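/- Fix constants $\sigma_{\min},\sigma_{\max},a,b>0$. There is a constant $c>0$, depending only on $\sigma_{\min},\sigma_{\max}$ and on the prior hyperparameters $a,b$, such that the following holds for all $\alpha\in(0,1)$, all integers $n<d$, all $C_{\rm x}>0$, $C_1\in\mathbb R$, all $\sigma_0>0$, $\theta_0\in\mathbb R^d$, all sets $\Theta\subset\mathbb R^d$ with $\theta_0\notin\Theta$, and all probability distributions $\nu$ on $\mathbb R^d$. For $\theta\in\mathbb R^d$, $\sigma>0$ let $P_{\theta,\sigma}$ be the law of $(Y,X)\in\mathbb R\times\mathbb R^d$ with $X\sim\nu$, $Y=X^\top\theta+\epsilon$, and $\epsilon\sim N(0,\sigma^2)$ independent of $X$. Let $(Y_i,X_i)_{i=1}^n$ be i.i.d. with law $P_{\theta_0,\sigma_0}$ and let $\mathbb E$ be the expectation over these data. Put $\tau=1/(C_{\rm x}\sqrt{nd})$ and let $s^*=\|\theta_0\|_0$ be the number of nonzero entries of $\theta_0$. Let the prior on $(\theta,\sigma)$ be $\pi_\theta\otimes\pi_\sigma$, where $\pi_\theta$ is supported by $\{\theta\in\mathbb R^d:\|\theta\|_1\le C_1\}$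 with density proportional to $\prod_{i=1}^d(\tau^2+\theta_i^2)^{-2}$ there, and where under $\pi_\sigma$ the variance $\sigma^2$ has the inverse-Gamma distribution $IG(a,b)$, with density $\frac{b^a}{\Gamma(a)}x^{-a-1}e^{-b/x}$ on $(0,\infty)$. Let $\Pi_n$ be the (regular) posterior distribution of $(\theta,\sigma)$ given the data, that is, $$\Pi_n(d\theta,d\sigma)\propto\prod_{i=1}^n\frac1{\sqrt{2\pi\sigma^2}}\,e^{-(Y_i-X_i^\top\theta)^2/(2\sigma^2)}\;\pi_\theta(d\theta)\,\pi_\sigma(d\sigma).$$ Assume that $\mathbb E\|X_1\|_2^2<C_{\rm x}^2$, that $(2\sigma_{\min})^{-1}<\sigma_0^2<(2\sigma_{\max})^{-1}$, that $1\le s^*<n$, and that $\|\theta_0\|_1\le C_1-2d\tau$. Then $$\mathbb E\left[\int D_\alpha(P_{\theta,\sigma},P_{\theta_0,\sigma_0})\,\Pi_n(d\theta,d\sigma)\right]\le\frac{\alpha}{1-\alpha}\,\inf_{\theta\in\Theta}\mathcal K(P_{\theta_0,\sigma_0},P_{\theta,\sigma_0})+\frac{1+\alpha}{1-\alpha}\,\varepsilon_n,\qquad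 \varepsilon_n=\frac{c\,s^*}{n}\log\left(\frac{C_{\rm x}C_1\sqrt{nd}}{s^*}\right).$$ Here, for probability distributions $P,R$ and any measure $\mu$ dominating both, $D_\alpha(P,R)=\frac1{\alpha-1}\log\int\left(\frac{dP}{d\mu}\right)^\alpha\left(\frac{dR}{d\mu}\right)^{1-\alpha}d\mu\in[0,\infty]$ is the $\alpha$-Rényi divergence, and $\mathcal K(P,R)$ is the Kullback-Leibler divergence, equal to $\int\log\frac{dP}{dR}\,dP$ if $P\ll R$ and to $+\infty$ otherwise. The infimum is the minimum over $\Theta$ whenever that is attained (and $+\infty$ if $\Theta=\emptyset$). -/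

import Mathlib

open MeasureTheory ProbabilityTheory
open scoped ENNReal NNReal

noncomputable section

namespace SparseRegression

/-- `d`-dimensional Euclidean space: regression coefficients and covariates. -/
abbrev Vec (d : ℕ) : Type := EuclideanSpace ℝ (Fin d)

/-- One observation `Z = (Y, X)`. -/
abbrev Obs (d : ℕ) : Type := ℝ × Vec d

/-- The `ℓ₁` norm of a vector. -/
def l1norm {d : ℕ} (θ : Vec d) : ℝ := ∑ i, |θ i|

/-- The number of nonzero entries of a vector. -/
def l0norm {d : ℕ} (θ : Vec d) : ℕ := {i : Fin d | θ i ≠ 0}.ncard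

/-- The closed `ℓ₁` ball of radius `C` around the origin. -/
def l1ball (d : ℕ) (C : ℝ) : Set (Vec d) := {θ | l1norm θ ≤ C}

/-- The `α`-Rényi divergence
`D_α(P, R) = (α - 1)⁻¹ log ∫ (dP/dμ)^α (dR/dμ)^(1-α) dμ`, with the dominating measure
`μ = P + R`. It is meant for `α ∈ (0, 1)` and probability measures; the integral then lies in
`[0, 1]`, and the divergence in `[0, ∞]` is `∞` exactly when the integral is `0`. -/
def renyiDiv {Ω : Type*} [MeasurableSpace Ω] (α : ℝ) (P R : Measure Ω) : ℝ≥0∞ :=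
  (((1 / (α - 1) : ℝ) : EReal) *
    ENNReal.log (∫⁻ x, P.rnDeriv (P + R) x ^ α * R.rnDeriv (P + R) x ^ (1 - α) ∂(P + R))).toENNReal

/-- The law `P_{θ,σ}` of `(Y, X)` where `X ∼ ν`, `Y = Xᵀθ + ε`, and `ε ∼ N(0, σ²)` is independent
of `X`. -/
def model {d : ℕ} (ν : Measure (Vec d)) (θ : Vec d) (σ : ℝ) : Measure (Obs d) :=
  (ν.prod (gaussianReal 0 (Real.toNNReal (σ ^ 2)))).map
    (fun p => (inner ℝ p.1 θ + p.2, p.1))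

/-- The likelihood `L_n(θ, σ) = ∏ p_{θ,σ}(Y_i, X_i)`, where `p_{θ,σ}(y, x)` is the density of
`P_{θ,σ}` with respect to the product of Lebesgue measure and the law of the covariates, that is,
the `N(xᵀθ, σ²)` density at `y`. -/
def likelihood {n d : ℕ} (z : Fin n → Obs d) (θ : Vec d) (σ : ℝ) : ℝ≥0∞ :=
  ∏ i, gaussianPDF (inner ℝ (z i).2 θ) (Real.toNNReal (σ ^ 2)) (z i).1

/-- The multiple of total mass one of a measure whose total mass is positive and finite. -/
def normalizeMeasure {Ω : Type*} [MeasurableSpace Ω] (μ : Measure Ω) : Measure Ω :=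
  (μ Set.univ)⁻¹ • μ

/-- The scaled Student prior on `θ`: the probability measure supported by `{‖θ‖₁ ≤ C₁}` with
Lebesgue density proportional to `∏ (τ² + θ_i²)⁻²` there. -/
def priorTheta (d : ℕ) (τ C₁ : ℝ) : Measure (Vec d) :=
  normalizeMeasure ((volume.restrict (l1ball d C₁)).withDensity
    fun θ => ENNReal.ofReal (∏ i, ((τ ^ 2 + θ i ^ 2) ^ 2)⁻¹))

/-- The inverse-Gamma distribution `IG(a, b)` with shape `a` and scale `b`. -/
def invGamma (a b : ℝ) : Measure ℝ :=
  (volume.restrict (Set.Ioi 0)).withDensity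
    fun x => ENNReal.ofReal (b ^ a / Real.Gamma a * x ^ (-a - 1) * Real.exp (-b / x))

/-- The prior on `σ > 0` under which `σ² ∼ IG(a, b)`. -/
def priorSigma (a b : ℝ) : Measure ℝ := (invGamma a b).map Real.sqrt

/-- The prior `π(θ, σ) = π_θ(θ) π_σ(σ)`. -/
def prior (d : ℕ) (τ C₁ a b : ℝ) : Measure (Vec d × ℝ) :=
  (priorTheta d τ C₁).prod (priorSigma a b)

/-- The (regular) posterior `Π_n(dθ, dσ) ∝ L_n(θ, σ) π(dθ, dσ)` given the data `z`. -/
def posterior {n d : ℕ} (π : Measure (Vec d × ℝ)) (z : Fin n → Obs d) : Measure (Vec d × ℝ) :=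
  normalizeMeasure (π.withDensity fun p => likelihood z p.1 p.2)

/-- The scale `τ = 1 / (C_x √(nd))` of the prior on `θ`. -/
def tau (n d : ℕ) (Cx : ℝ) : ℝ := 1 / (Cx * Real.sqrt (n * d))

/-- The rate `s log (C_x C₁ √(nd) / s) / n` (up to the constant in front of it). -/
def rate (n d s : ℕ) (Cx C₁ : ℝ) : ℝ :=
  s * Real.log (Cx * C₁ * Real.sqrt (n * d) / s) / n

end SparseRegression

end

namespace SparseRegression

/-! ### Product measures -/

/-! The posterior is not tempered, so the usual change of measure leaves a positive power of the
likelihood ratio to be controlled. Write `L` and `L₀` for the likelihoods at `(θ, σ)` and at the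
truth, `Z` for the evidence and `A` for the affinity of one observation. Up to truncation at `0`, `n
(1 - α) D_α = -n log A`, and `-n log A = log[(Z/L) A⁻ⁿ (L/L₀)^α] + (1 - α) log(L/L₀) + log(L₀/Z)`.
In the first term use `log x ≤ x`: the factor `Z/L` turns a posterior integral into a prior
integral, and averaging over the data leaves at most the mass of the prior
(`lintegral_fractional_le`).

The middle term needs a bound on `L/L₀` that holds for all parameters at once. It comes from a
domination `L ≤ e^g U` (`likelihood_le_mixLik`), where `U` is a mixture of likelihoods with `E[U/L₀]
≤ 1` (`lintegral_mixLik_div_le`) and `e^(21g/20)` has a controlled prior integral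
(`exists_lintegral_exp_excess_prior`). That the exponent exceeds one is essential: from `log(L/L₀) =
21 log(L/L₀) - 20 log(L/L₀)`, `log(L/L₀) ≤ 20 log[(Z/L) e^(21g/20)] + 20 log(L₀/Z) + 21 log(U/L₀)`,
and the factor `Z/L` again replaces the posterior by the prior. This algebra is
`neg_log_affinity_le`.

To build `U`, move the precision down to a geometric grid and round `θ` at random, without bias, to
a lattice. The log-likelihood is quadratic in `θ`, so rounding costs on average only a variance
term, and Jensen's inequality bounds `L` by a weighted sum over neighbouring lattice points
(`logLik_le_round`). The lattice weights sit mostly at `0` and have polynomial tails. Mesh and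
weights depend on the covariates but not on the responses, so `U` integrates to at most one for each
fixed design. The prior integral of `e^(21g/20)` factorizes over coordinates. The Student prior has
moments of order `5/2`, enough for the polynomial rounding cost, and the remaining multiple of `σ⁻²`
is absorbed by the factor `e^(-b/σ²)` of the inverse-Gamma density.

For `log(L₀/Z)`, restrict the prior to a neighbourhood of the truth. Polynomial tails make the shift
to `θ₀` cost only logarithms over the support of `θ₀`; Cauchy–Schwarz replaces `1/Z` by an average
of `1/L`, and `E[L₀/L]` is an explicit Gaussian integral (`exists_lintegral_inv_evidence_le`).

All costs are bounded by the shift cost and `log d` times a normalized design size of mean at most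
`2`; `rate_bounds` compares them with `n` times the rate. The Kullback–Leibler term is nonnegative
and is added at the very end. -/

theorem lintegral_fin_prod_eq_prod {n : ℕ} {E : Type*} [MeasurableSpace E]
    {μ : Fin n → Measure E} [∀ i, SigmaFinite (μ i)] {f : Fin n → E → ℝ≥0∞}
    (hf : ∀ i, Measurable (f i)) :
    ∫⁻ x, ∏ i, f i (x i) ∂(Measure.pi μ) = ∏ i, ∫⁻ t, f i t ∂(μ i) := by
  induction n with
  | zero => simp
  | succ n ih =>
    have h := (measurePreserving_piFinSuccAbove μ 0).symm
    rw [← h.lintegral_comp_emb (MeasurableEquiv.measurableEmbedding _)]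
    simp_rw [MeasurableEquiv.piFinSuccAbove_symm_apply, Fin.insertNthEquiv,
      Fin.prod_univ_succ, Fin.insertNth_zero]
    simp only [Fin.zero_succAbove]
    rw [← ih (μ := fun j => μ j.succ) (fun i => hf _)]
    exact lintegral_prod_mul (hf 0).aemeasurable
      (Finset.measurable_prod _ fun i _ => (hf _).comp (measurable_pi_apply i)).aemeasurable

theorem pi_withDensity {n : ℕ} {E : Type*} [MeasurableSpace E] (μ : Measure E) [SigmaFinite μ]
    {f : E → ℝ≥0∞} (hf : Measurable f) [SigmaFinite (μ.withDensity f)] :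
    Measure.pi (fun _ : Fin n => μ.withDensity f)
      = (Measure.pi fun _ : Fin n => μ).withDensity fun x => ∏ i, f (x i) := by
  refine Measure.pi_eq fun s hs => ?_
  rw [withDensity_apply _ (MeasurableSet.univ_pi hs), ← lintegral_indicator (MeasurableSet.univ_pi hs)]
  have : ∀ x : Fin n → E, (Set.univ.pi s).indicator (fun x => ∏ i, f (x i)) x
      = ∏ i, (s i).indicator f (x i) := by
    intro x
    by_cases hx : x ∈ Set.univ.pi s
    · rw [Set.indicator_of_mem hx]
      exact Finset.prod_congr rfl fun i _ => (Set.indicator_of_mem (hx i trivial) _).symm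
    · rw [Set.indicator_of_notMem hx]
      simp only [Set.mem_pi, not_forall] at hx
      obtain ⟨i, _, hi⟩ := hx
      exact (Finset.prod_eq_zero (Finset.mem_univ i) (Set.indicator_of_notMem hi _)).symm
  simp_rw [this]
  rw [lintegral_fin_prod_eq_prod fun i => hf.indicator (hs i)]
  refine Finset.prod_congr rfl fun i _ => ?_
  rw [lintegral_indicator (hs i), withDensity_apply _ (hs i)]

/-! ### The likelihood -/

/-- Residual sum of squares. -/
noncomputable def rss {n d : ℕ} (z : Fin n → Obs d) (θ : Vec d) : ℝ :=
  ∑ i, ((z i).1 - inner ℝ (z i).2 θ) ^ 2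

/-- The logarithm of the likelihood. -/
noncomputable def logLik {n d : ℕ} (z : Fin n → Obs d) (θ : Vec d) (σ : ℝ) : ℝ :=
  -(n * Real.log (Real.sqrt (2 * Real.pi) * σ)) - rss z θ / (2 * σ ^ 2)

theorem rss_nonneg {n d : ℕ} (z : Fin n → Obs d) (θ : Vec d) : 0 ≤ rss z θ :=
  Finset.sum_nonneg fun _ _ => sq_nonneg _

theorem gaussianPDF_eq_exp {σ : ℝ} (hσ : 0 < σ) (m y : ℝ) :
    gaussianPDF m (Real.toNNReal (σ ^ 2)) y = ENNReal.ofReal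
      (Real.exp (-Real.log (Real.sqrt (2 * Real.pi) * σ) - (y - m) ^ 2 / (2 * σ ^ 2))) := by
  rw [gaussianPDF, gaussianPDFReal, Real.coe_toNNReal _ (sq_nonneg σ), sub_eq_add_neg (-Real.log _),
    Real.exp_add, Real.exp_neg, Real.exp_log (by positivity), Real.sqrt_mul (by positivity),
    Real.sqrt_sq hσ.le, neg_div]

theorem likelihood_eq_exp {n d : ℕ} (z : Fin n → Obs d) (θ : Vec d) {σ : ℝ} (hσ : 0 < σ) :
    likelihood z θ σ = ENNReal.ofReal (Real.exp (logLik z θ σ)) := by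
  simp only [likelihood, gaussianPDF_eq_exp hσ]
  rw [← ENNReal.ofReal_prod_of_nonneg fun _ _ => (Real.exp_pos _).le, ← Real.exp_sum,
    Finset.sum_sub_distrib, ← Finset.sum_div]
  simp [logLik, rss]

theorem likelihood_ne_zero {n d : ℕ} (z : Fin n → Obs d) (θ : Vec d) {σ : ℝ} (hσ : 0 < σ) :
    likelihood z θ σ ≠ 0 := by
  rw [likelihood_eq_exp z θ hσ]; simp [Real.exp_pos]

theorem likelihood_ne_top {n d : ℕ} (z : Fin n → Obs d) (θ : Vec d) (σ : ℝ) :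
    likelihood z θ σ ≠ ∞ :=
  ENNReal.prod_ne_top fun _ _ => ENNReal.ofReal_ne_top

theorem measurable_gaussianPDF_comp {Ω : Type*} [MeasurableSpace Ω] {m σ y : Ω → ℝ}
    (hm : Measurable m) (hσ : Measurable σ) (hy : Measurable y) :
    Measurable fun ω => gaussianPDF (m ω) (Real.toNNReal (σ ω ^ 2)) (y ω) :=
  (measurable_uncurry_gaussianPDFReal.comp
    (hm.prodMk ((hσ.pow_const 2).real_toNNReal.prodMk hy))).ennreal_ofReal

theorem measurable_likelihood_comp {n d : ℕ} {Ω : Type*} [MeasurableSpace Ω]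
    {z : Ω → Fin n → Obs d} {θ : Ω → Vec d} {σ : Ω → ℝ}
    (hz : Measurable z) (hθ : Measurable θ) (hσ : Measurable σ) :
    Measurable fun ω => likelihood (z ω) (θ ω) (σ ω) := by
  refine Finset.measurable_prod _ fun i _ => ?_
  have hzi : Measurable fun ω => z ω i := (measurable_pi_apply i).comp hz
  exact measurable_gaussianPDF_comp (hzi.snd.inner hθ) hσ hzi.fst

/-- The density of one observation. -/
noncomputable def obsDensity {d : ℕ} (θ : Vec d) (σ : ℝ) (o : Obs d) : ℝ≥0∞ :=
  gaussianPDF (inner ℝ o.2 θ) (Real.toNNReal (σ ^ 2)) o.1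

theorem measurable_obsDensity {d : ℕ} (θ : Vec d) (σ : ℝ) : Measurable (obsDensity θ σ) :=
  measurable_gaussianPDF_comp (measurable_snd.inner measurable_const) measurable_const measurable_fst

theorem toNNReal_sq_ne_zero {σ : ℝ} (hσ : 0 < σ) : Real.toNNReal (σ ^ 2) ≠ 0 := by
  simp [hσ.ne']

/-- Translating the noise by the regression mean gives a Gaussian in `y` for each `x`. The base
measure is the same for all parameters, so likelihood ratios are pointwise quotients. -/
theorem model_eq_withDensity {d : ℕ} (ν : Measure (Vec d)) [IsProbabilityMeasure ν] (θ : Vec d)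
    {σ : ℝ} (hσ : 0 < σ) :
    model ν θ σ = ((volume : Measure ℝ).prod ν).withDensity (obsDensity θ σ) := by
  have hv := toNNReal_sq_ne_zero hσ
  have hm : Measurable fun p : Vec d × ℝ => ((inner ℝ p.1 θ + p.2, p.1) : Obs d) :=
    ((measurable_fst.inner measurable_const).add measurable_snd).prodMk measurable_fst
  refine Measure.ext_of_lintegral _ fun F hF => ?_
  rw [model, lintegral_map hF hm, lintegral_withDensity_eq_lintegral_mul _
    (measurable_obsDensity θ σ) hF, lintegral_prod_symm _ ((measurable_obsDensity θ σ).mul hF).aemeasurable,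
    lintegral_prod (fun p : Vec d × ℝ => F (inner ℝ p.1 θ + p.2, p.1)) (hF.comp hm).aemeasurable]
  refine lintegral_congr fun x => ?_
  have hF' : Measurable fun y : ℝ => F (y, x) := hF.comp (measurable_id.prodMk measurable_const)
  calc ∫⁻ y, F (inner ℝ x θ + y, x) ∂(gaussianReal 0 (Real.toNNReal (σ ^ 2)))
      = ∫⁻ y, F (y, x) ∂((gaussianReal 0 (Real.toNNReal (σ ^ 2))).map (inner ℝ x θ + ·)) := by
        rw [lintegral_map hF' (measurable_const_add _)]
    _ = ∫⁻ y, F (y, x) ∂(gaussianReal (inner ℝ x θ) (Real.toNNReal (σ ^ 2))) := by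
        rw [gaussianReal_map_const_add, zero_add]
    _ = _ := by
        rw [gaussianReal_of_var_ne_zero _ hv,
          lintegral_withDensity_eq_lintegral_mul _ (measurable_gaussianPDF _ _) hF']
        rfl

instance isProbabilityMeasure_model {d : ℕ} (ν : Measure (Vec d)) [IsProbabilityMeasure ν]
    (θ : Vec d) (σ : ℝ) : IsProbabilityMeasure (model ν θ σ) :=
  Measure.isProbabilityMeasure_map
    (((measurable_fst.inner measurable_const).add measurable_snd).prodMk measurable_fst).aemeasurable

theorem lintegral_pi_model {n d : ℕ} (ν : Measure (Vec d)) [IsProbabilityMeasure ν] (θ : Vec d)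
    {σ : ℝ} (hσ : 0 < σ) {F : (Fin n → Obs d) → ℝ≥0∞} (hF : Measurable F) :
    ∫⁻ z, F z ∂(Measure.pi fun _ : Fin n => model ν θ σ)
      = ∫⁻ z, likelihood z θ σ * F z ∂(Measure.pi fun _ : Fin n => (volume : Measure ℝ).prod ν) := by
  have : IsProbabilityMeasure (((volume : Measure ℝ).prod ν).withDensity (obsDensity θ σ)) := by
    rw [← model_eq_withDensity ν θ hσ]; infer_instance
  rw [model_eq_withDensity ν θ hσ, pi_withDensity _ (measurable_obsDensity θ σ),
    lintegral_withDensity_eq_lintegral_mul _ _ hF]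
  · rfl
  · exact measurable_likelihood_comp measurable_id measurable_const measurable_const

/-- The data with covariates `x` and responses `y`. -/
def mkData {n d : ℕ} (x : Fin n → Vec d) (y : Fin n → ℝ) : Fin n → Obs d := fun i => (y i, x i)

theorem measurable_mkData {n d : ℕ} :
    Measurable fun p : (Fin n → Vec d) × (Fin n → ℝ) => mkData p.1 p.2 :=
  measurable_pi_lambda _ fun i =>
    ((measurable_pi_apply i).comp measurable_snd).prodMk ((measurable_pi_apply i).comp measurable_fst)

/-- Conditioning on the design: the mixture is normalized only for fixed covariates, since its mesh
depends on them. -/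
theorem lintegral_pi_base {n d : ℕ} (ν : Measure (Vec d)) [IsProbabilityMeasure ν]
    {F : (Fin n → Obs d) → ℝ≥0∞} (hF : Measurable F) :
    ∫⁻ z, F z ∂(Measure.pi fun _ : Fin n => (volume : Measure ℝ).prod ν)
      = ∫⁻ x, ∫⁻ y, F (mkData x y) ∂(Measure.pi fun _ : Fin n => (volume : Measure ℝ))
          ∂(Measure.pi fun _ : Fin n => ν) := by
  have h := (measurePreserving_arrowProdEquivProdArrow ℝ (Vec d) (Fin n)
    (fun _ => (volume : Measure ℝ)) (fun _ => ν)).symm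
  rw [← h.lintegral_comp_emb (MeasurableEquiv.measurableEmbedding _),
    lintegral_prod_symm]
  · rfl
  · exact (hF.comp (MeasurableEquiv.measurable _)).aemeasurable

theorem lintegral_likelihood {n d : ℕ} (x : Fin n → Vec d) (θ : Vec d) {σ : ℝ} (hσ : 0 < σ) :
    ∫⁻ y, likelihood (mkData x y) θ σ ∂(Measure.pi fun _ : Fin n => (volume : Measure ℝ)) = 1 := by
  simp only [likelihood, mkData]
  rw [lintegral_fin_prod_eq_prod (f := fun i y => gaussianPDF (inner ℝ (x i) θ) (Real.toNNReal (σ ^ 2)) y)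
    fun i => measurable_gaussianPDF _ _]
  exact Finset.prod_eq_one fun i _ => lintegral_gaussianPDF_eq_one _ (toNNReal_sq_ne_zero hσ)

/-! ### The affinity -/

/-- The `α`-affinity `∫ p^α r^(1-α)` of two models. -/
noncomputable def affinity {d : ℕ} (ν : Measure (Vec d)) (α : ℝ) (θ₀ : Vec d) (σ₀ : ℝ)
    (p : Vec d × ℝ) : ℝ≥0∞ :=
  ∫⁻ o, obsDensity p.1 p.2 o ^ α * obsDensity θ₀ σ₀ o ^ (1 - α) ∂((volume : Measure ℝ).prod ν)

theorem obsDensity_pos {d : ℕ} (θ : Vec d) {σ : ℝ} (hσ : 0 < σ) (o : Obs d) :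
    0 < obsDensity θ σ o := gaussianPDF_pos _ (toNNReal_sq_ne_zero hσ) _

theorem obsDensity_ne_top {d : ℕ} (θ : Vec d) (σ : ℝ) (o : Obs d) : obsDensity θ σ o ≠ ∞ :=
  ENNReal.ofReal_ne_top

theorem affinity_ne_zero {d : ℕ} (ν : Measure (Vec d)) [IsProbabilityMeasure ν] {α : ℝ}
    (θ₀ : Vec d) {σ₀ : ℝ} (hσ₀ : 0 < σ₀) (p : Vec d × ℝ) (hp : 0 < p.2) :
    affinity ν α θ₀ σ₀ p ≠ 0 := by
  have hm : Measurable fun o => obsDensity p.1 p.2 o ^ α * obsDensity θ₀ σ₀ o ^ (1 - α) :=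
    ((measurable_obsDensity _ _).pow_const _).mul ((measurable_obsDensity _ _).pow_const _)
  rw [affinity, Ne, lintegral_eq_zero_iff hm]
  intro h
  have h2 : ∀ᵐ o : Obs d ∂((volume : Measure ℝ).prod ν), False := by
    filter_upwards [h] with o ho
    refine absurd ho (mul_ne_zero ?_ ?_)
    · exact (ENNReal.rpow_pos (obsDensity_pos _ hp _) (obsDensity_ne_top _ _ _)).ne'
    · exact (ENNReal.rpow_pos (obsDensity_pos _ hσ₀ _) (obsDensity_ne_top _ _ _)).ne'
  rw [ae_iff] at h2
  simp only [not_false_eq_true, Set.ofPred_true, ← Set.univ_prod_univ, Measure.prod_prod] at h2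
  simp at h2

theorem measurable_affinity {d : ℕ} (ν : Measure (Vec d)) [IsProbabilityMeasure ν] (α : ℝ)
    (θ₀ : Vec d) (σ₀ : ℝ) : Measurable (affinity ν α θ₀ σ₀) := by
  refine Measurable.lintegral_prod_right' (f := fun q : (Vec d × ℝ) × Obs d =>
    obsDensity q.1.1 q.1.2 q.2 ^ α * obsDensity θ₀ σ₀ q.2 ^ (1 - α)) ?_
  refine Measurable.mul ?_ (((measurable_obsDensity θ₀ σ₀).comp measurable_snd).pow_const _)
  exact (measurable_gaussianPDF_comp (measurable_snd.snd.inner measurable_fst.fst)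
    measurable_fst.snd measurable_snd.fst).pow_const _

/-- The Rényi integral does not depend on the dominating measure: the densities with respect to the
sum are `f/(f+g)` and `g/(f+g)`, and the powers of `f+g` cancel because `α + (1 - α) = 1`. -/
theorem renyiDiv_model {d : ℕ} (ν : Measure (Vec d)) [IsProbabilityMeasure ν] {α : ℝ}
    (hα0 : 0 < α) (hα1 : α < 1) (θ₀ : Vec d) {σ₀ : ℝ} (hσ₀ : 0 < σ₀) (p : Vec d × ℝ)
    (hp : 0 < p.2) :
    renyiDiv α (model ν p.1 p.2) (model ν θ₀ σ₀)
      = (((1 / (α - 1) : ℝ) : EReal) * ENNReal.log (affinity ν α θ₀ σ₀ p)).toENNReal := by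
  set β : Measure (Obs d) := (volume : Measure ℝ).prod ν with hβ
  set f := obsDensity (d := d) p.1 p.2 with hf
  set g := obsDensity θ₀ σ₀ with hg
  have hfm : Measurable f := measurable_obsDensity _ _
  have hgm : Measurable g := measurable_obsDensity _ _
  have hP := model_eq_withDensity ν p.1 hp
  have hR := model_eq_withDensity ν θ₀ hσ₀
  have hsum : model ν p.1 p.2 + model ν θ₀ σ₀ = β.withDensity (f + g) := by
    rw [hP, hR, withDensity_add_left hfm]
  have hpos : ∀ o, (f + g) o ≠ 0 := fun o => by
    simp only [Pi.add_apply, ne_eq, add_eq_zero, not_and_or]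
    exact Or.inl (obsDensity_pos _ hp o).ne'
  have htop : ∀ o, (f + g) o ≠ ∞ := fun o =>
    ENNReal.add_ne_top.2 ⟨obsDensity_ne_top _ _ _, obsDensity_ne_top _ _ _⟩
  have key : ∀ h : Obs d → ℝ≥0∞, Measurable h → ∀ Q : Measure (Obs d), Q = β.withDensity h →
      Q.rnDeriv (model ν p.1 p.2 + model ν θ₀ σ₀)
        =ᵐ[model ν p.1 p.2 + model ν θ₀ σ₀] fun o => h o / (f + g) o := by
    intro h hh Q hQ
    have : Q = (model ν p.1 p.2 + model ν θ₀ σ₀).withDensity (fun o => h o / (f + g) o) := by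
      refine Eq.trans ?_ (congrArg (fun m => Measure.withDensity m fun o => h o / (f + g) o) hsum.symm)
      refine Eq.trans ?_ (withDensity_mul β (hfm.add hgm) (hh.div (hfm.add hgm)))
      rw [hQ]
      congr 1
      funext o
      simp only [Pi.mul_apply]
      exact (ENNReal.mul_div_cancel (hpos o) (htop o)).symm
    conv_lhs => rw [this]
    exact Measure.rnDeriv_withDensity _ (hh.div (hfm.add hgm))
  have hk1 := key f hfm _ hP
  have hk2 := key g hgm _ hR
  rw [renyiDiv]
  congr 3
  have e1 : ∫⁻ x, (model ν p.1 p.2).rnDeriv (model ν p.1 p.2 + model ν θ₀ σ₀) x ^ α *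
        (model ν θ₀ σ₀).rnDeriv (model ν p.1 p.2 + model ν θ₀ σ₀) x ^ (1 - α)
        ∂(model ν p.1 p.2 + model ν θ₀ σ₀)
      = ∫⁻ x, (f x / (f + g) x) ^ α * (g x / (f + g) x) ^ (1 - α)
        ∂(model ν p.1 p.2 + model ν θ₀ σ₀) := by
    refine lintegral_congr_ae ?_
    filter_upwards [hk1, hk2] with o h1 h2
    rw [h1, h2]
  rw [e1, hsum]
  refine (lintegral_withDensity_eq_lintegral_mul β (hfm.add hgm)
    (((hfm.div (hfm.add hgm)).pow_const α).mul
      ((hgm.div (hfm.add hgm)).pow_const (1 - α)))).trans ?_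
  refine lintegral_congr fun o => ?_
  simp only [Pi.mul_apply, Pi.div_apply]
  rw [ENNReal.div_rpow_of_nonneg _ _ hα0.le, ENNReal.div_rpow_of_nonneg _ _ (by linarith),
    div_eq_mul_inv, div_eq_mul_inv]
  have hc : (f + g) o = ((f + g) o) ^ α * ((f + g) o) ^ (1 - α) := by
    rw [← ENNReal.rpow_add _ _ (hpos o) (htop o)]; simp
  have hn : ∀ r : ℝ, ((f + g) o) ^ r * (((f + g) o) ^ r)⁻¹ = 1 := fun r =>
    ENNReal.mul_inv_cancel (ENNReal.rpow_pos (pos_iff_ne_zero.2 (hpos o)) (htop o)).ne'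
      (ENNReal.rpow_ne_top_of_ne_zero (hpos o) (htop o))
  calc (f + g) o * (f o ^ α * ((f + g) o ^ α)⁻¹ * (g o ^ (1 - α) * ((f + g) o ^ (1 - α))⁻¹))
      = ((f + g) o) ^ α * ((f + g) o) ^ (1 - α) *
        (f o ^ α * ((f + g) o ^ α)⁻¹ * (g o ^ (1 - α) * ((f + g) o ^ (1 - α))⁻¹)) := by rw [← hc]
    _ = (f o ^ α * g o ^ (1 - α)) * (((f + g) o) ^ α * (((f + g) o) ^ α)⁻¹) *
        (((f + g) o) ^ (1 - α) * (((f + g) o) ^ (1 - α))⁻¹) := by ring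
    _ = _ := by rw [hn, hn, mul_one, mul_one]

/-- The `n`-sample affinity is the `n`-th power of the affinity. -/
theorem lintegral_likelihood_rpow {n d : ℕ} (ν : Measure (Vec d)) [IsProbabilityMeasure ν] {α : ℝ}
    (hα0 : 0 < α) (hα1 : α < 1) (θ₀ : Vec d) (σ₀ : ℝ) (p : Vec d × ℝ) :
    ∫⁻ z, likelihood z p.1 p.2 ^ α * likelihood z θ₀ σ₀ ^ (1 - α)
        ∂(Measure.pi fun _ : Fin n => (volume : Measure ℝ).prod ν)
      = affinity ν α θ₀ σ₀ p ^ n := by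
  have : ∀ z : Fin n → Obs d, likelihood z p.1 p.2 ^ α * likelihood z θ₀ σ₀ ^ (1 - α)
      = ∏ i, (obsDensity p.1 p.2 (z i) ^ α * obsDensity θ₀ σ₀ (z i) ^ (1 - α)) := by
    intro z
    rw [Finset.prod_mul_distrib, ENNReal.prod_rpow_of_nonneg hα0.le,
      ENNReal.prod_rpow_of_nonneg (by linarith)]
    rfl
  simp_rw [this]
  have hs : SigmaFinite ((volume : Measure ℝ).prod ν) := inferInstance
  have hm : Measurable fun o => obsDensity p.1 p.2 o ^ α * obsDensity θ₀ σ₀ o ^ (1 - α) :=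
    ((measurable_obsDensity _ _).pow_const _).mul ((measurable_obsDensity _ _).pow_const _)
  refine (lintegral_fin_prod_eq_prod (n := n) (μ := fun _ => (volume : Measure ℝ).prod ν)
    (f := fun _ => _) fun _ => hm).trans ?_
  simp [affinity]

end SparseRegression

namespace SparseRegression

/-! ### Expectations over independent two-valued choices -/

section TwoPoint

variable {d : ℕ} {k : Fin d → Bool → ℝ}

/-- Expectation over independent choices with probabilities `k`. -/
def choiceExp (k : Fin d → Bool → ℝ) (φ : (Fin d → Bool) → ℝ) : ℝ := ∑ ε, (∏ i, k i (ε i)) * φ ε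

theorem choiceExp_prod (k g : Fin d → Bool → ℝ) :
    choiceExp k (fun ε => ∏ i, g i (ε i)) = ∏ i, ∑ b, k i b * g i b := by
  rw [Finset.prod_univ_sum]
  simp only [Fintype.piFinset_univ, choiceExp, Finset.prod_mul_distrib]

theorem choiceExp_sum {ι : Type*} (s : Finset ι) (k : Fin d → Bool → ℝ)
    (φ : ι → (Fin d → Bool) → ℝ) :
    choiceExp k (fun ε => ∑ j ∈ s, φ j ε) = ∑ j ∈ s, choiceExp k (φ j) := by
  simp only [choiceExp, Finset.mul_sum]
  exact Finset.sum_comm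

theorem choiceExp_add (k : Fin d → Bool → ℝ) (φ ψ : (Fin d → Bool) → ℝ) :
    choiceExp k (fun ε => φ ε + ψ ε) = choiceExp k φ + choiceExp k ψ := by
  simp only [choiceExp, mul_add, Finset.sum_add_distrib]

theorem choiceExp_const_mul (k : Fin d → Bool → ℝ) (c : ℝ) (φ : (Fin d → Bool) → ℝ) :
    choiceExp k (fun ε => c * φ ε) = c * choiceExp k φ := by
  simp only [choiceExp, Finset.mul_sum]
  exact Finset.sum_congr rfl fun _ _ => by ring

theorem choiceExp_const (hk : ∀ i, ∑ b, k i b = 1) (c : ℝ) : choiceExp k (fun _ => c) = c := by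
  have h := choiceExp_prod k fun _ _ => 1
  simp only [Finset.prod_const_one, mul_one, hk] at h
  have := choiceExp_const_mul k c fun _ => 1
  rw [h] at this
  simpa using this

theorem choiceExp_coord (hk : ∀ i, ∑ b, k i b = 1) (i : Fin d) (φ : Bool → ℝ) :
    choiceExp k (fun ε => φ (ε i)) = ∑ b, k i b * φ b := by
  have h := choiceExp_prod k fun j b => if j = i then φ b else 1
  simp only [Finset.prod_ite_eq', Finset.mem_univ, if_true] at h
  rw [h, Finset.prod_eq_single i]
  · simp
  · intro j _ hj; simpa [hj] using hk j
  · simp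

theorem choiceExp_mul_of_ne (hk : ∀ i, ∑ b, k i b = 1) {i j : Fin d} (hij : i ≠ j)
    (φ ψ : Bool → ℝ) :
    choiceExp k (fun ε => φ (ε i) * ψ (ε j)) = (∑ b, k i b * φ b) * ∑ b, k j b * ψ b := by
  have h := choiceExp_prod k fun l b => (if l = i then φ b else 1) * (if l = j then ψ b else 1)
  simp only [Finset.prod_mul_distrib, Finset.prod_ite_eq', Finset.mem_univ, if_true] at h
  rw [h, ← Finset.mul_prod_erase _ _ (Finset.mem_univ i),
    ← Finset.mul_prod_erase _ _ (Finset.mem_erase.2 ⟨hij.symm, Finset.mem_univ j⟩),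
    Finset.prod_eq_one, mul_one]
  · simp [hij, hij.symm]
  · intro l hl
    simp only [Finset.mem_erase, ne_eq, Finset.mem_univ, and_true] at hl
    simpa [hl.1, hl.2] using hk l

/-- Independent centred terms: all cross terms vanish and only variances remain. -/
theorem choiceExp_sq (hk : ∀ i, ∑ b, k i b = 1) (a : ℝ) (ξ : Fin d → Bool → ℝ)
    (hξ : ∀ i, ∑ b, k i b * ξ i b = 0) :
    choiceExp k (fun ε => (a + ∑ i, ξ i (ε i)) ^ 2) = a ^ 2 + ∑ i, ∑ b, k i b * ξ i b ^ 2 := by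
  have e : ∀ ε : Fin d → Bool, (a + ∑ i, ξ i (ε i)) ^ 2
      = a ^ 2 + (2 * a * ∑ i, ξ i (ε i) + ∑ i, ∑ j, ξ i (ε i) * ξ j (ε j)) := by
    intro ε
    rw [← Finset.sum_mul_sum]; ring
  simp_rw [e]
  rw [choiceExp_add, choiceExp_add, choiceExp_const hk, choiceExp_const_mul, choiceExp_sum,
    choiceExp_sum]
  simp_rw [choiceExp_sum, choiceExp_coord hk, hξ]
  simp only [Finset.sum_const_zero, mul_zero, zero_add]
  congr 1
  refine Finset.sum_congr rfl fun i _ => ?_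
  rw [Finset.sum_eq_single i]
  · have := choiceExp_coord hk i fun b => ξ i b * ξ i b
    simpa [pow_two] using this
  · intro j _ hj
    rw [choiceExp_mul_of_ne hk hj.symm, hξ, zero_mul]
  · simp

/-- Jensen's inequality for weights that are at most one. -/
theorem choiceExp_log_le (hk : ∀ i, ∑ b, k i b = 1) (hk0 : ∀ i b, 0 ≤ k i b)
    {x : (Fin d → Bool) → ℝ} (hx : ∀ ε, 0 < x ε) :
    choiceExp k (fun ε => Real.log (x ε)) ≤ Real.log (∑ ε, x ε) := by
  have hK : ∀ ε : Fin d → Bool, 0 ≤ ∏ i, k i (ε i) := fun ε => Finset.prod_nonneg fun i _ => hk0 i _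
  have hK1 : ∑ ε : Fin d → Bool, ∏ i, k i (ε i) = 1 := by
    simpa [choiceExp] using choiceExp_const hk 1
  have h := strictConcaveOn_log_Ioi.concaveOn.le_map_sum (t := Finset.univ)
    (w := fun ε : Fin d → Bool => ∏ i, k i (ε i)) (p := x) (fun ε _ => hK ε) hK1 (fun ε _ => hx ε)
  simp only [smul_eq_mul] at h
  refine h.trans (Real.log_le_log ?_ ?_)
  · obtain ⟨ε, _, hε⟩ : ∃ ε ∈ Finset.univ, 0 < ∏ i, k i ((ε : Fin d → Bool) i) := by
      by_contra! hc
      have := Finset.sum_nonpos hc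
      linarith
    exact Finset.sum_pos' (fun ε _ => mul_nonneg (hK ε) (hx ε).le)
      ⟨ε, Finset.mem_univ _, mul_pos hε (hx ε)⟩
  · refine Finset.sum_le_sum fun ε _ => mul_le_of_le_one_left (hx ε).le ?_
    rw [← hK1]
    exact Finset.single_le_sum (f := fun ε : Fin d → Bool => ∏ i, k i (ε i)) (fun ε _ => hK ε)
      (Finset.mem_univ ε)

end TwoPoint

/-! ### Unbiased rounding -/

/-- The two integers next to `r`. -/
noncomputable def roundAt (r : ℝ) (b : Bool) : ℤ := ⌊r⌋ + if b then 1 else 0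

/-- The probabilities of unbiased rounding. -/
noncomputable def roundProb (r : ℝ) (b : Bool) : ℝ := if b then Int.fract r else 1 - Int.fract r

theorem sum_roundProb (r : ℝ) : ∑ b, roundProb r b = 1 := by simp [roundProb]

theorem roundProb_nonneg (r : ℝ) (b : Bool) : 0 ≤ roundProb r b := by
  cases b
  · simpa [roundProb] using (Int.fract_lt_one r).le
  · simp [roundProb, Int.fract_nonneg]

theorem sum_roundProb_mul_sub (r : ℝ) : ∑ b, roundProb r b * (roundAt r b - r) = 0 := by
  simp only [roundProb, roundAt, Fintype.sum_bool, if_true, Bool.false_eq_true, if_false, Int.fract]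
  push_cast; ring

theorem sum_roundProb_mul_sq (r : ℝ) :
    ∑ b, roundProb r b * (roundAt r b - r) ^ 2 = Int.fract r * (1 - Int.fract r) := by
  simp only [roundProb, roundAt, Fintype.sum_bool, if_true, Bool.false_eq_true, if_false, Int.fract]
  push_cast; ring

/-- The point of the lattice with mesh widths `u` that has integer coordinates `m`. -/
noncomputable def latticePoint {d : ℕ} (u : Fin d → ℝ) (m : Fin d → ℤ) : Vec d :=
  WithLp.toLp 2 fun i => u i * m i

/-- Squared norms of the columns of the design. -/
noncomputable def colSq {n d : ℕ} (z : Fin n → Obs d) (i : Fin d) : ℝ := ∑ j, ((z j).2 i) ^ 2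

/-- The cost of rounding `r` at random: expected log-weight plus variance. -/
noncomputable def roundCost (ω : ℤ → ℝ) (c r : ℝ) : ℝ :=
  (∑ b, roundProb r b * -Real.log (ω (roundAt r b))) + c * (Int.fract r * (1 - Int.fract r))

/-- Unbiased rounding raises the expected residual sum of squares only by the variances of the
roundings. Jensen's inequality for the logarithm of weight times likelihood then moves the
expectation inside, at the price of the expected negative log-weights. -/
theorem logLik_le_round {n d : ℕ} (z : Fin n → Obs d) (θ : Vec d) {σ : ℝ}
    {u : Fin d → ℝ} (hu : ∀ i, 0 < u i) {ω : ℤ → ℝ} (hω : ∀ m, 0 < ω m) :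
    logLik z θ σ ≤ (∑ i, roundCost ω (colSq z i * u i ^ 2 / (2 * σ ^ 2)) (θ i / u i))
      + Real.log (∑ ε : Fin d → Bool, (∏ i, ω (roundAt (θ i / u i) (ε i))) *
          Real.exp (logLik z (latticePoint u fun i => roundAt (θ i / u i) (ε i)) σ)) := by
  set r : Fin d → ℝ := fun i => θ i / u i with hr
  set k : Fin d → Bool → ℝ := fun i => roundProb (r i) with hkdef
  have hk : ∀ i, ∑ b, k i b = 1 := fun i => sum_roundProb _
  set θε : (Fin d → Bool) → Vec d := fun ε => latticePoint u fun i => roundAt (r i) (ε i) with hθε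
  have hωpos : ∀ ε : Fin d → Bool, 0 < ∏ i, ω (roundAt (r i) (ε i)) :=
    fun ε => Finset.prod_pos fun i _ => hω _
  have hJ := choiceExp_log_le hk (fun i b => roundProb_nonneg _ _)
    (x := fun ε => (∏ i, ω (roundAt (r i) (ε i))) * Real.exp (logLik z (θε ε) σ))
    fun ε => mul_pos (hωpos ε) (Real.exp_pos _)
  -- The change of a residual is linear in the centred rounding errors, which is the form
  -- `choiceExp_sq` needs.
  have hin : ∀ (ε : Fin d → Bool) (j : Fin n), (z j).1 - inner ℝ (z j).2 (θε ε)
      = ((z j).1 - inner ℝ (z j).2 θ) + ∑ i, -((z j).2 i * u i) * (roundAt (r i) (ε i) - r i) := by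
    intro ε j
    simp only [PiLp.inner_apply, hθε, latticePoint, RCLike.inner_apply, conj_trivial]
    rw [sub_add, sub_right_inj, ← Finset.sum_sub_distrib]
    refine Finset.sum_congr rfl fun i _ => ?_
    have : u i ≠ 0 := (hu i).ne'
    simp only [hr]
    field_simp
    ring
  have hrss : choiceExp k (fun ε => rss z (θε ε))
      = rss z θ + ∑ i, colSq z i * u i ^ 2 * (Int.fract (r i) * (1 - Int.fract (r i))) := by
    simp only [rss]
    rw [choiceExp_sum]
    simp_rw [hin]
    have : ∀ j, choiceExp k (fun ε => ((z j).1 - inner ℝ (z j).2 θ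
          + ∑ i, -((z j).2 i * u i) * (roundAt (r i) (ε i) - r i)) ^ 2)
        = ((z j).1 - inner ℝ (z j).2 θ) ^ 2
          + ∑ i, ((z j).2 i) ^ 2 * u i ^ 2 * (Int.fract (r i) * (1 - Int.fract (r i))) := by
      intro j
      rw [choiceExp_sq hk _ fun i b => -((z j).2 i * u i) * (roundAt (r i) b - r i)]
      · congr 1
        refine Finset.sum_congr rfl fun i _ => ?_
        rw [← sum_roundProb_mul_sq, Finset.mul_sum]
        exact Finset.sum_congr rfl fun b _ => by simp only [hkdef]; ring
      · intro i
        have := sum_roundProb_mul_sub (r i)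
        calc _ = -((z j).2 i * u i) * ∑ b, roundProb (r i) b * (roundAt (r i) b - r i) := by
              rw [Finset.mul_sum]
              exact Finset.sum_congr rfl fun b _ => by simp only [hkdef]; ring
          _ = 0 := by rw [this, mul_zero]
    simp_rw [this]
    rw [Finset.sum_add_distrib, Finset.sum_comm]
    simp only [colSq, Finset.sum_mul]
  have hlog : ∀ ε, Real.log ((∏ i, ω (roundAt (r i) (ε i))) * Real.exp (logLik z (θε ε) σ))
      = (∑ i, Real.log (ω (roundAt (r i) (ε i)))) + (-(n * Real.log (Real.sqrt (2 * Real.pi) * σ))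
        + (-(1 / (2 * σ ^ 2))) * rss z (θε ε)) := by
    intro ε
    rw [Real.log_mul (hωpos ε).ne' (Real.exp_pos _).ne', Real.log_exp,
      Real.log_prod fun i _ => (hω _).ne', logLik]
    ring
  simp_rw [hlog] at hJ
  rw [choiceExp_add, choiceExp_add, choiceExp_const hk, choiceExp_const_mul, choiceExp_sum, hrss]
    at hJ
  simp_rw [fun i => choiceExp_coord hk i fun b => Real.log (ω (roundAt (r i) b))] at hJ
  have hc : ∑ i, roundCost ω (colSq z i * u i ^ 2 / (2 * σ ^ 2)) (r i)
      = -(∑ i, ∑ b, k i b * Real.log (ω (roundAt (r i) b))) + 1 / (2 * σ ^ 2) *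
        ∑ i, colSq z i * u i ^ 2 * (Int.fract (r i) * (1 - Int.fract (r i))) := by
    simp only [roundCost, Finset.sum_add_distrib, Finset.mul_sum, ← Finset.sum_neg_distrib]
    congr 1
    · exact Finset.sum_congr rfl fun i _ => Finset.sum_congr rfl fun b _ => by
        simp only [hkdef]; ring
    · exact Finset.sum_congr rfl fun i _ => by ring
  have hl : logLik z θ σ = -(n * Real.log (Real.sqrt (2 * Real.pi) * σ))
      + (-(1 / (2 * σ ^ 2))) * rss z θ := by rw [logLik]; ring
  rw [hc, hl]
  linarith [hJ]

end SparseRegression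

namespace SparseRegression

/-! ### Weights on the integers -/

/-- A heavy-tailed sub-probability on `ℤ` that puts most of its mass at `0`. -/
noncomputable def intWeight (q : ℝ) (m : ℤ) : ℝ := if m = 0 then 1 - q else q / (4 * (m : ℝ) ^ 2)

theorem intWeight_pos {q : ℝ} (hq0 : 0 < q) (hq1 : q ≤ 1 / 2) (m : ℤ) : 0 < intWeight q m := by
  unfold intWeight
  split_ifs with h
  · linarith
  · have : (m : ℝ) ≠ 0 := by exact_mod_cast h
    positivity

/-- The nonzero integers carry mass `(q/2) π²/6`, which is at most `q`; the crude bound `π² ≤ 10`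
suffices. -/
theorem tsum_intWeight_le {q : ℝ} (hq0 : 0 < q) (hq1 : q ≤ 1 / 2) :
    ∑' m : ℤ, ENNReal.ofReal (intWeight q m) ≤ 1 := by
  have hz : HasSum (fun n : ℕ => 1 / ((n : ℝ) + 1) ^ 2) (Real.pi ^ 2 / 6) := by
    have := (hasSum_nat_add_iff' 1).2 hasSum_zeta_two
    simpa using this
  have h1 : HasSum (fun n : ℕ => intWeight q ((n : ℤ) + 1)) (q / 4 * (Real.pi ^ 2 / 6)) := by
    refine (hz.mul_left (q / 4)).congr_fun fun n => ?_
    have : ((n : ℤ) + 1) ≠ 0 := by omega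
    simp only [intWeight, this, if_false]
    push_cast
    field_simp
  have h2 : HasSum (fun n : ℕ => intWeight q (-((n : ℤ) + 1))) (q / 4 * (Real.pi ^ 2 / 6)) := by
    refine h1.congr_fun fun n => ?_
    have : ((n : ℤ) + 1) ≠ 0 := by omega
    have h' : -((n : ℤ) + 1) ≠ 0 := by omega
    simp only [intWeight, this, if_false, h']
    push_cast
    ring
  have h3 : HasSum (intWeight q) (q / 4 * (Real.pi ^ 2 / 6) + (1 - q) + q / 4 * (Real.pi ^ 2 / 6)) := by
    have := HasSum.of_add_one_of_neg_add_one (f := intWeight q) h1 h2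
    simpa [intWeight] using this
  rw [← ENNReal.ofReal_tsum_of_nonneg (fun m => (intWeight_pos hq0 hq1 m).le) h3.summable, h3.tsum_eq]
  refine ENNReal.ofReal_le_one.2 ?_
  have : Real.pi ^ 2 ≤ 10 := by nlinarith [Real.pi_lt_d2, Real.pi_gt_three]
  nlinarith

/-! ### The cost of rounding one coordinate -/

theorem fract_mul_le_one (r : ℝ) : Int.fract r * (1 - Int.fract r) ≤ 1 := by
  nlinarith [Int.fract_nonneg r, Int.fract_lt_one r]

/-- Linearity of the variance near `0` makes coordinates far below the mesh width almost free. -/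
theorem fract_mul_le_abs (r : ℝ) : Int.fract r * (1 - Int.fract r) ≤ |r| := by
  have h0 := Int.fract_nonneg r
  have h1 := Int.fract_lt_one r
  rcases le_or_gt 0 r with hr | hr
  · have : Int.fract r ≤ r := by
      have : (0 : ℝ) ≤ ⌊r⌋ := by exact_mod_cast Int.floor_nonneg.2 hr
      unfold Int.fract; linarith
    rw [abs_of_nonneg hr]; nlinarith
  · have : (⌊r⌋ : ℝ) ≤ -1 := by
      have : ⌊r⌋ < 0 := Int.floor_lt.2 (by simpa using hr)
      exact_mod_cast (by omega : ⌊r⌋ ≤ -1)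
    have : r + 1 ≤ Int.fract r := by unfold Int.fract; linarith
    rw [abs_of_neg hr]; nlinarith

theorem neg_log_one_sub_le {q : ℝ} (hq0 : 0 < q) (hq1 : q ≤ 1 / 2) : -Real.log (1 - q) ≤ 2 * q := by
  rw [← Real.log_inv]
  refine (Real.log_le_sub_one_of_pos (inv_pos.2 (by linarith))).trans ?_
  rw [sub_le_iff_le_add, inv_le_iff_one_le_mul₀ (by linarith)]
  nlinarith

theorem neg_log_intWeight_le {q : ℝ} (hq0 : 0 < q) {m : ℤ} (hm : m ≠ 0)
    {r : ℝ} (hr : 1 ≤ r) (hmr : |(m : ℝ)| ≤ 2 * r) :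
    -Real.log (intWeight q m) ≤ Real.log (16 / q) + 2 * Real.log r := by
  have hm' : (m : ℝ) ≠ 0 := by exact_mod_cast hm
  rw [intWeight, if_neg hm, ← Real.log_inv, inv_div,
    show (2 : ℝ) * Real.log r = Real.log (r ^ 2) by rw [Real.log_pow]; norm_num,
    ← Real.log_mul (by positivity) (by positivity)]
  refine Real.log_le_log (by positivity) ?_
  rw [div_mul_eq_mul_div, div_le_div_iff_of_pos_right hq0, ← sq_abs]
  nlinarith [abs_nonneg (m : ℝ)]

/-- Below the mesh width a coordinate is rounded to `±1` with probability `|r|` and to `0`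
otherwise. Staying at `0` costs at most `2q`; leaving it costs `log(16/q)`, so that part is
proportional to `|r|`. -/
theorem roundCost_le_of_abs_le {q c r : ℝ} (hq0 : 0 < q) (hq1 : q ≤ 1 / 2) (hc : 0 ≤ c)
    (hr : |r| ≤ 1) :
    roundCost (intWeight q) c r ≤ 2 * q + (Real.log (16 / q) + c) * |r| := by
  have hcf : c * (Int.fract r * (1 - Int.fract r)) ≤ c * |r| :=
    mul_le_mul_of_nonneg_left (fract_mul_le_abs r) hc
  have hw : ∀ m : ℤ, |m| = 1 → -Real.log (intWeight q m) ≤ Real.log (16 / q) := by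
    intro m hm
    have h := neg_log_intWeight_le hq0 (m := m) (by rintro rfl; simp at hm) (le_refl (1 : ℝ))
      (by
        have : |(m : ℝ)| = 1 := by exact_mod_cast congrArg (Int.cast : ℤ → ℝ) hm
        rw [this]; norm_num)
    simpa using h
  have h0 : -Real.log (intWeight q 0) ≤ 2 * q := by
    simpa [intWeight] using neg_log_one_sub_le hq0 hq1
  have key : ∑ b, roundProb r b * -Real.log (intWeight q (roundAt r b))
      ≤ 2 * q + Real.log (16 / q) * |r| := by
    simp only [roundProb, roundAt, Fintype.sum_bool, if_true, Bool.false_eq_true, if_false]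
    rw [abs_le] at hr
    -- The endpoint `r = 1` is separate because its floor is `1`, not `0`.
    rcases eq_or_lt_of_le hr.2 with h | h
    · have := hw 1 (by norm_num)
      subst h
      simp only [Int.floor_one, Int.fract_one]
      norm_num
      linarith
    rcases le_or_gt 0 r with hr0 | hr0
    · have hf : ⌊r⌋ = 0 := Int.floor_eq_zero_iff.2 ⟨hr0, h⟩
      have hfr : Int.fract r = r := Int.fract_eq_self.2 ⟨hr0, h⟩
      rw [hf, hfr, abs_of_nonneg hr0, zero_add, add_zero]
      have := hw 1 (by norm_num)
      nlinarith
    · have hf : ⌊r⌋ = -1 := by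
        rw [Int.floor_eq_iff]; push_cast; constructor <;> linarith [hr.1]
      have hfr : Int.fract r = r + 1 := by unfold Int.fract; rw [hf]; push_cast; ring
      rw [hf, hfr, abs_of_neg hr0, add_zero, show (-1 : ℤ) + 1 = 0 by norm_num]
      have := hw (-1) (by norm_num)
      nlinarith [hr.1]
  unfold roundCost
  linarith

/-- Both neighbours of `r` are nonzero and at most `2|r|` in modulus, so the weights charge
`log(16/q) + 2 log|r|`. -/
theorem roundCost_le_of_le_abs {q c r : ℝ} (hq0 : 0 < q) (hc : 0 ≤ c)
    (hr : 1 < |r|) :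
    roundCost (intWeight q) c r ≤ Real.log (16 / q) + c + 2 * Real.log |r| := by
  have hcf : c * (Int.fract r * (1 - Int.fract r)) ≤ c * 1 :=
    mul_le_mul_of_nonneg_left (fract_mul_le_one r) hc
  have hb : ∀ b, -Real.log (intWeight q (roundAt r b)) ≤ Real.log (16 / q) + 2 * Real.log |r| := by
    intro b
    have h1 : (⌊r⌋ : ℝ) ≤ r := Int.floor_le r
    have h2 : r < ⌊r⌋ + 1 := Int.lt_floor_add_one r
    refine neg_log_intWeight_le hq0 ?_ hr.le ?_
    · intro h
      rcases lt_abs.1 hr with h' | h'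
      · have : 1 ≤ ⌊r⌋ := Int.le_floor.2 (by exact_mod_cast h'.le)
        unfold roundAt at h
        split_ifs at h <;> omega
      · have : ⌊r⌋ < -1 := Int.floor_lt.2 (by push_cast; linarith)
        unfold roundAt at h
        split_ifs at h <;> omega
    · have h3 := le_abs_self r
      have h4 := neg_abs_le r
      unfold roundAt
      rw [abs_le]
      split_ifs <;> push_cast <;> constructor <;> linarith
  have := sum_roundProb r
  have h2 : ∑ b, roundProb r b * -Real.log (intWeight q (roundAt r b))
      ≤ ∑ b, roundProb r b * (Real.log (16 / q) + 2 * Real.log |r|) :=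
    Finset.sum_le_sum fun b _ => mul_le_mul_of_nonneg_left (hb b) (roundProb_nonneg r b)
  rw [← Finset.sum_mul, this, one_mul] at h2
  unfold roundCost
  linarith

/-- If `Bx ≤ 1`, expand to second order. Otherwise `1/x ≤ B`, so `e^(Bx) = e^B e^(-B(1-x)) ≤ e^B
e^(-(1/x-1))`, and the last exponential beats any power of `x`; `17` exceeds `6e`, from `v³/6 ≤
e^v`. -/
theorem exp_mul_le_of_le_one {B x : ℝ} (hB : 0 ≤ B) (hx0 : 0 ≤ x) (hx1 : x ≤ 1) :
    Real.exp (B * x) ≤ 1 + 2 * (B * x) + 17 * (Real.exp B * x ^ (5 / 2 : ℝ)) := by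
  rcases le_or_gt (B * x) 1 with h | h
  · have h0 : 0 ≤ B * x := mul_nonneg hB hx0
    have := (abs_le.1 (Real.abs_exp_sub_one_sub_id_le (x := B * x) (by rwa [abs_of_nonneg h0]))).2
    have h3 : 0 ≤ Real.exp B * x ^ (5 / 2 : ℝ) := by positivity
    nlinarith
  · have hx : 0 < x := by
      rcases hx0.eq_or_lt with rfl | h'
      · simp at h; linarith
      · exact h'
    have h1 : x⁻¹ - 1 ≤ B * (1 - x) := by
      have : x⁻¹ ≤ B := (inv_le_iff_one_le_mul₀ hx).2 h.le
      calc x⁻¹ - 1 = x⁻¹ * (1 - x) := by field_simp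
        _ ≤ _ := mul_le_mul_of_nonneg_right this (by linarith)
    have h2 : (x⁻¹) ^ (5 / 2 : ℝ) ≤ 17 * Real.exp (x⁻¹ - 1) := by
      have hv : 1 ≤ x⁻¹ := (one_le_inv₀ hx).2 hx1
      have e1 : (x⁻¹) ^ (5 / 2 : ℝ) ≤ (x⁻¹) ^ (3 : ℝ) :=
        Real.rpow_le_rpow_of_exponent_le hv (by norm_num)
      have e2 : (x⁻¹) ^ 3 / 6 ≤ Real.exp x⁻¹ := by
        have := Real.pow_div_factorial_le_exp x⁻¹ (by positivity) 3
        simpa [Nat.factorial] using this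
      have e3 : Real.exp x⁻¹ = Real.exp (x⁻¹ - 1) * Real.exp 1 := by rw [← Real.exp_add]; ring_nf
      have e4 := Real.exp_one_lt_d9
      have e5 := Real.exp_pos (x⁻¹ - 1)
      rw [show (3 : ℝ) = ((3 : ℕ) : ℝ) by norm_num, Real.rpow_natCast] at e1
      nlinarith
    have h4 : Real.exp (B * x) * (Real.exp (B * (1 - x))) = Real.exp B := by
      rw [← Real.exp_add]; ring_nf
    have h5 : (x⁻¹) ^ (5 / 2 : ℝ) * x ^ (5 / 2 : ℝ) = 1 := by
      rw [← Real.mul_rpow (by positivity) hx0, inv_mul_cancel₀ hx.ne', Real.one_rpow]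
    have h6 : Real.exp (B * x) * (x⁻¹) ^ (5 / 2 : ℝ) ≤ 17 * Real.exp B := by
      rw [← h4]
      calc _ ≤ Real.exp (B * x) * (17 * Real.exp (B * (1 - x))) := by
            refine mul_le_mul_of_nonneg_left (h2.trans ?_) (Real.exp_pos _).le
            exact mul_le_mul_of_nonneg_left (Real.exp_le_exp.2 h1) (by norm_num)
        _ = _ := by ring
    have h7 : 0 ≤ B * x := mul_nonneg hB hx0
    calc Real.exp (B * x) = Real.exp (B * x) * (x⁻¹) ^ (5 / 2 : ℝ) * x ^ (5 / 2 : ℝ) := by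
          rw [mul_assoc, h5, mul_one]
      _ ≤ 17 * Real.exp B * x ^ (5 / 2 : ℝ) := mul_le_mul_of_nonneg_right h6 (by positivity)
      _ ≤ _ := by nlinarith

/-- The factor `21/20` turns the tail cost `2 log|r|` into the power `21/10`. It is raised to `5/2`,
still below the order `3` at which Student moments diverge. Likewise `(21/20)·2q ≤ 3q`. -/
theorem exp_roundCost_le {q c r B : ℝ} (hq0 : 0 < q) (hq1 : q ≤ 1 / 2) (hc : 0 ≤ c)
    (hB : 21 / 20 * (Real.log (16 / q) + c) ≤ B) :
    Real.exp (21 / 20 * roundCost (intWeight q) c r)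
      ≤ Real.exp (3 * q) * (1 + 2 * (B * |r|) + 17 * (Real.exp B * |r| ^ (5 / 2 : ℝ))) := by
  have hA : 0 ≤ Real.log (16 / q) := Real.log_nonneg (by rw [le_div_iff₀ hq0]; linarith)
  have hB0 : 0 ≤ B := le_trans (by positivity) hB
  rcases le_or_gt |r| 1 with h | h
  · have h1 := roundCost_le_of_abs_le hq0 hq1 hc h
    have h2 : 21 / 20 * roundCost (intWeight q) c r ≤ 3 * q + B * |r| := by
      have := mul_le_mul_of_nonneg_right hB (abs_nonneg r)
      nlinarith
    calc _ ≤ Real.exp (3 * q + B * |r|) := Real.exp_le_exp.2 h2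
      _ = Real.exp (3 * q) * Real.exp (B * |r|) := Real.exp_add _ _
      _ ≤ _ := mul_le_mul_of_nonneg_left (exp_mul_le_of_le_one hB0 (abs_nonneg r) h)
          (Real.exp_pos _).le
  · have h1 := roundCost_le_of_le_abs (c := c) hq0 hc h
    have hl : 0 ≤ Real.log |r| := Real.log_nonneg h.le
    have h2 : 21 / 20 * roundCost (intWeight q) c r ≤ B + Real.log |r| * (5 / 2) := by
      nlinarith
    have h3 : Real.exp (21 / 20 * roundCost (intWeight q) c r)
        ≤ Real.exp B * |r| ^ (5 / 2 : ℝ) := by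
      rw [Real.rpow_def_of_pos (by linarith), ← Real.exp_add]
      exact Real.exp_le_exp.2 h2
    have h4 : 0 ≤ Real.exp B * |r| ^ (5 / 2 : ℝ) := by positivity
    have h5 : 1 ≤ Real.exp (3 * q) := Real.one_le_exp (by positivity)
    have h6 : 0 ≤ B * |r| := by positivity
    nlinarith

end SparseRegression

namespace SparseRegression

/-! ### A mixture of likelihoods over data-dependent lattices -/

theorem tsum_fin_prod {d : ℕ} (f : ℤ → ℝ≥0∞) :
    ∑' m : Fin d → ℤ, ∏ i, f (m i) = (∑' j, f j) ^ d := by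
  induction d with
  | zero => simp
  | succ d ih =>
    rw [← (Fin.consEquiv fun _ => ℤ).tsum_eq, ENNReal.tsum_prod']
    simp only [Fin.consEquiv_apply, Fin.prod_univ_succ, Fin.cons_zero, Fin.cons_succ]
    simp_rw [ENNReal.tsum_mul_left, ih]
    rw [ENNReal.tsum_mul_right, pow_succ, mul_comm]

/-- Normalized squared norm of the design, plus one. -/
noncomputable def designSize {n d : ℕ} (Cx : ℝ) (z : Fin n → Obs d) : ℝ :=
  1 + (∑ i, colSq z i) / (n * Cx ^ 2)

/-- The mass that the lattice weights put away from `0`. -/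
noncomputable def offMass {n d : ℕ} (Cx : ℝ) (z : Fin n → Obs d) : ℝ :=
  min (designSize Cx z / d) (1 / 2)

/-- A geometric grid of precisions. -/
noncomputable def gridPrec (n : ℕ) (K : ℝ) (k : ℕ) : ℝ := K * n * Real.exp (-(k / n))

/-- The standard deviations that correspond to `gridPrec`. -/
noncomputable def gridSd (n : ℕ) (K : ℝ) (k : ℕ) : ℝ := (Real.sqrt (gridPrec n K k))⁻¹

/-- Geometric weights on the grid of precisions. -/
noncomputable def gridWeight (n : ℕ) (β : ℝ) (k : ℕ) : ℝ :=
  (1 - Real.exp (-(β / n))) * Real.exp (-(β / n)) ^ k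

/-- The mesh widths of the lattice that belongs to a precision. -/
noncomputable def mesh {n d : ℕ} (Cx K : ℝ) (z : Fin n → Obs d) (k : ℕ) (i : Fin d) : ℝ :=
  Real.sqrt (Real.log (16 / offMass Cx z) / 10
    / (gridPrec n K k * (colSq z i + n * Cx ^ 2 / d)))

/-- The mixture of likelihoods over the lattices. -/
noncomputable def mixLik {n d : ℕ} (Cx K β : ℝ) (z : Fin n → Obs d) : ℝ≥0∞ :=
  ∑' k : ℕ, ENNReal.ofReal (gridWeight n β k) * ∑' m : Fin d → ℤ,
    (∏ i, ENNReal.ofReal (intWeight (offMass Cx z) (m i))) *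
      likelihood z (latticePoint (mesh Cx K z k) m) (gridSd n K k)

theorem colSq_nonneg {n d : ℕ} (z : Fin n → Obs d) (i : Fin d) : 0 ≤ colSq z i :=
  Finset.sum_nonneg fun _ _ => sq_nonneg _

theorem one_le_designSize {n d : ℕ} (Cx : ℝ) (z : Fin n → Obs d) : 1 ≤ designSize Cx z := by
  have : 0 ≤ (∑ i, colSq z i) / (n * Cx ^ 2) :=
    div_nonneg (Finset.sum_nonneg fun i _ => colSq_nonneg z i) (by positivity)
  unfold designSize; linarith

theorem offMass_pos {n d : ℕ} (hd : 0 < d) (Cx : ℝ) (z : Fin n → Obs d) : 0 < offMass Cx z := by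
  have := one_le_designSize Cx z
  have hd' : (0 : ℝ) < d := by exact_mod_cast hd
  exact lt_min (by positivity) (by norm_num)

theorem offMass_le {n d : ℕ} (Cx : ℝ) (z : Fin n → Obs d) : offMass Cx z ≤ 1 / 2 := min_le_right _ _

theorem gridPrec_pos {n : ℕ} (hn : 0 < n) {K : ℝ} (hK : 0 < K) (k : ℕ) : 0 < gridPrec n K k := by
  have : (0 : ℝ) < n := by exact_mod_cast hn
  unfold gridPrec; positivity

theorem gridSd_pos {n : ℕ} (hn : 0 < n) {K : ℝ} (hK : 0 < K) (k : ℕ) : 0 < gridSd n K k :=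
  inv_pos.2 (Real.sqrt_pos.2 (gridPrec_pos hn hK k))

theorem gridSd_sq {n : ℕ} (hn : 0 < n) {K : ℝ} (hK : 0 < K) (k : ℕ) :
    gridSd n K k ^ 2 = (gridPrec n K k)⁻¹ := by
  rw [gridSd, inv_pow, Real.sq_sqrt (gridPrec_pos hn hK k).le]

theorem gridWeight_pos {n : ℕ} (hn : 0 < n) {β : ℝ} (hβ : 0 < β) (k : ℕ) : 0 < gridWeight n β k := by
  have : (0 : ℝ) < n := by exact_mod_cast hn
  have h : Real.exp (-(β / n)) < 1 := Real.exp_lt_one_iff.2 (neg_neg_of_pos (by positivity))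
  exact mul_pos (by linarith) (pow_pos (Real.exp_pos _) _)

theorem tsum_gridWeight {n : ℕ} (hn : 0 < n) {β : ℝ} (hβ : 0 < β) :
    ∑' k, ENNReal.ofReal (gridWeight n β k) = 1 := by
  have hn' : (0 : ℝ) < n := by exact_mod_cast hn
  have h : Real.exp (-(β / n)) < 1 := Real.exp_lt_one_iff.2 (neg_neg_of_pos (by positivity))
  have hs : HasSum (gridWeight n β) 1 := by
    have := (hasSum_geometric_of_lt_one (Real.exp_pos _).le h).mul_left (1 - Real.exp (-(β / n)))
    rwa [mul_inv_cancel₀ (by linarith)] at this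
  rw [← ENNReal.ofReal_tsum_of_nonneg (fun k => (gridWeight_pos hn hβ k).le) hs.summable, hs.tsum_eq,
    ENNReal.ofReal_one]

theorem measurable_colSq {n d : ℕ} (i : Fin d) :
    Measurable fun z : Fin n → Obs d => colSq z i := by
  unfold colSq
  fun_prop

theorem measurable_designSize {n d : ℕ} (Cx : ℝ) :
    Measurable fun z : Fin n → Obs d => designSize Cx z :=
  ((Finset.measurable_sum _ fun i _ => measurable_colSq i).div_const _).const_add _

theorem measurable_offMass {n d : ℕ} (Cx : ℝ) :
    Measurable fun z : Fin n → Obs d => offMass Cx z :=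
  ((measurable_designSize Cx).div_const _).min measurable_const

theorem measurable_mesh {n d : ℕ} (Cx K : ℝ) (k : ℕ) (i : Fin d) :
    Measurable fun z : Fin n → Obs d => mesh Cx K z k i := by
  unfold mesh
  have h1 := measurable_offMass (n := n) (d := d) Cx
  have h2 := measurable_colSq (n := n) i
  fun_prop

theorem measurable_mixLik {n d : ℕ} (Cx K β : ℝ) :
    Measurable fun z : Fin n → Obs d => mixLik Cx K β z := by
  refine Measurable.tsum fun k => Measurable.const_mul (Measurable.tsum fun m => ?_) _
  refine Measurable.mul (Finset.measurable_prod _ fun i _ => ?_) ?_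
  · refine Measurable.ennreal_ofReal ?_
    have := measurable_offMass (n := n) (d := d) Cx
    unfold intWeight
    split_ifs <;> fun_prop
  · refine measurable_likelihood_comp measurable_id ?_ measurable_const
    refine (WithLp.measurable_toLp 2 _).comp (measurable_pi_lambda _ fun i => ?_)
    exact (measurable_mesh Cx K k i).mul_const _

theorem lintegral_mixLik_le {n d : ℕ} (hn : 0 < n) (hd : 0 < d) {K β : ℝ} (Cx : ℝ) (hK : 0 < K)
    (hβ : 0 < β) (x : Fin n → Vec d) :
    ∫⁻ y, mixLik Cx K β (mkData x y) ∂(Measure.pi fun _ : Fin n => (volume : Measure ℝ)) ≤ 1 := by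
  -- Weights and mesh are functions of the covariates alone, so they are constants in the integral
  -- over responses.
  have hq : ∀ y, offMass Cx (mkData x y) = offMass Cx (mkData x 0) := fun _ => rfl
  have hu : ∀ y k, mesh Cx K (mkData x y) k = mesh Cx K (mkData x 0) k := fun _ _ => rfl
  have hL : ∀ θ : Vec d, ∀ σ, Measurable fun y : Fin n → ℝ => likelihood (mkData x y) θ σ :=
    fun θ σ => measurable_likelihood_comp
      (measurable_mkData.comp (measurable_const.prodMk measurable_id)) measurable_const measurable_const
  simp only [mixLik, hq, hu]
  rw [lintegral_tsum fun k => (Measurable.const_mul (Measurable.tsum fun m =>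
    (hL _ _).const_mul _) _).aemeasurable]
  rw [← tsum_gridWeight hn hβ]
  refine ENNReal.tsum_le_tsum fun k => ?_
  rw [lintegral_const_mul _ (Measurable.tsum fun m => (hL _ _).const_mul _),
    lintegral_tsum fun m => ((hL _ _).const_mul _).aemeasurable]
  simp_rw [lintegral_const_mul _ (hL _ _), lintegral_likelihood x _ (gridSd_pos hn hK k), mul_one]
  rw [tsum_fin_prod fun j => ENNReal.ofReal (intWeight (offMass Cx (mkData x 0)) j)]
  exact mul_le_of_le_one_right' (pow_le_one' (tsum_intWeight_le (offMass_pos hd Cx _) (offMass_le _ _)) _)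

/-- Under the truth, the mixture likelihood ratio has expectation at most one. -/
theorem lintegral_mixLik_div_le {n d : ℕ} (hn : 0 < n) (hd : 0 < d) {K β : ℝ} (Cx : ℝ) (hK : 0 < K)
    (hβ : 0 < β) (ν : Measure (Vec d)) [IsProbabilityMeasure ν] (θ₀ : Vec d) {σ₀ : ℝ} (hσ₀ : 0 < σ₀) :
    ∫⁻ z, mixLik Cx K β z / likelihood z θ₀ σ₀ ∂(Measure.pi fun _ : Fin n => model ν θ₀ σ₀) ≤ 1 := by
  have hm := measurable_mixLik (n := n) (d := d) Cx K β
  have hF : Measurable fun z : Fin n → Obs d => mixLik Cx K β z / likelihood z θ₀ σ₀ :=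
    hm.div (measurable_likelihood_comp measurable_id measurable_const measurable_const)
  rw [lintegral_pi_model ν θ₀ hσ₀ hF]
  simp_rw [ENNReal.mul_div_cancel (likelihood_ne_zero _ θ₀ hσ₀) (likelihood_ne_top _ θ₀ σ₀)]
  rw [lintegral_pi_base ν hm]
  calc _ ≤ ∫⁻ _, 1 ∂(Measure.pi fun _ : Fin n => ν) :=
        lintegral_mono fun x => lintegral_mixLik_le hn hd Cx hK hβ x
    _ = 1 := by simp

end SparseRegression

namespace SparseRegression

/-! ### The likelihood is dominated by the mixture -/

/-- The index of the grid precision just below `σ⁻²`. -/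
noncomputable def gridIndex (n : ℕ) (K σ : ℝ) : ℕ := ⌈n * Real.log (K * n * σ ^ 2)⌉₊

/-- The variance cost of rounding a coordinate. -/
noncomputable def meshCost {n d : ℕ} (Cx K : ℝ) (z : Fin n → Obs d) (k : ℕ) (i : Fin d) : ℝ :=
  colSq z i * mesh Cx K z k i ^ 2 / (2 * gridSd n K k ^ 2)

/-- The logarithm of the factor by which the likelihood can exceed the mixture. -/
noncomputable def excess {n d : ℕ} (Cx K β : ℝ) (z : Fin n → Obs d) (θ : Vec d) (σ : ℝ) : ℝ :=
  1 / 2 + 1 / (2 * K * σ ^ 2) - Real.log (gridWeight n β (gridIndex n K σ))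
    + ∑ i, roundCost (intWeight (offMass Cx z)) (meshCost Cx K z (gridIndex n K σ) i)
        (θ i / mesh Cx K z (gridIndex n K σ) i)

theorem log_gridPrec {n : ℕ} (hn : 0 < n) {K : ℝ} (hK : 0 < K) (k : ℕ) :
    Real.log (gridPrec n K k) = Real.log (K * n) - k / n := by
  have : (0 : ℝ) < n := by exact_mod_cast hn
  rw [gridPrec, Real.log_mul (by positivity) (Real.exp_pos _).ne', Real.log_exp]; ring

theorem log_inv_sq_sub {n : ℕ} (hn : 0 < n) {K σ : ℝ} (hK : 0 < K) (hσ : 0 < σ) (k : ℕ) :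
    n * (Real.log (σ ^ 2)⁻¹ - Real.log (gridPrec n K k)) = k - n * Real.log (K * n * σ ^ 2) := by
  have hn' : (0 : ℝ) < n := by exact_mod_cast hn
  rw [log_gridPrec hn hK, Real.log_inv, Real.log_mul (x := K * n) (by positivity) (by positivity)]
  have : n * ((k : ℝ) / n) = k := by field_simp
  linear_combination this

theorem gridPrec_le {n : ℕ} (hn : 0 < n) {K σ : ℝ} (hK : 0 < K) (hσ : 0 < σ) :
    gridPrec n K (gridIndex n K σ) ≤ (σ ^ 2)⁻¹ := by
  have hn' : (0 : ℝ) < n := by exact_mod_cast hn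
  rw [← Real.log_le_log_iff (gridPrec_pos hn hK _) (by positivity)]
  have h := log_inv_sq_sub hn hK hσ (gridIndex n K σ)
  have h2 : n * Real.log (K * n * σ ^ 2) ≤ gridIndex n K σ := Nat.le_ceil _
  by_contra! hc
  nlinarith

theorem gridPrec_le_top {n : ℕ} {K : ℝ} (hK : 0 < K) (k : ℕ) : gridPrec n K k ≤ K * n := by
  have : Real.exp (-((k : ℝ) / n)) ≤ 1 := Real.exp_le_one_iff.2 (neg_nonpos.2 (by positivity))
  exact mul_le_of_le_one_right (by positivity) this

/-- Lowering the precision shrinks the residual term and loses only in the normalizing factor. That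
loss is half of `k - n log(Knσ²)`: at most `1/2` from rounding up the index, plus a term for
precisions above the top of the grid. -/
theorem logLik_le_grid {n d : ℕ} (hn : 0 < n) {K σ : ℝ} (hK : 0 < K) (hσ : 0 < σ)
    (z : Fin n → Obs d) (θ : Vec d) :
    logLik z θ σ ≤ 1 / 2 + 1 / (2 * K * σ ^ 2) + logLik z θ (gridSd n K (gridIndex n K σ)) := by
  have hn' : (0 : ℝ) < n := by exact_mod_cast hn
  set k := gridIndex n K σ with hk
  have hs := gridSd_pos hn hK k
  have hp := gridPrec_pos hn hK k
  have h1 := gridPrec_le hn hK hσ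
  have h2 := log_inv_sq_sub hn hK hσ k
  have h3 : (k : ℝ) - n * Real.log (K * n * σ ^ 2) ≤ 1 + 1 / (K * σ ^ 2) := by
    rcases le_or_gt 0 (n * Real.log (K * n * σ ^ 2)) with h | h
    · have := Nat.ceil_lt_add_one h
      have h' : 0 < 1 / (K * σ ^ 2) := by positivity
      simp only [hk, gridIndex]; linarith
    -- Precisions above the top grid value `Kn` all get index `0`; the loss is then bounded by `log
    -- x ≤ x`, which produces `1/(Kσ²)`.
    · have h0 : k = 0 := Nat.ceil_eq_zero.2 h.le
      have h4 := Real.log_le_self (x := (K * n * σ ^ 2)⁻¹) (by positivity)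
      rw [Real.log_inv] at h4
      have h5 : (n : ℝ) * (K * n * σ ^ 2)⁻¹ = 1 / (K * σ ^ 2) := by field_simp
      rw [h0, ← h5]
      push_cast
      nlinarith
  rw [logLik, logLik, Real.log_mul (by positivity) hσ.ne', Real.log_mul (by positivity) hs.ne']
  have hlσ : Real.log (σ ^ 2)⁻¹ = -(2 * Real.log σ) := by
    rw [Real.log_inv, Real.log_pow]; norm_num
  have hls : Real.log (gridPrec n K k) = -(2 * Real.log (gridSd n K k)) := by
    rw [← inv_inv (gridPrec n K k), ← gridSd_sq hn hK, Real.log_inv, Real.log_pow]; norm_num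
  rw [hlσ, hls] at h2
  have h6 : rss z θ / (2 * gridSd n K k ^ 2) ≤ rss z θ / (2 * σ ^ 2) := by
    have e1 : rss z θ / (2 * gridSd n K k ^ 2) = rss z θ / 2 * gridPrec n K k := by
      rw [gridSd_sq hn hK]; field_simp
    have e2 : rss z θ / (2 * σ ^ 2) = rss z θ / 2 * (σ ^ 2)⁻¹ := by field_simp
    rw [e1, e2]
    exact mul_le_mul_of_nonneg_left h1 (by have := rss_nonneg z θ; positivity)
  have h7 : 1 / (2 * K * σ ^ 2) = 1 / (K * σ ^ 2) / 2 := by field_simp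
  rw [h7]
  nlinarith

theorem mesh_pos {n d : ℕ} (hn : 0 < n) (hd : 0 < d) {Cx K : ℝ} (hCx : 0 < Cx) (hK : 0 < K)
    (z : Fin n → Obs d) (k : ℕ) (i : Fin d) : 0 < mesh Cx K z k i := by
  have hn' : (0 : ℝ) < n := by exact_mod_cast hn
  have hd' : (0 : ℝ) < d := by exact_mod_cast hd
  have hq := offMass_pos hd Cx z
  have hq1 := offMass_le Cx z
  have hl : 0 < Real.log (16 / offMass Cx z) :=
    Real.log_pos (by rw [lt_div_iff₀ hq]; linarith)
  have := gridPrec_pos hn hK k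
  have := colSq_nonneg z i
  exact Real.sqrt_pos.2 (by positivity)

/-- Only one grid level and the corners of one lattice cell are kept from the mixture. Different
rounding choices give different lattice indices, so the finite sum of `logLik_le_round` is a subsum
of the mixture. -/
theorem likelihood_le_mixLik {n d : ℕ} (hn : 0 < n) (hd : 0 < d) {Cx K β : ℝ} (hCx : 0 < Cx)
    (hK : 0 < K) (hβ : 0 < β) (z : Fin n → Obs d) (θ : Vec d) {σ : ℝ} (hσ : 0 < σ) :
    likelihood z θ σ ≤ ENNReal.ofReal (Real.exp (excess Cx K β z θ σ)) * mixLik Cx K β z := by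
  set k := gridIndex n K σ with hk
  set q := offMass Cx z with hqdef
  set u := mesh Cx K z k with hu
  have hs := gridSd_pos hn hK k
  have hω : ∀ m, 0 < intWeight q m := intWeight_pos (offMass_pos hd Cx z) (offMass_le Cx z)
  have hw := gridWeight_pos hn hβ k
  set R : (Fin d → Bool) → Fin d → ℤ := fun ε i => roundAt (θ i / u i) (ε i) with hR
  set F : ℝ := ∑ ε : Fin d → Bool, (∏ i, intWeight q (R ε i)) *
    Real.exp (logLik z (latticePoint u (R ε)) (gridSd n K k)) with hF
  have hterm : ∀ ε, 0 < (∏ i, intWeight q (R ε i)) *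
      Real.exp (logLik z (latticePoint u (R ε)) (gridSd n K k)) :=
    fun ε => mul_pos (Finset.prod_pos fun i _ => hω _) (Real.exp_pos _)
  have hFpos : 0 < F := Finset.sum_pos (fun ε _ => hterm ε) Finset.univ_nonempty
  have h1 := logLik_le_grid hn hK hσ z θ
  have h2 := logLik_le_round z θ (σ := gridSd n K k) (mesh_pos hn hd hCx hK z k) hω
  have h3 : logLik z θ σ ≤ excess Cx K β z θ σ + Real.log (gridWeight n β k * F) := by
    rw [Real.log_mul hw.ne' hFpos.ne', excess]
    simp only [meshCost, ← hk]
    linarith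
  have hinj : Function.Injective R := by
    intro ε ε' h
    funext i
    have := congrFun h i
    simp only [hR, roundAt] at this
    cases h1 : ε i <;> cases h2 : ε' i <;> simp [h1, h2] at this ⊢
  have h4 : ENNReal.ofReal (gridWeight n β k * F) ≤ mixLik Cx K β z := by
    rw [ENNReal.ofReal_mul hw.le]
    refine le_trans ?_ (ENNReal.le_tsum k)
    refine mul_le_mul_right ?_ _
    rw [hF, ENNReal.ofReal_sum_of_nonneg fun ε _ => (hterm ε).le, ← tsum_fintype (L := .unconditional _)]
    refine le_trans (le_of_eq ?_) (ENNReal.tsum_comp_le_tsum_of_injective hinj _)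
    refine tsum_congr fun ε => ?_
    rw [ENNReal.ofReal_mul (Finset.prod_nonneg fun i _ => (hω _).le),
      ENNReal.ofReal_prod_of_nonneg fun i _ => (hω _).le, likelihood_eq_exp _ _ hs]
  rw [likelihood_eq_exp z θ hσ]
  calc _ ≤ ENNReal.ofReal (Real.exp (excess Cx K β z θ σ) * (gridWeight n β k * F)) := by
        refine ENNReal.ofReal_le_ofReal ?_
        rw [← Real.exp_log (mul_pos hw hFpos), ← Real.exp_add]
        exact Real.exp_le_exp.2 h3
    _ ≤ _ := by
        rw [ENNReal.ofReal_mul (Real.exp_pos _).le]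
        exact mul_le_mul_right h4 _

end SparseRegression

namespace SparseRegression

/-! ### The scaled Student prior -/

/-- Density of the scaled Student distribution with three degrees of freedom. -/
noncomputable def studentDensity (τ t : ℝ) : ℝ := 2 / Real.pi * τ ^ 3 * ((τ ^ 2 + t ^ 2) ^ 2)⁻¹

/-- The scaled Student distribution. -/
noncomputable def student (τ : ℝ) : Measure ℝ :=
  volume.withDensity fun t => ENNReal.ofReal (studentDensity τ t)

/-- The product of scaled Student distributions. -/
noncomputable def studentPi (d : ℕ) (τ : ℝ) : Measure (Vec d) :=
  volume.withDensity fun θ => ∏ i, ENNReal.ofReal (studentDensity τ (θ i))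

theorem studentDensity_nonneg {τ : ℝ} (hτ : 0 < τ) (t : ℝ) : 0 ≤ studentDensity τ t := by
  unfold studentDensity; positivity

theorem measurable_studentDensity (τ : ℝ) : Measurable fun t => ENNReal.ofReal (studentDensity τ t) := by
  unfold studentDensity; fun_prop

theorem measurable_coord {d : ℕ} (i : Fin d) : Measurable fun θ : Vec d => θ i := by fun_prop

theorem measurable_studentPi_density (d : ℕ) (τ : ℝ) :
    Measurable fun θ : Vec d => ∏ i, ENNReal.ofReal (studentDensity τ (θ i)) :=
  Finset.measurable_prod _ fun i _ => (measurable_studentDensity τ).comp (measurable_coord i)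

theorem lintegral_studentPi_prod {d : ℕ} (τ : ℝ) {h : Fin d → ℝ → ℝ≥0∞} (hh : ∀ i, Measurable (h i)) :
    ∫⁻ θ, ∏ i, h i (θ i) ∂(studentPi d τ) = ∏ i, ∫⁻ t, h i t ∂(student τ) := by
  have hm : Measurable fun θ : Vec d => ∏ i, h i (θ i) :=
    Finset.measurable_prod _ fun i _ => (hh i).comp (measurable_coord i)
  rw [studentPi, lintegral_withDensity_eq_lintegral_mul _ (measurable_studentPi_density d τ) hm]
  have e : ∀ i, ∫⁻ t, h i t ∂(student τ) 
      = ∫⁻ t, ((fun t => ENNReal.ofReal (studentDensity τ t)) * h i) t :=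
    fun i => lintegral_withDensity_eq_lintegral_mul _ (measurable_studentDensity τ) (hh i)
  rw [Finset.prod_congr rfl fun i _ => e i]
  rw [← lintegral_fin_prod_eq_prod (μ := fun _ => (volume : Measure ℝ))
    fun i => (measurable_studentDensity τ).mul (hh i), ← volume_pi,
    ← (PiLp.volume_preserving_toLp (Fin d)).lintegral_comp ((measurable_studentPi_density d τ).mul hm)]
  refine lintegral_congr fun x => ?_
  simp [Finset.prod_mul_distrib]

theorem lintegral_student {τ : ℝ} (hτ : 0 < τ) {h : ℝ → ℝ≥0∞} (hh : Measurable h) :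
    ∫⁻ t, h (t / τ) ∂(student τ)
      = ∫⁻ s, ENNReal.ofReal (2 / Real.pi * ((1 + s ^ 2) ^ 2)⁻¹) * h s := by
  have hd : Measurable fun t => h (t / τ) := hh.comp (measurable_id.div_const τ)
  rw [student, lintegral_withDensity_eq_lintegral_mul _ (measurable_studentDensity τ) hd]
  have hF := (measurable_studentDensity τ).mul hd
  have h1 : ∫⁻ s, ((fun t => ENNReal.ofReal (studentDensity τ t)) * fun t => h (t / τ)) (τ * s)
      = ENNReal.ofReal |τ⁻¹| *
        ∫⁻ t, ((fun t => ENNReal.ofReal (studentDensity τ t)) * fun t => h (t / τ)) t := by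
    refine Eq.trans ?_ (lintegral_smul_measure (μ := (volume : Measure ℝ))
      (ENNReal.ofReal |τ⁻¹|) ((fun t => ENNReal.ofReal (studentDensity τ t)) * fun t => h (t / τ)))
    rw [← Real.map_volume_mul_left hτ.ne', lintegral_map hF (measurable_const_mul τ)]
  have h2 : ∫⁻ t, ((fun t => ENNReal.ofReal (studentDensity τ t)) * fun t => h (t / τ)) t
      = ENNReal.ofReal τ * ∫⁻ s,
        ((fun t => ENNReal.ofReal (studentDensity τ t)) * fun t => h (t / τ)) (τ * s) := by
    rw [h1, ← mul_assoc, ← ENNReal.ofReal_mul hτ.le, abs_of_pos (by positivity),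
      mul_inv_cancel₀ hτ.ne', ENNReal.ofReal_one, one_mul]
  rw [h2]
  refine (lintegral_const_mul _ (hF.comp (measurable_const_mul τ))).symm.trans ?_
  refine lintegral_congr fun s => ?_
  simp only [Pi.mul_apply, Function.comp_apply]
  rw [← mul_assoc, ← ENNReal.ofReal_mul hτ.le, mul_div_cancel_left₀ s hτ.ne']
  congr 2
  unfold studentDensity
  have : 0 < 1 + s ^ 2 := by positivity
  rw [show τ ^ 2 + (τ * s) ^ 2 = τ ^ 2 * (1 + s ^ 2) by ring]
  field_simp

theorem integrable_student_mul {g : ℝ → ℝ} (hg : Continuous g) (hb : ∀ s, |g s| ≤ 1 + s ^ 2) :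
    Integrable fun s : ℝ => 2 / Real.pi * ((1 + s ^ 2) ^ 2)⁻¹ * g s := by
  refine (integrable_inv_one_add_sq.const_mul (2 / Real.pi)).mono' ?_ ?_
  · refine Continuous.aestronglyMeasurable ?_
    have : ∀ s : ℝ, (1 + s ^ 2) ^ 2 ≠ 0 := fun s => by positivity
    fun_prop (disch := exact this _)
  · refine Filter.Eventually.of_forall fun s => ?_
    have h1 : 0 < 1 + s ^ 2 := by positivity
    rw [Real.norm_eq_abs, abs_mul, abs_of_nonneg (by positivity), mul_assoc]
    refine mul_le_mul_of_nonneg_left ?_ (by positivity)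
    calc ((1 + s ^ 2) ^ 2)⁻¹ * |g s| ≤ ((1 + s ^ 2) ^ 2)⁻¹ * (1 + s ^ 2) :=
          mul_le_mul_of_nonneg_left (hb s) (by positivity)
      _ = (1 + s ^ 2)⁻¹ := by field_simp

/-- The integrand is the derivative of `s/(1+s²)`, which vanishes at both ends. -/
theorem integral_one_sub_sq : ∫ s : ℝ, (1 - s ^ 2) * ((1 + s ^ 2) ^ 2)⁻¹ = 0 := by
  have hd : ∀ s : ℝ, HasDerivAt (fun s => s / (1 + s ^ 2)) ((1 - s ^ 2) * ((1 + s ^ 2) ^ 2)⁻¹) s := by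
    intro s
    have h0 : 1 + s ^ 2 ≠ 0 := by positivity
    have := (hasDerivAt_id s).div (((hasDerivAt_id s).pow 2).const_add 1) h0
    refine this.congr_deriv ?_
    rw [div_eq_mul_inv]
    simp only [id, Pi.pow_apply]
    norm_num
    left
    ring
  have hb : ∀ s : ℝ, |s / (1 + s ^ 2)| ≤ |s⁻¹| := by
    intro s
    rcases eq_or_ne s 0 with rfl | hs
    · simp
    rw [abs_div, abs_inv, div_eq_mul_inv]
    have h1 : 0 < |s| := abs_pos.2 hs
    rw [abs_of_pos (show 0 < 1 + s ^ 2 by positivity), ← sq_abs]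
    rw [← div_eq_mul_inv, div_le_iff₀ (by positivity)]
    have : |s|⁻¹ * (1 + |s| ^ 2) = |s|⁻¹ + |s| := by field_simp
    rw [this]; linarith [inv_pos.2 h1]
  have hi : Integrable fun s : ℝ => (1 - s ^ 2) * ((1 + s ^ 2) ^ 2)⁻¹ := by
    have := (integrable_student_mul (g := fun s => 1 - s ^ 2) (by fun_prop) fun s => by
      rw [abs_le]; constructor <;> nlinarith [sq_nonneg s]).const_mul (Real.pi / 2)
    refine this.congr (Filter.Eventually.of_forall fun s => ?_)
    have := Real.pi_pos
    simp only []
    field_simp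
  have h := integral_of_hasDerivAt_of_tendsto (m := 0) (n := 0) hd hi ?_ ?_
  · simpa using h
  · exact squeeze_zero_norm hb (by simpa using (tendsto_inv_atBot_zero (𝕜 := ℝ)).abs)
  · exact squeeze_zero_norm hb (by simpa using (tendsto_inv_atTop_zero (𝕜 := ℝ)).abs)

/-- The sum of the two integrals is a Cauchy integral, equal to `2`; their difference vanishes by
`integral_one_sub_sq`. -/
theorem integral_student_one_and_sq :
    ∫ s : ℝ, 2 / Real.pi * ((1 + s ^ 2) ^ 2)⁻¹ * 1 = 1
      ∧ ∫ s : ℝ, 2 / Real.pi * ((1 + s ^ 2) ^ 2)⁻¹ * s ^ 2 = 1 := by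
  have i0 := integrable_student_mul (g := fun _ => 1) (by fun_prop) fun s => by
    rw [abs_of_pos one_pos]; nlinarith [sq_nonneg s]
  have i2 := integrable_student_mul (g := fun s => s ^ 2) (by fun_prop) fun s => by
    rw [abs_of_nonneg (sq_nonneg s)]; linarith
  have hπ := Real.pi_pos
  have hsum : (∫ s : ℝ, 2 / Real.pi * ((1 + s ^ 2) ^ 2)⁻¹ * 1)
      + ∫ s : ℝ, 2 / Real.pi * ((1 + s ^ 2) ^ 2)⁻¹ * s ^ 2 = 2 := by
    rw [← integral_add i0 i2]
    calc _ = ∫ s : ℝ, 2 / Real.pi * (1 + s ^ 2)⁻¹ := by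
          refine integral_congr_ae (Filter.Eventually.of_forall fun s => ?_)
          have : 0 < 1 + s ^ 2 := by positivity
          simp only []
          field_simp
      _ = 2 := by rw [integral_const_mul, integral_univ_inv_one_add_sq]; field_simp
  have hdiff : (∫ s : ℝ, 2 / Real.pi * ((1 + s ^ 2) ^ 2)⁻¹ * 1)
      - ∫ s : ℝ, 2 / Real.pi * ((1 + s ^ 2) ^ 2)⁻¹ * s ^ 2 = 0 := by
    rw [← integral_sub i0 i2]
    calc _ = ∫ s : ℝ, 2 / Real.pi * ((1 - s ^ 2) * ((1 + s ^ 2) ^ 2)⁻¹) := by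
          refine integral_congr_ae (Filter.Eventually.of_forall fun s => ?_)
          simp only []
          ring
      _ = 0 := by rw [integral_const_mul, integral_one_sub_sq, mul_zero]
  constructor <;> linarith

theorem lintegral_student_ofReal {τ : ℝ} (hτ : 0 < τ) {g : ℝ → ℝ} (hg : Continuous g)
    (hg0 : ∀ s, 0 ≤ g s) (hb : ∀ s, |g s| ≤ 1 + s ^ 2) :
    ∫⁻ t, ENNReal.ofReal (g (t / τ)) ∂(student τ)
      = ENNReal.ofReal (∫ s : ℝ, 2 / Real.pi * ((1 + s ^ 2) ^ 2)⁻¹ * g s) := by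
  rw [lintegral_student hτ (h := fun s => ENNReal.ofReal (g s)) hg.measurable.ennreal_ofReal,
    ofReal_integral_eq_lintegral_ofReal (integrable_student_mul hg hb)]
  · exact lintegral_congr fun s => (ENNReal.ofReal_mul (by positivity)).symm
  · exact Filter.Eventually.of_forall fun s => mul_nonneg (by positivity) (hg0 s)

theorem isProbabilityMeasure_student {τ : ℝ} (hτ : 0 < τ) : IsProbabilityMeasure (student τ) := by
  constructor
  have := lintegral_student_ofReal hτ (g := fun _ => 1) (by fun_prop) (fun _ => zero_le_one) fun s => by
    rw [abs_of_pos one_pos]; nlinarith [sq_nonneg s]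
  rw [integral_student_one_and_sq.1] at this
  simpa using this

theorem lintegral_student_sq {τ : ℝ} (hτ : 0 < τ) :
    ∫⁻ t, ENNReal.ofReal ((t / τ) ^ 2) ∂(student τ) = 1 := by
  have := lintegral_student_ofReal hτ (g := fun s => s ^ 2) (by fun_prop) (fun _ => sq_nonneg _)
    fun s => by rw [abs_of_nonneg (sq_nonneg s)]; linarith
  rw [integral_student_one_and_sq.2] at this
  simpa using this

/-- From `2|s| ≤ 1 + s²` and the unit second moment. -/
theorem lintegral_student_abs {τ : ℝ} (hτ : 0 < τ) :
    ∫⁻ t, ENNReal.ofReal |t / τ| ∂(student τ) ≤ 1 := by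
  have hp := isProbabilityMeasure_student hτ
  have h2 : (2 : ℝ≥0∞) * ∫⁻ t, ENNReal.ofReal |t / τ| ∂(student τ) ≤ 2 * 1 := by
    rw [← lintegral_const_mul _ (by fun_prop)]
    calc _ ≤ ∫⁻ t, (1 + ENNReal.ofReal ((t / τ) ^ 2)) ∂(student τ) := by
          refine lintegral_mono fun t => ?_
          rw [← ENNReal.ofReal_one, ← ENNReal.ofReal_add zero_le_one (sq_nonneg _),
            show (2 : ℝ≥0∞) = ENNReal.ofReal 2 by simp, ← ENNReal.ofReal_mul (by norm_num)]
          refine ENNReal.ofReal_le_ofReal ?_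
          nlinarith [sq_nonneg (|t / τ| - 1), sq_abs (t / τ)]
      _ = 2 * 1 := by
          rw [lintegral_add_left measurable_const, lintegral_student_sq hτ]
          simp only [lintegral_const, measure_univ]
          norm_num
  exact (ENNReal.mul_le_mul_iff_right (by simp) (by simp)).1 h2

/-- The integrand is at most `(1+s²)^(-3/4)`, which decays like `|s|^(-3/2)`. By scaling, the
constant does not depend on `τ`. -/
theorem exists_lintegral_student_rpow :
    ∃ C : ℝ, 1 ≤ C ∧ ∀ τ : ℝ, 0 < τ →
      ∫⁻ t, ENNReal.ofReal (|t / τ| ^ (5 / 2 : ℝ)) ∂(student τ) ≤ ENNReal.ofReal C := by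
  have hi : Integrable fun s : ℝ => (1 + ‖s‖ ^ 2) ^ (-(3 / 2 : ℝ) / 2) :=
    integrable_rpow_neg_one_add_norm_sq (by simp; norm_num)
  refine ⟨max 1 (∫ s : ℝ, (1 + ‖s‖ ^ 2) ^ (-(3 / 2 : ℝ) / 2)), le_max_left _ _, fun τ hτ => ?_⟩
  rw [lintegral_student hτ (h := fun s => ENNReal.ofReal (|s| ^ (5 / 2 : ℝ))) (by fun_prop)]
  refine le_trans ?_ (ENNReal.ofReal_le_ofReal (le_max_right _ _))
  rw [ofReal_integral_eq_lintegral_ofReal hi (Filter.Eventually.of_forall fun s => by positivity)]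
  refine lintegral_mono fun s => ?_
  rw [← ENNReal.ofReal_mul (by positivity)]
  refine ENNReal.ofReal_le_ofReal ?_
  have h1 : 0 < 1 + s ^ 2 := by positivity
  have h2 : |s| ^ (5 / 2 : ℝ) ≤ (1 + s ^ 2) ^ (5 / 4 : ℝ) := by
    have : |s| ^ (5 / 2 : ℝ) = (s ^ 2) ^ (5 / 4 : ℝ) := by
      rw [← sq_abs, ← Real.rpow_natCast, ← Real.rpow_mul (abs_nonneg s)]; norm_num
    rw [this]
    exact Real.rpow_le_rpow (sq_nonneg s) (by linarith) (by norm_num)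
  have h3 : 2 / Real.pi ≤ 1 := by
    rw [div_le_one Real.pi_pos]; linarith [Real.pi_gt_three]
  have h4 : ((1 + s ^ 2) ^ 2)⁻¹ * (1 + s ^ 2) ^ (5 / 4 : ℝ) = (1 + ‖s‖ ^ 2) ^ (-(3 / 2 : ℝ) / 2) := by
    rw [Real.norm_eq_abs, sq_abs, ← Real.rpow_natCast (1 + s ^ 2) 2, ← Real.rpow_neg h1.le,
      ← Real.rpow_add h1]
    norm_num
  rw [← h4]
  have h5 : 0 ≤ ((1 + s ^ 2) ^ 2)⁻¹ := by positivity
  have h6 : 0 ≤ |s| ^ (5 / 2 : ℝ) := by positivity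
  calc 2 / Real.pi * ((1 + s ^ 2) ^ 2)⁻¹ * |s| ^ (5 / 2 : ℝ)
      ≤ 1 * ((1 + s ^ 2) ^ 2)⁻¹ * |s| ^ (5 / 2 : ℝ) := by gcongr
    _ ≤ _ := by rw [one_mul]; gcongr

end SparseRegression

/-! ### Prior mass near zero and near the true coefficients -/

namespace SparseRegression

theorem isProbabilityMeasure_studentPi (d : ℕ) {τ : ℝ} (hτ : 0 < τ) :
    IsProbabilityMeasure (studentPi d τ) := by
  have hp := isProbabilityMeasure_student hτ
  constructor
  have := lintegral_studentPi_prod (d := d) τ (h := fun _ _ => 1) fun _ => measurable_const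
  simpa using this

theorem lintegral_studentPi_coord {d : ℕ} {τ : ℝ} (hτ : 0 < τ) (i : Fin d) {h : ℝ → ℝ≥0∞}
    (hh : Measurable h) : ∫⁻ θ, h (θ i) ∂(studentPi d τ) = ∫⁻ t, h t ∂(student τ) := by
  have hp := isProbabilityMeasure_student hτ
  have := lintegral_studentPi_prod (d := d) τ (h := fun j t => if j = i then h t else 1) fun j => by
    split_ifs
    · exact hh
    · exact measurable_const
  simp only [Finset.prod_ite_eq', Finset.mem_univ, if_true] at this
  rw [this, Finset.prod_eq_single i]
  · simp
  · intro j _ hj; simp [hj]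
  · simp

theorem measurable_l1norm {d : ℕ} : Measurable fun θ : Vec d => l1norm θ := by
  unfold l1norm; fun_prop

theorem measurableSet_l1ball (d : ℕ) (C : ℝ) : MeasurableSet (l1ball d C) :=
  measurableSet_le measurable_l1norm measurable_const

theorem l1norm_nonneg {d : ℕ} (θ : Vec d) : 0 ≤ l1norm θ := Finset.sum_nonneg fun _ _ => abs_nonneg _

theorem lintegral_studentPi_l1norm {d : ℕ} {τ : ℝ} (hτ : 0 < τ) :
    ∫⁻ θ, ENNReal.ofReal (l1norm θ / τ) ∂(studentPi d τ) ≤ d := by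
  have : ∀ θ : Vec d, ENNReal.ofReal (l1norm θ / τ) = ∑ i, ENNReal.ofReal |θ i / τ| := by
    intro θ
    rw [← ENNReal.ofReal_sum_of_nonneg fun _ _ => abs_nonneg _, l1norm, Finset.sum_div]
    simp only [abs_div, abs_of_pos hτ]
  simp_rw [this]
  rw [lintegral_finsetSum _ fun i _ => by fun_prop]
  calc _ ≤ ∑ _i : Fin d, (1 : ℝ≥0∞) := Finset.sum_le_sum fun i _ => by
        rw [lintegral_studentPi_coord hτ i (h := fun t => ENNReal.ofReal |t / τ|) (by fun_prop)]
        exact lintegral_student_abs hτ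
    _ = d := by simp

theorem lintegral_studentPi_sq {d : ℕ} {τ : ℝ} (hτ : 0 < τ) :
    ∫⁻ θ, ENNReal.ofReal ((∑ i, θ i ^ 2) / τ ^ 2) ∂(studentPi d τ) = d := by
  have : ∀ θ : Vec d, ENNReal.ofReal ((∑ i, θ i ^ 2) / τ ^ 2)
      = ∑ i, ENNReal.ofReal ((θ i / τ) ^ 2) := by
    intro θ
    rw [← ENNReal.ofReal_sum_of_nonneg fun _ _ => sq_nonneg _, Finset.sum_div]
    simp only [div_pow]
  simp_rw [this]
  rw [lintegral_finsetSum _ fun i _ => by fun_prop]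
  calc _ = ∑ _i : Fin d, (1 : ℝ≥0∞) := Finset.sum_congr rfl fun i _ => by
        rw [lintegral_studentPi_coord hτ i (h := fun t => ENNReal.ofReal ((t / τ) ^ 2)) (by fun_prop)]
        exact lintegral_student_sq hτ
    _ = d := by simp

/-- The perturbations of the coefficient vector at which the prior mass is measured. -/
def smallVec (d : ℕ) (τ : ℝ) : Set (Vec d) :=
  {δ | l1norm δ ≤ 2 * d * τ ∧ ∑ i, δ i ^ 2 ≤ 4 * d * τ ^ 2}

theorem measurableSet_smallVec (d : ℕ) (τ : ℝ) : MeasurableSet (smallVec d τ) :=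
  (measurableSet_l1ball d _).inter
    (measurableSet_le (f := fun δ : Vec d => ∑ i, δ i ^ 2) (by fun_prop) measurable_const)

theorem studentPi_l1_gt_le {d : ℕ} (hd : 0 < d) {τ : ℝ} (hτ : 0 < τ) :
    studentPi d τ {θ | 2 * d * τ < l1norm θ} ≤ ENNReal.ofReal (1 / 2) := by
  have hd' : (0 : ℝ) < d := by exact_mod_cast hd
  have h := mul_meas_ge_le_lintegral (μ := studentPi d τ)
    (f := fun θ => ENNReal.ofReal (l1norm θ / τ)) (measurable_l1norm.div_const τ).ennreal_ofReal
    (ENNReal.ofReal (2 * d))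
  have h2 : studentPi d τ {θ | 2 * d * τ < l1norm θ}
      ≤ studentPi d τ {θ | ENNReal.ofReal (2 * d) ≤ ENNReal.ofReal (l1norm θ / τ)} := by
    refine measure_mono fun θ hθ => ENNReal.ofReal_le_ofReal ?_
    rw [le_div_iff₀ hτ]; exact (le_of_lt hθ)
  have h3 := (mul_le_mul_right h2 (ENNReal.ofReal (2 * d))).trans (h.trans (lintegral_studentPi_l1norm hτ))
  rw [mul_comm, ← ENNReal.le_div_iff_mul_le (by left; simpa using hd.ne') (by simp)] at h3
  refine h3.trans (le_of_eq ?_)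
  rw [← ENNReal.ofReal_natCast, ← ENNReal.ofReal_div_of_pos (by positivity)]
  congr 1; field_simp

theorem studentPi_sq_gt_le {d : ℕ} (hd : 0 < d) {τ : ℝ} (hτ : 0 < τ) :
    studentPi d τ {θ | 4 * d * τ ^ 2 < ∑ i, θ i ^ 2} ≤ ENNReal.ofReal (1 / 4) := by
  have hd' : (0 : ℝ) < d := by exact_mod_cast hd
  have h := mul_meas_ge_le_lintegral (μ := studentPi d τ)
    (f := fun θ => ENNReal.ofReal ((∑ i, θ i ^ 2) / τ ^ 2)) (by fun_prop) (ENNReal.ofReal (4 * d))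
  have h2 : studentPi d τ {θ | 4 * d * τ ^ 2 < ∑ i, θ i ^ 2}
      ≤ studentPi d τ {θ | ENNReal.ofReal (4 * d) ≤ ENNReal.ofReal ((∑ i, θ i ^ 2) / τ ^ 2)} := by
    refine measure_mono fun θ hθ => ENNReal.ofReal_le_ofReal ?_
    rw [le_div_iff₀ (by positivity)]; exact (le_of_lt hθ)
  have h3 := (mul_le_mul_right h2 (ENNReal.ofReal (4 * d))).trans (h.trans (lintegral_studentPi_sq hτ).le)
  rw [mul_comm, ← ENNReal.le_div_iff_mul_le (by left; simpa using hd.ne') (by simp)] at h3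
  refine h3.trans (le_of_eq ?_)
  rw [← ENNReal.ofReal_natCast, ← ENNReal.ofReal_div_of_pos (by positivity)]
  congr 1; field_simp

/-- Markov's inequality at twice the bound on the mean `ℓ₁` norm and at four times the mean square
excludes at most `1/2 + 1/4`. -/
theorem studentPi_smallVec_ge {d : ℕ} (hd : 0 < d) {τ : ℝ} (hτ : 0 < τ) :
    ENNReal.ofReal (1 / 4) ≤ studentPi d τ (smallVec d τ) := by
  have hp := isProbabilityMeasure_studentPi d hτ
  have hc : (smallVec d τ)ᶜ ⊆ {θ | 2 * d * τ < l1norm θ} ∪ {θ | 4 * d * τ ^ 2 < ∑ i, θ i ^ 2} := by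
    intro θ hθ
    simp only [smallVec, Set.mem_compl_iff, Set.mem_ofPred_eq, not_and_or, not_le] at hθ
    exact hθ
  have h1 : studentPi d τ (smallVec d τ)ᶜ ≤ ENNReal.ofReal (3 / 4) := by
    refine (measure_mono hc).trans ((measure_union_le _ _).trans
      ((add_le_add (studentPi_l1_gt_le hd hτ) (studentPi_sq_gt_le hd hτ)).trans (le_of_eq ?_)))
    rw [← ENNReal.ofReal_add (by norm_num) (by norm_num)]; norm_num
  have h2 := prob_add_prob_compl (μ := studentPi d τ) (measurableSet_smallVec d τ)
  by_contra! hlt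
  have : studentPi d τ (smallVec d τ) + studentPi d τ (smallVec d τ)ᶜ < 1 := by
    calc _ < ENNReal.ofReal (1 / 4) + ENNReal.ofReal (3 / 4) :=
          ENNReal.add_lt_add_of_lt_of_le (ne_top_of_le_ne_top ENNReal.ofReal_ne_top h1) hlt h1
      _ = 1 := by rw [← ENNReal.ofReal_add (by norm_num) (by norm_num)]; norm_num
  exact this.ne h2

theorem studentPi_l1ball_ge {d : ℕ} (hd : 0 < d) {τ C : ℝ} (hτ : 0 < τ) (hC : 2 * d * τ ≤ C) :
    ENNReal.ofReal (1 / 4) ≤ studentPi d τ (l1ball d C) :=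
  (studentPi_smallVec_ge hd hτ).trans (measure_mono fun _ h => h.1.trans hC)

theorem normalizeMeasure_smul {Ω : Type*} [MeasurableSpace Ω] {c : ℝ≥0∞} (hc0 : c ≠ 0)
    (hc : c ≠ ∞) (μ : Measure Ω) : normalizeMeasure (c • μ) = normalizeMeasure μ := by
  simp only [normalizeMeasure, Measure.smul_apply, smul_eq_mul, smul_smul]
  rw [ENNReal.mul_inv (Or.inl hc0) (Or.inl hc), mul_right_comm, ENNReal.inv_mul_cancel hc0 hc, one_mul]

theorem priorTheta_eq (d : ℕ) {τ : ℝ} (hτ : 0 < τ) (C : ℝ) :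
    priorTheta d τ C = normalizeMeasure ((studentPi d τ).restrict (l1ball d C)) := by
  have hc : 0 < (2 / Real.pi * τ ^ 3) ^ d := by have := Real.pi_pos; positivity
  have : (studentPi d τ).restrict (l1ball d C) = ENNReal.ofReal ((2 / Real.pi * τ ^ 3) ^ d) •
      (volume.restrict (l1ball d C)).withDensity
        fun θ => ENNReal.ofReal (∏ i, ((τ ^ 2 + θ i ^ 2) ^ 2)⁻¹) := by
    rw [studentPi, restrict_withDensity (measurableSet_l1ball d C), ← withDensity_smul _ (by fun_prop)]
    congr 1
    funext θ
    rw [← ENNReal.ofReal_prod_of_nonneg fun i _ => studentDensity_nonneg hτ _, Pi.smul_apply,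
      smul_eq_mul, ← ENNReal.ofReal_mul hc.le]
    simp [studentDensity, Finset.prod_mul_distrib]
  rw [this, normalizeMeasure_smul (by simpa using hc) ENNReal.ofReal_ne_top, priorTheta]

/-- The truncation keeps at least a quarter of the mass. At the price of a factor `4`, upper bounds
may therefore use the product measure, under which coordinates are independent. -/
theorem priorTheta_le {d : ℕ} (hd : 0 < d) {τ C : ℝ} (hτ : 0 < τ) (hC : 2 * d * τ ≤ C) :
    priorTheta d τ C ≤ (4 : ℝ≥0∞) • studentPi d τ := by
  rw [priorTheta_eq d hτ, normalizeMeasure, Measure.restrict_apply_univ]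
  refine Measure.le_iff.2 fun s _ => ?_
  simp only [Measure.smul_apply, smul_eq_mul]
  refine mul_le_mul' ?_ (Measure.restrict_apply_le _ _)
  rw [ENNReal.inv_le_iff_inv_le]
  refine le_trans (le_of_eq ?_) (studentPi_l1ball_ge hd hτ hC)
  rw [one_div, ENNReal.ofReal_inv_of_pos (by norm_num)]; simp

theorem isProbabilityMeasure_priorTheta {d : ℕ} (hd : 0 < d) {τ C : ℝ} (hτ : 0 < τ)
    (hC : 2 * d * τ ≤ C) : IsProbabilityMeasure (priorTheta d τ C) := by
  have hp := isProbabilityMeasure_studentPi d hτ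
  constructor
  rw [priorTheta_eq d hτ, normalizeMeasure, Measure.smul_apply, smul_eq_mul]
  refine ENNReal.inv_mul_cancel ?_ (measure_ne_top _ _)
  rw [Measure.restrict_apply_univ]
  have := studentPi_l1ball_ge hd hτ hC
  exact (lt_of_lt_of_le (by norm_num) this).ne'

/-- Polynomial tails: `τ² + (a+t)² ≤ (1 + |a|/τ)² (τ² + t²)`, so a shift by `a` costs only a
logarithm of `|a|/τ`, and nothing when `a = 0`. -/
theorem studentDensity_add_ge {τ : ℝ} (hτ : 0 < τ) (a t : ℝ) :
    Real.exp (-(4 * Real.log (1 + |a| / τ))) * studentDensity τ t ≤ studentDensity τ (a + t) := by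
  have h1 : 0 < 1 + |a| / τ := by positivity
  have he : Real.exp (-(4 * Real.log (1 + |a| / τ))) = ((1 + |a| / τ) ^ 4)⁻¹ := by
    rw [show 4 * Real.log (1 + |a| / τ) = Real.log ((1 + |a| / τ) ^ 4) by rw [Real.log_pow]; norm_num,
      Real.exp_neg, Real.exp_log (by positivity)]
  have key : τ ^ 2 + (a + t) ^ 2 ≤ (1 + |a| / τ) ^ 2 * (τ ^ 2 + t ^ 2) := by
    set b := |a| / τ with hb
    have ha : |a| = b * τ := by rw [hb]; field_simp
    have hb0 : 0 ≤ b := by positivity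
    have e1 : a ^ 2 = b ^ 2 * τ ^ 2 := by rw [← sq_abs a, ha]; ring
    have e2 : a * t ≤ b * τ * |t| := by
      calc a * t ≤ |a * t| := le_abs_self _
        _ = _ := by rw [abs_mul, ha]
    have e3 : τ * |t| ≤ (τ ^ 2 + t ^ 2) := by nlinarith [sq_abs t, sq_nonneg (τ - |t|), sq_nonneg (τ + |t|)]
    nlinarith [mul_le_mul_of_nonneg_left e3 hb0, mul_nonneg (sq_nonneg b) (sq_nonneg t)]
  have hp : 0 < τ ^ 2 + (a + t) ^ 2 := by positivity
  have hq : 0 < τ ^ 2 + t ^ 2 := by positivity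
  rw [he, studentDensity, studentDensity, mul_left_comm]
  refine mul_le_mul_of_nonneg_left ?_ (by positivity)
  rw [← mul_inv]
  refine inv_anti₀ (by positivity) ?_
  calc (τ ^ 2 + (a + t) ^ 2) ^ 2 ≤ ((1 + |a| / τ) ^ 2 * (τ ^ 2 + t ^ 2)) ^ 2 := by gcongr
    _ = _ := by ring

/-- The logarithmic cost of moving the prior to `θ₀`. -/
noncomputable def shiftCost {d : ℕ} (τ : ℝ) (θ₀ : Vec d) : ℝ := ∑ i, 4 * Real.log (1 + |θ₀ i| / τ)

/-- The margin `2dτ` keeps `θ₀ + δ` inside the `ℓ₁` ball, and normalizing a truncated probability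
can only increase it. What remains is translation invariance of Lebesgue measure and the density
comparison in each coordinate. -/
theorem lintegral_priorTheta_ge {d : ℕ} {τ C : ℝ} (hτ : 0 < τ) {θ₀ : Vec d}
    (hθ₀ : l1norm θ₀ ≤ C - 2 * d * τ) {h : Vec d → ℝ≥0∞} (hh : Measurable h) :
    ENNReal.ofReal (Real.exp (-shiftCost τ θ₀)) *
        ∫⁻ δ in smallVec d τ, h (θ₀ + δ) ∂(studentPi d τ)
      ≤ ∫⁻ θ, h θ ∂(priorTheta d τ C) := by
  have hp := isProbabilityMeasure_studentPi d hτ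
  have hs := measurable_studentPi_density d τ
  rw [priorTheta_eq d hτ, normalizeMeasure, lintegral_smul_measure, smul_eq_mul]
  have h1 : (1 : ℝ≥0∞) ≤ ((studentPi d τ).restrict (l1ball d C) Set.univ)⁻¹ := by
    rw [ENNReal.one_le_inv, Measure.restrict_apply_univ]
    exact prob_le_one
  refine le_trans ?_ (le_mul_of_one_le_left' h1)
  have hL : ∫⁻ δ in smallVec d τ, h (θ₀ + δ) ∂(studentPi d τ)
      = ∫⁻ δ, (∏ i, ENNReal.ofReal (studentDensity τ (δ i))) *
          (smallVec d τ).indicator (fun δ => h (θ₀ + δ)) δ := by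
    rw [← lintegral_indicator (measurableSet_smallVec d τ)]
    exact lintegral_withDensity_eq_lintegral_mul _ hs
      ((hh.comp (measurable_const_add θ₀)).indicator (measurableSet_smallVec d τ))
  have hR : ∫⁻ θ in l1ball d C, h θ ∂(studentPi d τ)
      = ∫⁻ θ, (∏ i, ENNReal.ofReal (studentDensity τ (θ i))) * (l1ball d C).indicator h θ := by
    rw [← lintegral_indicator (measurableSet_l1ball d C)]
    exact lintegral_withDensity_eq_lintegral_mul _ hs (hh.indicator (measurableSet_l1ball d C))
  rw [hL, hR, ← lintegral_const_mul' _ _ ENNReal.ofReal_ne_top,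
    ← lintegral_add_left_eq_self (μ := (volume : Measure (Vec d)))
      (fun θ => (∏ i, ENNReal.ofReal (studentDensity τ (θ i))) * (l1ball d C).indicator h θ) θ₀]
  refine lintegral_mono fun δ => ?_
  by_cases hδ : δ ∈ smallVec d τ
  · have hb : θ₀ + δ ∈ l1ball d C := by
      have : l1norm (θ₀ + δ) ≤ l1norm θ₀ + l1norm δ := by
        rw [l1norm, l1norm, l1norm, ← Finset.sum_add_distrib]
        exact Finset.sum_le_sum fun i _ => abs_add_le _ _
      have := hδ.1
      simp only [l1ball, Set.mem_ofPred_eq]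
      linarith
    rw [Set.indicator_of_mem hδ, Set.indicator_of_mem hb, ← mul_assoc]
    refine mul_le_mul_left ?_ _
    rw [shiftCost, ← Finset.sum_neg_distrib, Real.exp_sum,
      ENNReal.ofReal_prod_of_nonneg fun i _ => (Real.exp_pos _).le, ← Finset.prod_mul_distrib]
    refine Finset.prod_le_prod' fun i _ => ?_
    rw [← ENNReal.ofReal_mul (Real.exp_pos _).le]
    exact ENNReal.ofReal_le_ofReal (studentDensity_add_ge hτ _ _)
  · rw [Set.indicator_of_notMem hδ]
    simp

end SparseRegression

namespace SparseRegression

/-! ### Exponential moments of the excess under the prior -/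

/-- The logarithm of the inverse off-mass, the cost of one coordinate away from `0`. -/
noncomputable def coordCost {n d : ℕ} (Cx : ℝ) (z : Fin n → Obs d) : ℝ :=
  Real.log (16 / offMass Cx z)

theorem one_le_coordCost {n d : ℕ} (hd : 0 < d) (Cx : ℝ) (z : Fin n → Obs d) :
    1 ≤ coordCost Cx z := by
  have h0 := offMass_pos hd Cx z
  have h1 := offMass_le Cx z
  rw [coordCost, Real.le_log_iff_exp_le (by positivity), le_div_iff₀ h0]
  have := Real.exp_one_lt_d9
  nlinarith

theorem coordCost_le {n d : ℕ} (hd : 0 < d) (Cx : ℝ) (z : Fin n → Obs d) :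
    coordCost Cx z ≤ Real.log (32 * d) := by
  have h0 := offMass_pos hd Cx z
  have hd' : (1 : ℝ) ≤ d := by exact_mod_cast hd
  refine Real.log_le_log (by positivity) ?_
  have h1 : 1 / (2 * d) ≤ offMass Cx z := by
    refine le_min ?_ ?_
    · rw [div_le_div_iff₀ (by positivity) (by positivity)]
      nlinarith [one_le_designSize Cx z]
    · rw [div_le_div_iff₀ (by positivity) (by positivity)]; linarith
  rw [div_le_iff₀ h0]
  calc (16 : ℝ) = 32 * d * (1 / (2 * d)) := by field_simp; norm_num
    _ ≤ _ := by gcongr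

theorem measurable_roundCost (ω : ℤ → ℝ) (c : ℝ) : Measurable (roundCost ω c) := by
  have h1 : Measurable fun t : ℝ => Int.fract t := measurable_fract
  have h2 : ∀ b, Measurable fun t => roundProb t b := fun b => by
    cases b <;> simp only [roundProb, if_true, Bool.false_eq_true, if_false] <;> fun_prop
  have h3 : ∀ b, Measurable fun t => roundAt t b := fun b => by
    cases b <;> simp only [roundAt, if_true, Bool.false_eq_true, if_false]
    · exact Int.measurable_floor.add_const 0
    · exact Int.measurable_floor.add_const 1
  unfold roundCost
  refine Measurable.add (Finset.measurable_sum _ fun b _ => (h2 b).mul ?_) (by fun_prop)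
  exact (Real.measurable_log.comp ((measurable_of_countable ω).comp (h3 b))).neg

/-- Used with `w` proportional to the square of `τ` over the mesh width: a `5/2` power becomes a
square in an exponent, and those squares have an explicit sum over the coordinates. -/
theorem one_add_add_le_exp {y w : ℝ} (hy : 0 ≤ y) (hw : 0 ≤ w) :
    1 + y + w ^ (5 / 4 : ℝ) ≤ Real.exp (y + 5 / 4 * w) := by
  have h1 : 1 + w ^ (5 / 4 : ℝ) ≤ Real.exp (5 / 4 * w) := by
    have h2 : 1 + w ^ (5 / 4 : ℝ) ≤ (1 + w) ^ (5 / 4 : ℝ) := by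
      have := Real.add_rpow_le_rpow_add (p := 5 / 4) zero_le_one hw (by norm_num)
      simpa using this
    refine h2.trans ?_
    calc (1 + w) ^ (5 / 4 : ℝ) ≤ (Real.exp w) ^ (5 / 4 : ℝ) :=
          Real.rpow_le_rpow (by linarith) (by linarith [Real.add_one_le_exp w]) (by norm_num)
      _ = _ := by rw [← Real.exp_mul]; ring_nf
  rw [Real.exp_add]
  have h3 := Real.add_one_le_exp y
  have h4 : 0 ≤ w ^ (5 / 4 : ℝ) := by positivity
  nlinarith [mul_le_mul h3 h1 (by positivity) (Real.exp_pos y).le]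

/-- The squared mesh is `A/10` divided by precision times `colSq z i + nCx²/d`, where `A` is the
coordinate cost. The variance charge is thus at most `A/20`, small enough for the factor `21/20`. -/
theorem meshCost_le {n d : ℕ} (hn : 0 < n) (hd : 0 < d) {Cx K : ℝ} (hCx : 0 < Cx) (hK : 0 < K)
    (z : Fin n → Obs d) (k : ℕ) (i : Fin d) :
    0 ≤ meshCost Cx K z k i ∧ meshCost Cx K z k i ≤ coordCost Cx z / 20 := by
  have hn' : (0 : ℝ) < n := by exact_mod_cast hn
  have hd' : (0 : ℝ) < d := by exact_mod_cast hd
  have hc := colSq_nonneg z i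
  have hp := gridPrec_pos hn hK k
  have hA := one_le_coordCost hd Cx z
  refine ⟨div_nonneg (mul_nonneg hc (sq_nonneg _)) (by positivity), ?_⟩
  have hb : 0 < colSq z i + n * Cx ^ 2 / d := by positivity
  have e : meshCost Cx K z k i
      = coordCost Cx z / 20 * (colSq z i / (colSq z i + n * Cx ^ 2 / d)) := by
    rw [meshCost, mesh, Real.sq_sqrt, gridSd_sq hn hK, ← coordCost]
    · field_simp; ring
    · rw [← coordCost]; positivity
  rw [e]
  refine mul_le_of_le_one_right (by positivity) ?_
  rw [div_le_one hb]
  have : 0 ≤ n * Cx ^ 2 / d := by positivity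
  linarith

/-- The extra `nCx²/d` per column keeps the mesh finite when a column vanishes. Summed over the `d`
columns it contributes `nCx²`, which is the `1` in the design size. -/
theorem sum_tau_div_mesh_sq {n d : ℕ} (hn : 0 < n) (hd : 0 < d) {Cx K : ℝ} (hCx : 0 < Cx)
    (hK : 0 < K) (z : Fin n → Obs d) (k : ℕ) :
    ∑ i, (tau n d Cx / mesh Cx K z k i) ^ 2
      = 10 * gridPrec n K k / (coordCost Cx z * d) * designSize Cx z := by
  have hn' : (0 : ℝ) < n := by exact_mod_cast hn
  have hd' : (0 : ℝ) < d := by exact_mod_cast hd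
  have hp := gridPrec_pos hn hK k
  have hA := one_le_coordCost hd Cx z
  have hA' : 0 < coordCost Cx z := by linarith
  have e : ∀ i, (tau n d Cx / mesh Cx K z k i) ^ 2 = 10 * gridPrec n K k / (coordCost Cx z * d) *
      (colSq z i / (n * Cx ^ 2) + 1 / d) := by
    intro i
    have hc := colSq_nonneg z i
    have hb : 0 < colSq z i + n * Cx ^ 2 / d := by positivity
    rw [div_pow, mesh, Real.sq_sqrt, ← coordCost, tau, div_pow, mul_pow, Real.sq_sqrt (by positivity)]
    · field_simp
    · rw [← coordCost]; positivity
  simp_rw [e]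
  rw [← Finset.mul_sum, Finset.sum_add_distrib, ← Finset.sum_div, designSize]
  simp only [one_div, Finset.sum_const, Finset.card_univ, Fintype.card_fin, nsmul_eq_mul]
  rw [mul_inv_cancel₀ hd'.ne', add_comm]

theorem lintegral_exp_roundCost_le {q c B τ u M : ℝ} (hq0 : 0 < q) (hq1 : q ≤ 1 / 2) (hc : 0 ≤ c)
    (hB : 21 / 20 * (Real.log (16 / q) + c) ≤ B) (hB0 : 0 ≤ B) (hτ : 0 < τ) (hu : 0 < u) (hM0 : 0 ≤ M)
    (hM : ∫⁻ t, ENNReal.ofReal (|t / τ| ^ (5 / 2 : ℝ)) ∂(student τ) ≤ ENNReal.ofReal M) :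
    ∫⁻ t, ENNReal.ofReal (Real.exp (21 / 20 * roundCost (intWeight q) c (t / u))) ∂(student τ)
      ≤ ENNReal.ofReal (Real.exp (3 * q) * (1 + 2 * (B * (τ / u))
          + 17 * (Real.exp B * (M * (τ / u) ^ (5 / 2 : ℝ))))) := by
  have hp := isProbabilityMeasure_student hτ
  set v := τ / u with hv
  have hv0 : 0 < v := by positivity
  have hpt : ∀ t, ENNReal.ofReal (Real.exp (21 / 20 * roundCost (intWeight q) c (t / u)))
      ≤ ENNReal.ofReal (Real.exp (3 * q)) * (1 + ENNReal.ofReal (2 * (B * v)) * ENNReal.ofReal |t / τ|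
        + ENNReal.ofReal (17 * (Real.exp B * v ^ (5 / 2 : ℝ))) * ENNReal.ofReal (|t / τ| ^ (5 / 2 : ℝ))) := by
    intro t
    have h := exp_roundCost_le (r := t / u) hq0 hq1 hc hB
    have e : |t / u| = v * |t / τ| := by
      rw [hv, abs_div, abs_div, abs_of_pos hτ, abs_of_pos hu]; field_simp
    have e2 : |t / u| ^ (5 / 2 : ℝ) = v ^ (5 / 2 : ℝ) * |t / τ| ^ (5 / 2 : ℝ) := by
      rw [e, Real.mul_rpow hv0.le (abs_nonneg _)]
    rw [← ENNReal.ofReal_mul (by positivity), ← ENNReal.ofReal_mul (by positivity),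
      ← ENNReal.ofReal_one, ← ENNReal.ofReal_add zero_le_one (by positivity),
      ← ENNReal.ofReal_add (by positivity) (by positivity), ← ENNReal.ofReal_mul (by positivity)]
    refine ENNReal.ofReal_le_ofReal (h.trans (le_of_eq ?_))
    rw [e2, e]; ring
  refine (lintegral_mono hpt).trans ?_
  rw [lintegral_const_mul' _ _ ENNReal.ofReal_ne_top, lintegral_add_left (by fun_prop),
    lintegral_add_left (by fun_prop), lintegral_const_mul' _ _ ENNReal.ofReal_ne_top,
    lintegral_const_mul' _ _ ENNReal.ofReal_ne_top]
  simp only [lintegral_const, measure_univ, mul_one]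
  calc _ ≤ ENNReal.ofReal (Real.exp (3 * q)) * (1 + ENNReal.ofReal (2 * (B * v)) * ENNReal.ofReal 1
        + ENNReal.ofReal (17 * (Real.exp B * v ^ (5 / 2 : ℝ))) * ENNReal.ofReal M) := by
        gcongr
        simpa using lintegral_student_abs hτ
    _ = _ := by
        rw [← ENNReal.ofReal_mul (by positivity), ← ENNReal.ofReal_mul (by positivity),
          ← ENNReal.ofReal_one, ← ENNReal.ofReal_add zero_le_one (by positivity),
          ← ENNReal.ofReal_add (by positivity) (by positivity), ← ENNReal.ofReal_mul (by positivity)]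
        congr 1; ring

end SparseRegression

/-! ### Adding up the rounding costs of all coordinates -/

namespace SparseRegression

/-- The first term is at most `3W` because `qd ≤ W`. The second is split by the arithmetic–geometric
inequality. In the third, `e^(9A/10)` is of order `q^(-9/10)`: for small `q = W/d` the product with
`W/d` is of order `q^(1/10)` and fits into `ε·lam`; for `q` bounded below, `lam ≤ Kd` gives a
multiple of `W`. The part `2ε·lam` is left for the noise prior. -/
theorem exists_exponent_bound {K ε D : ℝ} (hK : 0 < K) (hε : 0 < ε) (hD : 0 < D) :
    ∃ C : ℝ, 0 < C ∧ ∀ A W d q lam S : ℝ, 1 ≤ A → 1 ≤ W → 0 < d → q = min (W / d) (1 / 2) →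
      A = Real.log (16 / q) → 0 < lam → lam ≤ K * d → 0 ≤ S →
      S ^ 2 ≤ d * (10 * lam / (A * d) * W) →
      3 * q * d + 2 * (9 / 8 * A) * S
        + 5 / 4 * (D * (Real.exp (9 / 8 * A)) ^ (4 / 5 : ℝ)) * (10 * lam / (A * d) * W)
        ≤ 2 * ε * lam + C * (A * W) := by
  set D' := 5 / 4 * D * 10 * 16 with hD'
  have hD'0 : 0 < D' := by positivity
  -- Below this threshold `q^(1/10) ≤ ε/D'`; the cap `1/2` makes `q = W/d` there.
  set q0 : ℝ := min (1 / 2) ((ε / D') ^ 10) with hq0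
  have hq0p : 0 < q0 := lt_min (by norm_num) (by positivity)
  refine ⟨3 + 13 / ε + D' * K * q0⁻¹, by positivity, ?_⟩
  intro A W d q lam S hA hW hd hq hAq hl hlK hS hS2
  have hx : 0 < W / d := by positivity
  have hq0' : 0 < q := by rw [hq]; exact lt_min hx (by norm_num)
  have hA0 : 0 < A := by linarith
  have hAW : W ≤ A * W := by nlinarith
  have t1 : 3 * q * d ≤ 3 * (A * W) := by
    have : q * d ≤ W := by
      have : q ≤ W / d := by rw [hq]; exact min_le_left _ _
      exact (le_div_iff₀ hd).1 this
    linarith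
  -- After squaring, the left side is at most `(810/16)·A·lam·W`, and `4·13 = 52` is larger.
  have t2 : 2 * (9 / 8 * A) * S ≤ ε * lam + 13 / ε * (A * W) := by
    have e1 : d * (10 * lam / (A * d) * W) = 10 * lam * W / A := by field_simp
    rw [e1, le_div_iff₀ hA0] at hS2
    have hsq : (2 * (9 / 8 * A) * S) ^ 2 ≤ (ε * lam + 13 / ε * (A * W)) ^ 2 := by
      have h1 : (2 * (9 / 8 * A) * S) ^ 2 ≤ 81 / 16 * A * (10 * lam * W) := by
        calc _ = 81 / 16 * A * (S ^ 2 * A) := by ring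
          _ ≤ _ := by gcongr
      have h2 : 4 * (13 * (lam * (A * W))) ≤ (ε * lam + 13 / ε * (A * W)) ^ 2 := by
        have : (ε * lam + 13 / ε * (A * W)) ^ 2
            = (ε * lam - 13 / ε * (A * W)) ^ 2 + 4 * (13 * (lam * (A * W))) := by
          field_simp; ring
        rw [this]; nlinarith [sq_nonneg (ε * lam - 13 / ε * (A * W))]
      have h3 : 0 ≤ lam * (A * W) := by positivity
      nlinarith
    exact (abs_le_of_sq_le_sq' hsq (by positivity)).2
  have t3 : 5 / 4 * (D * (Real.exp (9 / 8 * A)) ^ (4 / 5 : ℝ)) * (10 * lam / (A * d) * W)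
      ≤ ε * lam + D' * K * q0⁻¹ * (A * W) := by
    have e1 : (Real.exp (9 / 8 * A)) ^ (4 / 5 : ℝ) ≤ 16 * q⁻¹ ^ (9 / 10 : ℝ) := by
      rw [← Real.exp_mul, show 9 / 8 * A * (4 / 5) = A * (9 / 10 : ℝ) by ring, Real.exp_mul, hAq,
        Real.exp_log (by positivity), div_eq_mul_inv, Real.mul_rpow (by norm_num) (by positivity)]
      gcongr
      calc (16 : ℝ) ^ (9 / 10 : ℝ) ≤ 16 ^ (1 : ℝ) :=
            Real.rpow_le_rpow_of_exponent_le (by norm_num) (by norm_num)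
        _ = 16 := by norm_num
    have e2 : 10 * lam / (A * d) * W ≤ 10 * lam * (W / d) := by
      calc 10 * lam / (A * d) * W = 10 * lam * (W / d) / A := by field_simp
        _ ≤ _ := div_le_self (by positivity) hA
    have e3 : 5 / 4 * (D * (Real.exp (9 / 8 * A)) ^ (4 / 5 : ℝ)) * (10 * lam / (A * d) * W)
        ≤ D' * lam * (q⁻¹ ^ (9 / 10 : ℝ) * (W / d)) := by
      calc _ ≤ 5 / 4 * (D * (16 * q⁻¹ ^ (9 / 10 : ℝ))) * (10 * lam * (W / d)) := by gcongr
        _ = _ := by rw [hD']; ring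
    refine e3.trans ?_
    rcases le_or_gt (W / d) q0 with h | h
    · have hqx : q = W / d := by
        rw [hq]; exact min_eq_left (h.trans (min_le_left _ _))
      have e4 : q⁻¹ ^ (9 / 10 : ℝ) * (W / d) ≤ ε / D' := by
        rw [← hqx]
        have : q⁻¹ ^ (9 / 10 : ℝ) * q = q ^ (1 / 10 : ℝ) := by
          rw [Real.inv_rpow hq0'.le, ← Real.rpow_neg hq0'.le]
          nth_rewrite 2 [← Real.rpow_one q]
          rw [← Real.rpow_add hq0']; norm_num
        rw [this]
        calc q ^ (1 / 10 : ℝ) ≤ ((ε / D') ^ 10) ^ (1 / 10 : ℝ) := by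
              refine Real.rpow_le_rpow hq0'.le ?_ (by norm_num)
              rw [hqx]; exact h.trans (min_le_right _ _)
          _ = ε / D' := by
              rw [← Real.rpow_natCast, ← Real.rpow_mul (by positivity)]; norm_num
      calc D' * lam * (q⁻¹ ^ (9 / 10 : ℝ) * (W / d)) ≤ D' * lam * (ε / D') := by gcongr
        _ = ε * lam := by field_simp
        _ ≤ _ := by
            have : 0 ≤ D' * K * q0⁻¹ * (A * W) := by positivity
            linarith
    · have hqq : q0 ≤ q := by rw [hq]; exact le_min h.le (min_le_left _ _)
      have e5 : q⁻¹ ^ (9 / 10 : ℝ) ≤ q0⁻¹ := by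
        have h1 : 1 ≤ q0⁻¹ := (one_le_inv₀ hq0p).2 ((min_le_left _ _).trans (by norm_num))
        calc q⁻¹ ^ (9 / 10 : ℝ) ≤ q0⁻¹ ^ (9 / 10 : ℝ) :=
              Real.rpow_le_rpow (by positivity) (inv_anti₀ hq0p hqq) (by norm_num)
          _ ≤ q0⁻¹ ^ (1 : ℝ) := Real.rpow_le_rpow_of_exponent_le h1 (by norm_num)
          _ = _ := Real.rpow_one _
      calc D' * lam * (q⁻¹ ^ (9 / 10 : ℝ) * (W / d)) ≤ D' * (K * d) * (q0⁻¹ * (W / d)) := by gcongr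
        _ = D' * K * q0⁻¹ * W := by field_simp
        _ ≤ D' * K * q0⁻¹ * (A * W) := by gcongr
        _ ≤ _ := by have : 0 ≤ ε * lam := by positivity
                    linarith
  linarith

/-- For fixed `σ` the exponential of the excess is a product over coordinates, so its integral under
the untruncated prior is a product of one-dimensional integrals. The sum of `τ/mesh` is controlled
by Cauchy–Schwarz, the sum of squares is explicit. -/
theorem exists_lintegral_exp_excess_studentPi {K ε : ℝ} (hK : 0 < K) (hε : 0 < ε) :
    ∃ C : ℝ, 0 < C ∧ ∀ (n d : ℕ) (Cx β : ℝ) (z : Fin n → Obs d) (σ : ℝ), 0 < n → n < d → 0 < Cx →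
      0 < σ →
      ∫⁻ θ, ENNReal.ofReal (Real.exp (21 / 20 * excess Cx K β z θ σ)) ∂(studentPi d (tau n d Cx))
        ≤ ENNReal.ofReal (Real.exp (21 / 20 * (1 / 2 + 1 / (2 * K * σ ^ 2)
            - Real.log (gridWeight n β (gridIndex n K σ))) + (2 * ε * (σ ^ 2)⁻¹
            + C * (coordCost Cx z * designSize Cx z)))) := by
  obtain ⟨M, hM1, hM⟩ := exists_lintegral_student_rpow
  have hM0 : 0 < M := by linarith
  obtain ⟨C, hC, hbound⟩ := exists_exponent_bound (D := (17 * M) ^ (4 / 5 : ℝ)) hK hε (by positivity)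
  refine ⟨C, hC, fun n d Cx β z σ hn hnd hCx hσ => ?_⟩
  have hd : 0 < d := hn.trans hnd
  have hn' : (0 : ℝ) < n := by exact_mod_cast hn
  have hd' : (0 : ℝ) < d := by exact_mod_cast hd
  have hτ : 0 < tau n d Cx := by unfold tau; positivity
  set τ := tau n d Cx with hτdef
  set k := gridIndex n K σ with hk
  set q := offMass Cx z with hq
  set A := coordCost Cx z with hA
  set W := designSize Cx z with hW
  set B := 9 / 8 * A with hB
  set c0 := 21 / 20 * (1 / 2 + 1 / (2 * K * σ ^ 2) - Real.log (gridWeight n β k)) with hc0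
  have hA1 : 1 ≤ A := one_le_coordCost hd Cx z
  have hB0 : 0 ≤ B := by positivity
  set v : Fin d → ℝ := fun i => τ / mesh Cx K z k i with hv
  have hv0 : ∀ i, 0 < v i := fun i => div_pos hτ (mesh_pos hn hd hCx hK z k i)
  have hcost := fun i => meshCost_le hn hd hCx hK z k i
  have hmeas : ∀ i, Measurable fun t => ENNReal.ofReal (Real.exp (21 / 20 *
      roundCost (intWeight q) (meshCost Cx K z k i) (t / mesh Cx K z k i))) := by
    intro i
    exact (Real.measurable_exp.comp (((measurable_roundCost _ _).comp (measurable_id.div_const _)).const_mul _)).ennreal_ofReal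
  have hsplit : ∀ θ : Vec d, ENNReal.ofReal (Real.exp (21 / 20 * excess Cx K β z θ σ))
      = ENNReal.ofReal (Real.exp c0) * ∏ i, ENNReal.ofReal (Real.exp (21 / 20 *
        roundCost (intWeight q) (meshCost Cx K z k i) (θ i / mesh Cx K z k i))) := by
    intro θ
    rw [← ENNReal.ofReal_prod_of_nonneg fun i _ => (Real.exp_pos _).le, ← Real.exp_sum,
      ← ENNReal.ofReal_mul (Real.exp_pos _).le, ← Real.exp_add, ← Finset.mul_sum]
    congr 2
    rw [excess, hc0]; ring
  simp_rw [hsplit]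
  rw [lintegral_const_mul' _ _ ENNReal.ofReal_ne_top, lintegral_studentPi_prod τ (h := fun i t =>
    ENNReal.ofReal (Real.exp (21 / 20 *
      roundCost (intWeight q) (meshCost Cx K z k i) (t / mesh Cx K z k i)))) hmeas]
  set w : Fin d → ℝ := fun i => (17 * M) ^ (4 / 5 : ℝ) * Real.exp B ^ (4 / 5 : ℝ) * v i ^ 2 with hw
  have hfac : ∀ i, ∫⁻ t, ENNReal.ofReal (Real.exp (21 / 20 *
      roundCost (intWeight q) (meshCost Cx K z k i) (t / mesh Cx K z k i))) ∂(student τ)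
      ≤ ENNReal.ofReal (Real.exp (3 * q + (2 * B * v i + 5 / 4 * w i))) := by
    intro i
    refine (lintegral_exp_roundCost_le (B := B) (offMass_pos hd Cx z) (offMass_le Cx z) (hcost i).1 ?_ hB0 hτ
      (mesh_pos hn hd hCx hK z k i) hM0.le (hM τ hτ)).trans (ENNReal.ofReal_le_ofReal ?_)
    -- `(21/20)(A + A/20) = (441/400) A ≤ (9/8) A`, which explains the choice of `B`.
    · have := (hcost i).2
      rw [← hq, ← coordCost, ← hA] at *
      change 21 / 20 * (A + _) ≤ _
      rw [hB]; linarith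
    · rw [Real.exp_add]
      refine mul_le_mul_of_nonneg_left ?_ (Real.exp_pos _).le
      have hvi := hv0 i
      have e : w i ^ (5 / 4 : ℝ) = 17 * (Real.exp B * (M * v i ^ (5 / 2 : ℝ))) := by
        simp only [hw]
        rw [Real.mul_rpow (by positivity) (by positivity), Real.mul_rpow (by positivity) (by positivity),
          ← Real.rpow_mul (by positivity), ← Real.rpow_mul (by positivity), ← Real.rpow_natCast (v i) 2,
          ← Real.rpow_mul hvi.le]
        norm_num
        ring
      have := one_add_add_le_exp (y := 2 * B * v i) (w := w i) (by positivity) (by positivity)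
      rw [e] at this
      calc _ = 1 + 2 * B * v i + 17 * (Real.exp B * (M * v i ^ (5 / 2 : ℝ))) := by
            simp only [hv]; ring
        _ ≤ _ := this
  calc _ ≤ ENNReal.ofReal (Real.exp c0) *
        ∏ i, ENNReal.ofReal (Real.exp (3 * q + (2 * B * v i + 5 / 4 * w i))) :=
        mul_le_mul_right (Finset.prod_le_prod' fun i _ => hfac i) _
    _ = ENNReal.ofReal (Real.exp (c0 + ∑ i, (3 * q + (2 * B * v i + 5 / 4 * w i)))) := by
        rw [← ENNReal.ofReal_prod_of_nonneg fun i _ => (Real.exp_pos _).le, ← Real.exp_sum,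
          ← ENNReal.ofReal_mul (Real.exp_pos _).le, ← Real.exp_add]
    _ ≤ _ := by
        refine ENNReal.ofReal_le_ofReal (Real.exp_le_exp.2 (add_le_add_right ?_ c0))
        have hV := sum_tau_div_mesh_sq hn hd hCx hK z k
        have hS : (∑ i, v i) ^ 2 ≤ d * (10 * gridPrec n K k / (A * d) * W) := by
          rw [← hV]
          have := sq_sum_le_card_mul_sum_sq (s := Finset.univ) (f := v)
          simpa using this
        have hlam := gridPrec_pos hn hK k
        have hlK : gridPrec n K k ≤ K * d := (gridPrec_le_top hK k).trans
          (mul_le_mul_of_nonneg_left (by exact_mod_cast hnd.le) hK.le)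
        have hb := hbound A W d q (gridPrec n K k) (∑ i, v i) hA1 (one_le_designSize Cx z) hd' rfl rfl
          hlam hlK (Finset.sum_nonneg fun i _ => (hv0 i).le) hS
        have hsum : ∑ i, (3 * q + (2 * B * v i + 5 / 4 * w i))
            = 3 * q * d + 2 * (9 / 8 * A) * (∑ i, v i)
              + 5 / 4 * ((17 * M) ^ (4 / 5 : ℝ) * Real.exp (9 / 8 * A) ^ (4 / 5 : ℝ))
                * (10 * gridPrec n K k / (A * d) * W) := by
          have e1 : ∑ i, w i = (17 * M) ^ (4 / 5 : ℝ) * Real.exp B ^ (4 / 5 : ℝ) * ∑ i, v i ^ 2 := by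
            simp only [hw, Finset.mul_sum]
          have e2 : ∑ i, v i ^ 2 = 10 * gridPrec n K k / (A * d) * W := hV
          simp only [Finset.sum_add_distrib, ← Finset.mul_sum]
          rw [e1, e2]
          simp only [Finset.sum_const, Finset.card_univ, Fintype.card_fin, nsmul_eq_mul]
          ring
        rw [hsum]
        have hl2 := mul_le_mul_of_nonneg_left (gridPrec_le hn hK hσ) hε.le
        rw [← hk] at hl2
        linarith

end SparseRegression

namespace SparseRegression

/-! ### The prior on the noise level -/

/-- Density of the inverse-Gamma distribution. -/
noncomputable def invGammaDensity (a b x : ℝ) : ℝ :=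
  b ^ a / Real.Gamma a * x ^ (-a - 1) * Real.exp (-b / x)

theorem measurable_invGammaDensity (a b : ℝ) :
    Measurable fun x => ENNReal.ofReal (invGammaDensity a b x) := by
  unfold invGammaDensity; fun_prop

theorem lintegral_priorSigma (a b : ℝ) {h : ℝ → ℝ≥0∞} (hh : Measurable h) :
    ∫⁻ σ, h σ ∂(priorSigma a b)
      = ∫⁻ x in Set.Ioi 0, ENNReal.ofReal (invGammaDensity a b x) * h (Real.sqrt x) := by
  rw [priorSigma, lintegral_map hh Real.continuous_sqrt.measurable, invGamma]
  exact lintegral_withDensity_eq_lintegral_mul _ (measurable_invGammaDensity a b)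
    (hh.comp Real.continuous_sqrt.measurable)

theorem ae_priorSigma_pos (a b : ℝ) : ∀ᵐ σ ∂(priorSigma a b), 0 < σ := by
  have hm : Measurable fun σ : ℝ => (Set.Iic (0 : ℝ)).indicator (fun _ => (1 : ℝ≥0∞)) σ :=
    measurable_const.indicator measurableSet_Iic
  have h := lintegral_priorSigma a b hm
  have h0 : ∫⁻ x in Set.Ioi (0 : ℝ), ENNReal.ofReal (invGammaDensity a b x) *
      (Set.Iic (0 : ℝ)).indicator (fun _ => (1 : ℝ≥0∞)) (Real.sqrt x) = 0 := by
    rw [setLIntegral_congr_fun (g := fun _ => 0) measurableSet_Ioi]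
    · simp
    · intro x hx
      have : Real.sqrt x ∉ Set.Iic (0 : ℝ) := by
        simpa using (Set.mem_Ioi.1 hx)
      simp only [Set.indicator_of_notMem this, mul_zero]
  rw [h0, lintegral_indicator_const measurableSet_Iic, one_mul] at h
  rw [ae_iff]
  simpa [not_lt, Set.Iic_def] using h

/-- The substitution `x ↦ 1/x` reduces this to the Gamma integral. -/
theorem integrableOn_invGamma {s b : ℝ} (hs : 0 < s) (hb : 0 < b) :
    IntegrableOn (fun x : ℝ => x ^ (-s - 1) * Real.exp (-b / x)) (Set.Ioi 0) := by
  have h := integrableOn_rpow_mul_exp_neg_mul_rpow (p := 1) (s := s - 1) (b := b) (by linarith)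
    one_pos hb
  rw [← integrableOn_Ioi_comp_rpow_iff' _ (p := -1) (by norm_num)] at h
  refine h.congr_fun (fun x hx => ?_) measurableSet_Ioi
  have hx : 0 < x := hx
  simp only [smul_eq_mul, Real.rpow_one]
  rw [← mul_assoc, ← Real.rpow_mul hx.le, ← Real.rpow_add hx, Real.rpow_neg_one]
  ring_nf

/-- The index is at most `n log(1 + Knσ²) + 1`, and each grid step costs `β/n`. The normalization
costs `log(1 + n/β)`, since `1 - e^(-y) ≥ y/(1+y)`. -/
theorem neg_log_gridWeight_le {n : ℕ} (hn : 0 < n) {β K σ : ℝ} (hβ : 0 < β) (hK : 0 < K) :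
    -Real.log (gridWeight n β (gridIndex n K σ))
      ≤ Real.log (1 + n / β) + β + β * Real.log (1 + K * n * σ ^ 2) := by
  have hn' : (0 : ℝ) < n := by exact_mod_cast hn
  set k := gridIndex n K σ with hk
  have hx0 : 0 ≤ K * n * σ ^ 2 := by positivity
  have hl : 0 ≤ Real.log (1 + K * n * σ ^ 2) := Real.log_nonneg (by linarith)
  have hk1 : (k : ℝ) ≤ n * Real.log (1 + K * n * σ ^ 2) + 1 := by
    have h1 : n * Real.log (K * n * σ ^ 2) ≤ n * Real.log (1 + K * n * σ ^ 2) := by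
      refine mul_le_mul_of_nonneg_left ?_ hn'.le
      rcases hx0.eq_or_lt with h | h
      · rw [← h]; simp
      · exact Real.log_le_log h (by linarith)
    have h2 : k ≤ ⌈n * Real.log (1 + K * n * σ ^ 2)⌉₊ := Nat.ceil_mono h1
    have h3 := Nat.ceil_lt_add_one (mul_nonneg hn'.le hl)
    have h4 : (k : ℝ) ≤ (⌈n * Real.log (1 + K * n * σ ^ 2)⌉₊ : ℝ) := by exact_mod_cast h2
    linarith
  set y := β / n with hy
  have hy0 : 0 < y := by positivity
  have hlt : Real.exp (-y) < 1 := Real.exp_lt_one_iff.2 (neg_neg_of_pos hy0)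
  have h5 : (1 + n / β)⁻¹ ≤ 1 - Real.exp (-y) := by
    have h6 : Real.exp (-y) ≤ (1 + y)⁻¹ := by
      rw [Real.exp_neg]
      exact inv_anti₀ (by linarith) (by linarith [Real.add_one_le_exp y])
    have h7 : (1 + (n : ℝ) / β)⁻¹ = 1 - (1 + y)⁻¹ := by
      rw [hy]; field_simp; ring
    linarith
  have h8 : -Real.log (1 - Real.exp (-y)) ≤ Real.log (1 + n / β) := by
    rw [← Real.log_inv]
    refine Real.log_le_log (inv_pos.2 (by linarith)) ?_
    exact inv_le_of_inv_le₀ (by positivity) h5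
  have h9 : y * k ≤ β * Real.log (1 + K * n * σ ^ 2) + β := by
    have e : y * (n * Real.log (1 + K * n * σ ^ 2) + 1) = β * Real.log (1 + K * n * σ ^ 2) + y := by
      rw [hy]; field_simp
    have : y ≤ β := div_le_self hβ.le (by exact_mod_cast hn)
    nlinarith [mul_le_mul_of_nonneg_left hk1 hy0.le]
  rw [gridWeight, Real.log_mul (by linarith) (by positivity), Real.log_pow, Real.log_exp]
  linarith

/-- With `K = 4/b` and `ε = b/16`, the multiples of `1/σ²` add up to less than half of the `b/σ²` in
the inverse-Gamma exponent. With `β = min a 1 / 4`, the grid weights contribute at most a power `2β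
< a` of `σ²`, which stays integrable. Of the factor `n³`, two powers come from normalizing the grid
weights and one from `n^(2β) ≤ n`. -/
theorem exists_lintegral_gridCost {a b : ℝ} (ha : 0 < a) (hb : 0 < b) :
    ∃ C : ℝ, 0 < C ∧ ∀ n : ℕ, 0 < n →
      ∫⁻ σ, ENNReal.ofReal (Real.exp (21 / 20 * (1 / 2 + 1 / (2 * (4 / b) * σ ^ 2)
          - Real.log (gridWeight n (min a 1 / 4) (gridIndex n (4 / b) σ)))
          + 2 * (b / 16) * (σ ^ 2)⁻¹)) ∂(priorSigma a b) ≤ ENNReal.ofReal (C * n ^ 3) := by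
  set β := min a 1 / 4 with hβ
  set K := 4 / b with hK
  have hK0 : 0 < K := by positivity
  have hβ0 : 0 < β := by have : 0 < min a 1 := lt_min ha one_pos
                         positivity
  have hβ1 : 2 * β ≤ 1 := by have := min_le_right a 1
                             linarith
  have hβa : 2 * β < a := by have := min_le_left a 1
                             linarith
  have hG : 0 < b ^ a / Real.Gamma a := div_pos (Real.rpow_pos_of_pos hb a) (Real.Gamma_pos_of_pos ha)
  set F : ℝ → ℝ := fun x => b ^ a / Real.Gamma a * (x ^ (-a - 1) * Real.exp (-(b / 2) / x)
    + K ^ (2 * β) * (x ^ (-(a - 2 * β) - 1) * Real.exp (-(b / 2) / x))) with hF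
  have hFi : IntegrableOn F (Set.Ioi 0) :=
    ((integrableOn_invGamma ha (by positivity)).add
      ((integrableOn_invGamma (by linarith) (by positivity)).const_mul _)).const_mul _
  set C1 := Real.exp (21 / 40) * ((1 + 1 / β) ^ 2 * Real.exp (2 * β)) with hC1
  have hC10 : 0 < C1 := by positivity
  have hF0 : ∀ x ∈ Set.Ioi (0 : ℝ), 0 ≤ F x := fun x hx => by
    have hx : 0 < x := hx
    have : 0 ≤ K ^ (2 * β) := by positivity
    simp only [hF]; positivity
  refine ⟨C1 * ((∫ x in Set.Ioi 0, F x) + 1), ?_, fun n hn => ?_⟩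
  · have : 0 ≤ ∫ x in Set.Ioi 0, F x := setIntegral_nonneg measurableSet_Ioi hF0
    positivity
  have hn' : (1 : ℝ) ≤ n := by exact_mod_cast hn
  have hkm : Measurable fun σ => gridIndex n K σ := by unfold gridIndex; fun_prop
  have hwm : Measurable fun σ => Real.log (gridWeight n β (gridIndex n K σ)) :=
    (measurable_of_countable fun k => Real.log (gridWeight n β k)).comp hkm
  rw [lintegral_priorSigma a b (by fun_prop)]
  have hpt : ∀ x ∈ Set.Ioi (0 : ℝ), ENNReal.ofReal (invGammaDensity a b x) *
      ENNReal.ofReal (Real.exp (21 / 20 * (1 / 2 + 1 / (2 * K * Real.sqrt x ^ 2)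
          - Real.log (gridWeight n β (gridIndex n K (Real.sqrt x))))
          + 2 * (b / 16) * (Real.sqrt x ^ 2)⁻¹)) ≤ ENNReal.ofReal (C1 * n ^ 3 * F x) := by
    intro x hx
    have hx : 0 < x := hx
    have hd0 : 0 ≤ invGammaDensity a b x := by unfold invGammaDensity; positivity
    rw [← ENNReal.ofReal_mul hd0]
    refine ENNReal.ofReal_le_ofReal ?_
    have hw := neg_log_gridWeight_le (σ := Real.sqrt x) hn hβ0 hK0
    rw [Real.sq_sqrt hx.le] at hw ⊢
    have hw0 : 0 ≤ Real.log (1 + n / β) := Real.log_nonneg (by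
      have : 0 ≤ n / β := by positivity
      linarith)
    have hw1 : 0 ≤ Real.log (1 + K * n * x) := Real.log_nonneg (by
      have : 0 ≤ K * n * x := by positivity
      linarith)
    have e1 : 21 / 20 * (1 / 2 + 1 / (2 * K * x) - Real.log (gridWeight n β (gridIndex n K (Real.sqrt x))))
          + 2 * (b / 16) * x⁻¹ ≤ 21 / 40 + b / 2 / x + 2 * (Real.log (1 + n / β) + β
            + β * Real.log (1 + K * n * x)) := by
      have e2 : 21 / 20 * (1 / (2 * K * x)) + 2 * (b / 16) * x⁻¹ ≤ b / 2 / x := by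
        rw [hK]
        have : 21 / 20 * (1 / (2 * (4 / b) * x)) + 2 * (b / 16) * x⁻¹ = (21 / 160 + 1 / 8) * (b / x) := by
          field_simp; norm_num
        rw [this, show b / 2 / x = 1 / 2 * (b / x) by ring]
        have : 0 < b / x := by positivity
        nlinarith
      have : 0 ≤ β * Real.log (1 + K * n * x) := by positivity
      nlinarith
    have e3 : Real.exp (2 * (Real.log (1 + n / β) + β + β * Real.log (1 + K * n * x)))
        ≤ (1 + 1 / β) ^ 2 * Real.exp (2 * β) * (n ^ 3 * (1 + K ^ (2 * β) * x ^ (2 * β))) := by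
      have f1 : Real.exp (2 * Real.log (1 + n / β)) ≤ (1 + 1 / β) ^ 2 * n ^ 2 := by
        rw [mul_comm, Real.exp_mul, Real.exp_log (by positivity), ← mul_pow,
          show (2 : ℝ) = ((2 : ℕ) : ℝ) by norm_num, Real.rpow_natCast]
        have : 1 + n / β ≤ (1 + 1 / β) * n := by
          have : (1 + 1 / β) * n = n + n / β := by ring
          linarith
        gcongr
      have f2 : Real.exp (2 * β * Real.log (1 + K * n * x)) ≤ n * (1 + K ^ (2 * β) * x ^ (2 * β)) := by
        rw [mul_comm, Real.exp_mul, Real.exp_log (by positivity), ← Real.mul_rpow hK0.le hx.le]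
        calc (1 + K * n * x) ^ (2 * β) ≤ (n * (1 + K * x)) ^ (2 * β) := by
              refine Real.rpow_le_rpow (by positivity) ?_ (by positivity)
              nlinarith
          _ = n ^ (2 * β) * (1 + K * x) ^ (2 * β) := Real.mul_rpow (by positivity) (by positivity)
          _ ≤ n ^ (1 : ℝ) * (1 ^ (2 * β) + (K * x) ^ (2 * β)) := by
              refine mul_le_mul (Real.rpow_le_rpow_of_exponent_le hn' hβ1) ?_ (by positivity) (by positivity)
              exact Real.rpow_add_le_add_rpow zero_le_one (by positivity) (by positivity) hβ1
          _ = _ := by rw [Real.rpow_one, Real.one_rpow]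
      calc _ = Real.exp (2 * Real.log (1 + n / β)) * Real.exp (2 * β)
            * Real.exp (2 * β * Real.log (1 + K * n * x)) := by
            rw [← Real.exp_add, ← Real.exp_add]; ring_nf
        _ ≤ ((1 + 1 / β) ^ 2 * n ^ 2) * Real.exp (2 * β) * (n * (1 + K ^ (2 * β) * x ^ (2 * β))) := by
            gcongr
        _ = _ := by ring
    have e4 : Real.exp (-b / x) * Real.exp (b / 2 / x) = Real.exp (-(b / 2) / x) := by
      rw [← Real.exp_add]; congr 1; field_simp; ring
    have e5 : x ^ (-a - 1) * x ^ (2 * β) = x ^ (-(a - 2 * β) - 1) := by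
      rw [← Real.rpow_add hx]; ring_nf
    calc _ ≤ invGammaDensity a b x * (Real.exp (21 / 40) * Real.exp (b / 2 / x)
          * ((1 + 1 / β) ^ 2 * Real.exp (2 * β) * (n ^ 3 * (1 + K ^ (2 * β) * x ^ (2 * β))))) := by
          refine mul_le_mul_of_nonneg_left ?_ hd0
          refine (Real.exp_le_exp.2 e1).trans ?_
          rw [Real.exp_add, Real.exp_add]
          gcongr
      _ = _ := by
          simp only [hF, hC1, invGammaDensity]
          rw [← e4, ← e5]; ring
  refine (setLIntegral_mono' measurableSet_Ioi hpt).trans ?_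
  rw [← ofReal_integral_eq_lintegral_ofReal (hFi.const_mul _)]
  · rw [integral_const_mul]
    refine ENNReal.ofReal_le_ofReal ?_
    have : 0 ≤ C1 * n ^ 3 := by positivity
    nlinarith
  · refine (ae_restrict_iff' measurableSet_Ioi).2 (Filter.Eventually.of_forall fun x hx => ?_)
    exact mul_nonneg (by positivity) (hF0 x hx)

theorem exists_priorSigma_univ_le {a b : ℝ} (ha : 0 < a) (hb : 0 < b) :
    ∃ C : ℝ, 0 < C ∧ priorSigma a b Set.univ ≤ ENNReal.ofReal C := by
  have hG : 0 < b ^ a / Real.Gamma a := div_pos (Real.rpow_pos_of_pos hb a) (Real.Gamma_pos_of_pos ha)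
  have hi := (integrableOn_invGamma ha hb).const_mul (b ^ a / Real.Gamma a)
  refine ⟨max 1 (∫ x in Set.Ioi 0, b ^ a / Real.Gamma a * (x ^ (-a - 1) * Real.exp (-b / x))),
    lt_max_of_lt_left one_pos, ?_⟩
  have h := lintegral_priorSigma a b (h := fun _ => 1) measurable_const
  simp only [mul_one, lintegral_const, one_mul] at h
  rw [h]
  refine le_trans (le_of_eq ?_) (ENNReal.ofReal_le_ofReal (le_max_right _ _))
  rw [ofReal_integral_eq_lintegral_ofReal hi]
  · simp only [invGammaDensity, mul_assoc]
  · refine (ae_restrict_iff' measurableSet_Ioi).2 (Filter.Eventually.of_forall fun x hx => ?_)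
    have hx : 0 < x := hx
    simp only [Pi.zero_apply]; positivity

/-- The noise levels just above `σ₀`. -/
def noiseWindow (n : ℕ) (σ₀ : ℝ) : Set ℝ := {σ | σ₀ ≤ σ ∧ σ ^ 2 ≤ σ₀ ^ 2 * (1 + 1 / n)}

theorem measurableSet_noiseWindow (n : ℕ) (σ₀ : ℝ) : MeasurableSet (noiseWindow n σ₀) :=
  (measurableSet_le measurable_const measurable_id).inter
    (measurableSet_le (f := fun σ : ℝ => σ ^ 2) (by fun_prop) measurable_const)

/-- In terms of `σ²` the window has length `σ₀²/n`, and the density is bounded below on it. -/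
theorem exists_priorSigma_noiseWindow_ge {a b l u : ℝ} (ha : 0 < a) (hb : 0 < b) (hl : 0 < l) :
    ∃ c : ℝ, 0 < c ∧ ∀ (n : ℕ) (σ₀ : ℝ), 0 < n → 0 < σ₀ → l ≤ σ₀ ^ 2 → σ₀ ^ 2 ≤ u →
      ENNReal.ofReal (c / n) ≤ priorSigma a b (noiseWindow n σ₀) := by
  have hG : 0 < b ^ a / Real.Gamma a := div_pos (Real.rpow_pos_of_pos hb a) (Real.Gamma_pos_of_pos ha)
  -- A lower bound for the density on `[l, 2 max u 1]`, which contains the window since `1 + 1/n ≤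
  -- 2`; the maximum keeps the base positive.
  set D := b ^ a / Real.Gamma a * (2 * max u 1) ^ (-a - 1) * Real.exp (-b / l) with hD
  have hu1 : 0 < max u 1 := lt_max_of_lt_right one_pos
  have hD0 : 0 < D := by positivity
  refine ⟨D * l, by positivity, fun n σ₀ hn hσ₀ hlσ hσu => ?_⟩
  have hn' : (1 : ℝ) ≤ n := by exact_mod_cast hn
  have hm := measurableSet_noiseWindow n σ₀
  have h := lintegral_priorSigma a b (h := (noiseWindow n σ₀).indicator fun _ => 1)
    (measurable_const.indicator hm)
  rw [lintegral_indicator_const hm, one_mul] at h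
  rw [h]
  set I := Set.Icc (σ₀ ^ 2) (σ₀ ^ 2 * (1 + 1 / n)) with hI
  have hIsub : I ⊆ Set.Ioi 0 := fun x hx => lt_of_lt_of_le (by positivity) hx.1
  calc ENNReal.ofReal (D * l / n) ≤ ENNReal.ofReal D * volume I := by
        rw [hI, Real.volume_Icc, ← ENNReal.ofReal_mul hD0.le]
        refine ENNReal.ofReal_le_ofReal ?_
        calc D * l / n = D * (l / n) := by ring
          _ ≤ D * (σ₀ ^ 2 / n) := by gcongr
          _ = _ := by ring
    _ = ∫⁻ x in I, ENNReal.ofReal D := by rw [setLIntegral_const]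
    _ ≤ ∫⁻ x in I, ENNReal.ofReal (invGammaDensity a b x) *
          (noiseWindow n σ₀).indicator (fun _ => 1) (Real.sqrt x) := by
        refine setLIntegral_mono' measurableSet_Icc fun x hx => ?_
        have hx0 : 0 < x := hIsub hx
        have hmem : Real.sqrt x ∈ noiseWindow n σ₀ := by
          refine ⟨Real.le_sqrt_of_sq_le hx.1, ?_⟩
          rw [Real.sq_sqrt hx0.le]; exact hx.2
        rw [Set.indicator_of_mem hmem, mul_one]
        refine ENNReal.ofReal_le_ofReal ?_
        rw [hD, invGammaDensity]
        have hx2 : x ≤ 2 * max u 1 := by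
          refine hx.2.trans ?_
          have h1 : 1 / (n : ℝ) ≤ 1 := by rw [div_le_one (by linarith)]; exact hn'
          have h2 : σ₀ ^ 2 ≤ max u 1 := hσu.trans (le_max_left _ _)
          nlinarith [sq_nonneg σ₀]
        have hlx : l ≤ x := hlσ.trans hx.1
        have e1 : (2 * max u 1) ^ (-a - 1) ≤ x ^ (-a - 1) :=
          Real.rpow_le_rpow_of_nonpos hx0 hx2 (by linarith)
        have e2 : -b / l ≤ -b / x := by
          rw [neg_div, neg_div, neg_le_neg_iff]; gcongr
        gcongr
    _ ≤ _ := lintegral_mono_set hIsub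

end SparseRegression

namespace SparseRegression

/-! ### The excess under the full prior -/

instance isFiniteMeasure_priorSigma_of_pos {a b : ℝ} [ha : Fact (0 < a)] [hb : Fact (0 < b)] :
    IsFiniteMeasure (priorSigma a b) := by
  obtain ⟨C, -, hC⟩ := exists_priorSigma_univ_le ha.out hb.out
  exact ⟨hC.trans_lt ENNReal.ofReal_lt_top⟩

theorem measurable_sum_roundCost {d : ℕ} (ω : ℤ → ℝ) (c u : Fin d → ℝ) :
    Measurable fun θ : Vec d => ∑ i, roundCost ω (c i) (θ i / u i) :=
  Finset.measurable_sum _ fun i _ =>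
    (measurable_roundCost ω (c i)).comp ((measurable_coord i).div_const (u i))

theorem measurable_nat_family {Ω : Type*} [MeasurableSpace Ω] {F : ℕ → Ω → ℝ}
    (hF : ∀ k, Measurable (F k)) {Ω' : Type*} [MeasurableSpace Ω'] {k : Ω' → ℕ} (hk : Measurable k)
    {X : Ω' → Ω} (hX : Measurable X) : Measurable fun ω => F (k ω) (X ω) :=
  (measurable_from_prod_countable_right (f := fun q : ℕ × Ω => F q.1 q.2) hF).comp (hk.prodMk hX)

theorem measurable_gridIndex (n : ℕ) (K : ℝ) : Measurable (gridIndex n K) := by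
  unfold gridIndex
  fun_prop

theorem measurable_excess {n d : ℕ} (Cx K β : ℝ) (z : Fin n → Obs d) :
    Measurable fun p : Vec d × ℝ => excess Cx K β z p.1 p.2 := by
  have h4 : Measurable fun p : Vec d × ℝ => gridIndex n K p.2 :=
    (measurable_gridIndex n K).comp measurable_snd
  have h1 := measurable_nat_family (fun k => measurable_sum_roundCost (intWeight (offMass Cx z))
    (meshCost Cx K z k) (mesh Cx K z k)) h4 measurable_fst
  have h2 := measurable_nat_family (F := fun k (_ : Unit) => Real.log (gridWeight n β k))
    (fun k => measurable_const) h4 (measurable_const (a := ()))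
  have h3 : Measurable fun p : Vec d × ℝ => 1 / 2 + 1 / (2 * K * p.2 ^ 2) := by fun_prop
  exact (h3.sub h2).add h1

/-- Integrating over `θ` leaves `2εσ⁻²` and the grid cost, which are then integrated together over
`σ`. The factor `n³` is only `3 log n` in the exponent. -/
theorem exists_lintegral_exp_excess_prior {a b : ℝ} (ha : 0 < a) (hb : 0 < b) :
    ∃ C : ℝ, 0 < C ∧ ∀ (n d : ℕ) (Cx C₁ : ℝ) (z : Fin n → Obs d), 0 < n → n < d → 0 < Cx →
      2 * d * tau n d Cx ≤ C₁ →
      ∫⁻ p, ENNReal.ofReal (Real.exp (21 / 20 * excess Cx (4 / b) (min a 1 / 4) z p.1 p.2))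
          ∂(prior d (tau n d Cx) C₁ a b)
        ≤ ENNReal.ofReal (Real.exp (C * (Real.log (32 * d) * designSize Cx z))) := by
  have : Fact (0 < a) := ⟨ha⟩
  have : Fact (0 < b) := ⟨hb⟩
  obtain ⟨C₂, hC₂, hE⟩ := exists_lintegral_exp_excess_studentPi (K := 4 / b) (ε := b / 16)
    (by positivity) (by positivity)
  obtain ⟨C₃, hC₃, hS⟩ := exists_lintegral_gridCost ha hb
  refine ⟨4 * C₃ + 3 + C₂, by positivity, fun n d Cx C₁ z hn hnd hCx hC₁ => ?_⟩
  have hd : 0 < d := hn.trans hnd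
  have hn' : (1 : ℝ) ≤ n := by exact_mod_cast hn
  have hd' : (1 : ℝ) ≤ d := by exact_mod_cast hd
  have hnd' : (n : ℝ) ≤ d := by exact_mod_cast hnd.le
  have hτ : 0 < tau n d Cx := by unfold tau; positivity
  have hp := isProbabilityMeasure_priorTheta hd hτ hC₁
  have hm : Measurable fun p : Vec d × ℝ =>
      ENNReal.ofReal (Real.exp (21 / 20 * excess Cx (4 / b) (min a 1 / 4) z p.1 p.2)) :=
    (((measurable_excess Cx _ _ z).const_mul _).exp).ennreal_ofReal
  rw [prior, lintegral_prod_symm _ hm.aemeasurable]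
  set g : ℝ → ℝ := fun σ => 21 / 20 * (1 / 2 + 1 / (2 * (4 / b) * σ ^ 2)
    - Real.log (gridWeight n (min a 1 / 4) (gridIndex n (4 / b) σ))) + 2 * (b / 16) * (σ ^ 2)⁻¹ with hg
  set w := C₂ * (coordCost Cx z * designSize Cx z) with hw
  have h1 : ∀ᵐ σ ∂(priorSigma a b),
      ∫⁻ θ, ENNReal.ofReal (Real.exp (21 / 20 * excess Cx (4 / b) (min a 1 / 4) z θ σ))
        ∂(priorTheta d (tau n d Cx) C₁)
      ≤ (4 * ENNReal.ofReal (Real.exp w)) * ENNReal.ofReal (Real.exp (g σ)) := by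
    filter_upwards [ae_priorSigma_pos a b] with σ hσ
    refine (lintegral_mono' (priorTheta_le hd hτ hC₁) le_rfl).trans ?_
    rw [lintegral_smul_measure]
    refine (mul_le_mul_right (hE n d Cx (min a 1 / 4) z σ hn hnd hCx hσ) _).trans (le_of_eq ?_)
    have e : ENNReal.ofReal (Real.exp w) * ENNReal.ofReal (Real.exp (g σ))
        = ENNReal.ofReal (Real.exp (w + g σ)) := by
      rw [← ENNReal.ofReal_mul (Real.exp_pos _).le, ← Real.exp_add]
    rw [mul_assoc (4 : ℝ≥0∞), e]
    congr 3
    simp only [hg, hw]; ring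
  refine (lintegral_mono_ae h1).trans ?_
  rw [lintegral_const_mul' _ _ (ENNReal.mul_ne_top (by norm_num) ENNReal.ofReal_ne_top)]
  refine (mul_le_mul_right (hS n hn) _).trans ?_
  have h4 : (4 : ℝ≥0∞) = ENNReal.ofReal 4 := by simp
  rw [h4, ← ENNReal.ofReal_mul (by norm_num), ← ENNReal.ofReal_mul (by positivity)]
  refine ENNReal.ofReal_le_ofReal ?_
  have e1 : 4 * C₃ ≤ Real.exp (4 * C₃) := by linarith [Real.add_one_le_exp (4 * C₃)]
  have e2 : (n : ℝ) ^ 3 = Real.exp (3 * Real.log n) := by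
    rw [mul_comm, Real.exp_mul, Real.exp_log (by linarith)]
    norm_cast
  have e3 : Real.log n ≤ Real.log (32 * d) := Real.log_le_log (by linarith) (by linarith)
  have e4 := one_le_designSize Cx z
  have e5 := coordCost_le hd Cx z
  have e6 := (one_le_coordCost hd Cx z).trans e5
  calc 4 * Real.exp w * (C₃ * n ^ 3) = 4 * C₃ * Real.exp (3 * Real.log n) * Real.exp w := by
        rw [e2]; ring
    _ ≤ Real.exp (4 * C₃) * Real.exp (3 * Real.log n) * Real.exp w := by gcongr
    _ = Real.exp (4 * C₃ + 3 * Real.log n + w) := by rw [Real.exp_add, Real.exp_add]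
    _ ≤ _ := by
      refine Real.exp_le_exp.2 ?_
      have f1 : 1 ≤ Real.log (32 * d) * designSize Cx z := one_le_mul_of_one_le_of_one_le e6 e4
      have f2 : Real.log n ≤ Real.log (32 * d) * designSize Cx z :=
        e3.trans (le_mul_of_one_le_right (by linarith) e4)
      have f3 : w ≤ C₂ * (Real.log (32 * d) * designSize Cx z) := by
        simp only [hw]; gcongr
      nlinarith

/-! ### A lower bound for the evidence -/

/-- Completing the square leaves a multiple of a Gaussian density of precision `2/σ₀² - 1/σ²`. It is
positive because `σ ≥ σ₀`, which is why the noise window lies above `σ₀`. -/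
theorem lintegral_gaussianPDF_sq_div_le {t : ℝ} (ht0 : 0 ≤ t) {σ₀ σ : ℝ} (hσ₀ : 0 < σ₀)
    (h1 : σ₀ ≤ σ) (h2 : σ ^ 2 ≤ σ₀ ^ 2 * (1 + t)) (m₀ m : ℝ) :
    ∫⁻ y, gaussianPDF m₀ (Real.toNNReal (σ₀ ^ 2)) y ^ 2 *
        (gaussianPDF (m₀ + m) (Real.toNNReal (σ ^ 2)) y)⁻¹
      ≤ ENNReal.ofReal (Real.exp (t / 2 + m ^ 2 / σ₀ ^ 2)) := by
  have hσ : 0 < σ := hσ₀.trans_le h1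
  set u := σ ^ 2 with hu
  set u₀ := σ₀ ^ 2 with hu₀
  have hu0 : 0 < u := by positivity
  have hu₀0 : 0 < u₀ := by positivity
  have hle : u₀ ≤ u := by simp only [hu, hu₀]; gcongr
  have hq : 0 < 2 * u - u₀ := by linarith
  set v := u * u₀ / (2 * u - u₀) with hv
  have hv0 : 0 < v := by positivity
  set s := Real.sqrt v with hs
  have hs0 : 0 < s := Real.sqrt_pos.2 hv0
  have hs2 : s ^ 2 = v := Real.sq_sqrt hv0.le
  set μ := m₀ - m * u₀ / (2 * u - u₀) with hμ
  set c := Real.log (σ * s / σ₀ ^ 2) + m ^ 2 / (2 * u - u₀) with hc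
  have key : ∀ y, gaussianPDF m₀ (Real.toNNReal u₀) y ^ 2 * (gaussianPDF (m₀ + m) (Real.toNNReal u) y)⁻¹
      = ENNReal.ofReal (Real.exp c) * gaussianPDF μ (Real.toNNReal (s ^ 2)) y := by
    intro y
    rw [hu, hu₀, gaussianPDF_eq_exp hσ₀, gaussianPDF_eq_exp hσ, gaussianPDF_eq_exp hs0,
      ← ENNReal.ofReal_pow (Real.exp_pos _).le, ← ENNReal.ofReal_inv_of_pos (Real.exp_pos _),
      ← ENNReal.ofReal_mul (by positivity), ← ENNReal.ofReal_mul (by positivity), ← Real.exp_neg,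
      ← Real.exp_nat_mul, ← Real.exp_add, ← Real.exp_add]
    congr 2
    simp only [hc]
    rw [Real.log_div (by positivity) (by positivity), Real.log_mul hσ.ne' hs0.ne', Real.log_pow,
      Real.log_mul (by positivity) hσ₀.ne', Real.log_mul (by positivity) hσ.ne',
      Real.log_mul (by positivity) hs0.ne', hs2, ← hu, ← hu₀]
    have : -2 * ((y - m₀) ^ 2 / (2 * u₀)) + (y - (m₀ + m)) ^ 2 / (2 * u)
        = m ^ 2 / (2 * u - u₀) - (y - μ) ^ 2 / (2 * v) := by
      simp only [hμ, hv]
      field_simp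
      ring
    push_cast
    linear_combination this
  simp_rw [key]
  rw [lintegral_const_mul _ (measurable_gaussianPDF _ _),
    lintegral_gaussianPDF_eq_one _ (toNNReal_sq_ne_zero hs0), mul_one]
  refine ENNReal.ofReal_le_ofReal (Real.exp_le_exp.2 ?_)
  have e1 : m ^ 2 / (2 * u - u₀) ≤ m ^ 2 / u₀ := by gcongr; linarith
  -- The squared factor is `u²/(u₀(2u - u₀)) ≤ u/u₀ ≤ 1 + t`, since `2u - u₀ ≥ u`.
  have e2 : 2 * Real.log (σ * s / σ₀ ^ 2) ≤ t := by
    have e3 : (σ * s / σ₀ ^ 2) ^ 2 ≤ 1 + t := by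
      rw [div_pow, mul_pow, hs2, ← hu, ← hu₀, div_le_iff₀ (by positivity), hv, ← mul_div_assoc,
        div_le_iff₀ hq]
      have : u ≤ 2 * u - u₀ := by linarith
      calc u * (u * u₀) ≤ (u₀ * (1 + t)) * ((2 * u - u₀) * u₀) := by gcongr
        _ = _ := by ring
    have e4 := Real.log_le_log (by positivity) e3
    rw [Real.log_pow] at e4
    have e5 := Real.log_le_sub_one_of_pos (x := 1 + t) (by linarith)
    push_cast at e4
    linarith
  simp only [hc]; linarith

/-- Responses are independent given the design. A window of relative width `1/n` makes the `n`
variance mismatches cost `1/2` in total. -/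
theorem lintegral_likelihood_sq_div_le {n d : ℕ} (hn : 0 < n) (x : Fin n → Vec d) (θ₀ δ : Vec d)
    {σ₀ σ : ℝ} (hσ₀ : 0 < σ₀) (hσ : σ ∈ noiseWindow n σ₀) :
    ∫⁻ y, likelihood (mkData x y) θ₀ σ₀ ^ 2 * (likelihood (mkData x y) (θ₀ + δ) σ)⁻¹
        ∂(Measure.pi fun _ : Fin n => (volume : Measure ℝ))
      ≤ ENNReal.ofReal (Real.exp (1 / 2 + (∑ i, inner ℝ (x i) δ ^ 2) / σ₀ ^ 2)) := by
  have hn' : (0 : ℝ) < n := by exact_mod_cast hn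
  have h : ∀ y : Fin n → ℝ,
      likelihood (mkData x y) θ₀ σ₀ ^ 2 * (likelihood (mkData x y) (θ₀ + δ) σ)⁻¹
      = ∏ i, (gaussianPDF (inner ℝ (x i) θ₀) (Real.toNNReal (σ₀ ^ 2)) (y i) ^ 2 *
        (gaussianPDF (inner ℝ (x i) θ₀ + inner ℝ (x i) δ) (Real.toNNReal (σ ^ 2)) (y i))⁻¹) := by
    intro y
    rw [Finset.prod_mul_distrib, Finset.prod_pow, likelihood, likelihood,
      ENNReal.prod_inv_distrib]
    · simp only [mkData, inner_add_right]
    · exact fun i _ j _ _ => Or.inr ENNReal.ofReal_ne_top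
  simp_rw [h]
  rw [lintegral_fin_prod_eq_prod (μ := fun _ => (volume : Measure ℝ))
    (f := fun i y => gaussianPDF (inner ℝ (x i) θ₀) (Real.toNNReal (σ₀ ^ 2)) y ^ 2 *
        (gaussianPDF (inner ℝ (x i) θ₀ + inner ℝ (x i) δ) (Real.toNNReal (σ ^ 2)) y)⁻¹)
    fun i => ((measurable_gaussianPDF _ _).pow_const 2).mul (measurable_gaussianPDF _ _).inv]
  refine (Finset.prod_le_prod' fun i _ => lintegral_gaussianPDF_sq_div_le
    (t := 1 / n) (by positivity) hσ₀ hσ.1 hσ.2 _ _).trans (le_of_eq ?_)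
  rw [← ENNReal.ofReal_prod_of_nonneg fun _ _ => (Real.exp_pos _).le, ← Real.exp_sum,
    Finset.sum_add_distrib, ← Finset.sum_div]
  congr 3
  · simp
    field_simp
  · rw [Finset.sum_div]

theorem sum_inner_sq_le {n d : ℕ} (z : Fin n → Obs d) (δ : Vec d) :
    ∑ j, inner ℝ (z j).2 δ ^ 2 ≤ (∑ i, colSq z i) * ∑ i, δ i ^ 2 := by
  have h : ∀ v : Vec d, ‖v‖ ^ 2 = ∑ i, v i ^ 2 := fun v => by
    rw [EuclideanSpace.norm_sq_eq]; simp
  simp only [colSq]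
  rw [Finset.sum_comm, Finset.sum_mul]
  refine Finset.sum_le_sum fun j _ => ?_
  rw [← h, ← h, ← mul_pow, ← sq_abs]
  exact pow_le_pow_left₀ (abs_nonneg _) (abs_real_inner_le_norm _ _) 2

/-- Here the scale of the prior is used: `τ² d = 1/(nCx²)` matches the normalization of the design
size. -/
theorem sum_inner_smallVec_le {n d : ℕ} (hn : 0 < n) (hd : 0 < d) {Cx : ℝ} (hCx : 0 < Cx)
    (z : Fin n → Obs d) {δ : Vec d} (hδ : δ ∈ smallVec d (tau n d Cx)) :
    ∑ j, inner ℝ (z j).2 δ ^ 2 ≤ 4 * designSize Cx z := by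
  have hn' : (0 : ℝ) < n := by exact_mod_cast hn
  have hd' : (0 : ℝ) < d := by exact_mod_cast hd
  have h0 : 0 ≤ ∑ i, colSq z i := Finset.sum_nonneg fun i _ => colSq_nonneg z i
  calc _ ≤ (∑ i, colSq z i) * ∑ i, δ i ^ 2 := sum_inner_sq_le z δ
    _ ≤ (∑ i, colSq z i) * (4 * d * tau n d Cx ^ 2) := by gcongr; exact hδ.2
    _ = 4 * ((∑ i, colSq z i) / (n * Cx ^ 2)) := by
        rw [tau, div_pow, mul_pow, Real.sq_sqrt (by positivity)]; field_simp
    _ ≤ _ := by rw [designSize]; linarith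

/-- Cauchy–Schwarz for `f^(1/2)` and `f^(-1/2)`. It bounds the inverse of an integrated likelihood
by an integral of inverse likelihoods, so that the data can be integrated out first. -/
theorem sq_measure_le_lintegral_mul_lintegral_inv {Ω : Type*} [MeasurableSpace Ω] (μ : Measure Ω)
    {f : Ω → ℝ≥0∞} (hf : Measurable f) (h0 : ∀ᵐ x ∂μ, f x ≠ 0) (ht : ∀ᵐ x ∂μ, f x ≠ ∞) :
    μ Set.univ ^ 2 ≤ (∫⁻ x, f x ∂μ) * ∫⁻ x, (f x)⁻¹ ∂μ := by
  have h := ENNReal.lintegral_mul_le_Lp_mul_Lq μ Real.HolderConjugate.two_two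
    (f := fun x => f x ^ (1 / 2 : ℝ)) (g := fun x => (f x)⁻¹ ^ (1 / 2 : ℝ))
    (hf.pow_const _).aemeasurable (hf.inv.pow_const _).aemeasurable
  have e1 : ∫⁻ x, ((fun x => f x ^ (1 / 2 : ℝ)) * fun x => (f x)⁻¹ ^ (1 / 2 : ℝ)) x ∂μ
      = μ Set.univ := by
    rw [← lintegral_one]
    refine lintegral_congr_ae ?_
    filter_upwards [h0, ht] with x hx0 hxt
    simp only [Pi.mul_apply]
    rw [← ENNReal.mul_rpow_of_nonneg _ _ (by norm_num), ENNReal.mul_inv_cancel hx0 hxt,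
      ENNReal.one_rpow]
  rw [e1] at h
  have e2 : ∀ y : ℝ≥0∞, (y ^ (1 / 2 : ℝ)) ^ (2 : ℝ) = y := fun y => by
    rw [← ENNReal.rpow_mul]; norm_num
  simp only [e2] at h
  have h2 := pow_le_pow_left' h 2
  rw [mul_pow] at h2
  have e3 : ∀ y : ℝ≥0∞, (y ^ (1 / 2 : ℝ)) ^ 2 = y := fun y => by
    rw [← ENNReal.rpow_natCast, ← ENNReal.rpow_mul]; norm_num
  rwa [e3, e3] at h2

/-- The evidence, i.e. the integral of the likelihood under the prior. -/
noncomputable def evidence {n d : ℕ} (π : Measure (Vec d × ℝ)) (z : Fin n → Obs d) : ℝ≥0∞ :=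
  ∫⁻ p, likelihood z p.1 p.2 ∂π

theorem measurable_evidence {n d : ℕ} (π : Measure (Vec d × ℝ)) [SFinite π] :
    Measurable fun z : Fin n → Obs d => evidence π z :=
  Measurable.lintegral_prod_right' (f := fun q : (Fin n → Obs d) × (Vec d × ℝ) =>
    likelihood q.1 q.2.1 q.2.2)
    (measurable_likelihood_comp measurable_fst measurable_snd.fst measurable_snd.snd)

/-- The measure that carries the lower bound for the evidence. -/
noncomputable def localPrior (n d : ℕ) (τ a b σ₀ : ℝ) : Measure (Vec d × ℝ) :=
  ((studentPi d τ).restrict (smallVec d τ)).prod ((priorSigma a b).restrict (noiseWindow n σ₀))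

theorem evidence_ge {n d : ℕ} {a b τ C₁ : ℝ} [Fact (0 < a)] [Fact (0 < b)] (hd : 0 < d) (hτ : 0 < τ)
    {θ₀ : Vec d} (hθ₀ : l1norm θ₀ ≤ C₁ - 2 * d * τ) (σ₀ : ℝ) (z : Fin n → Obs d) :
    ENNReal.ofReal (Real.exp (-shiftCost τ θ₀)) *
        ∫⁻ q, likelihood z (θ₀ + q.1) q.2 ∂(localPrior n d τ a b σ₀)
      ≤ evidence (prior d τ C₁ a b) z := by
  have hp := isProbabilityMeasure_priorTheta (C := C₁) hd hτ (by linarith [l1norm_nonneg θ₀])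
  have hps := isProbabilityMeasure_studentPi d hτ
  have hm : Measurable fun q : Vec d × ℝ => likelihood z (θ₀ + q.1) q.2 :=
    measurable_likelihood_comp measurable_const (measurable_const.add measurable_fst) measurable_snd
  rw [evidence, prior, lintegral_prod_symm _ (measurable_likelihood_comp measurable_const
    measurable_fst measurable_snd).aemeasurable, localPrior, lintegral_prod_symm _ hm.aemeasurable,
    ← lintegral_const_mul' _ _ ENNReal.ofReal_ne_top]
  refine (setLIntegral_le_lintegral _ _).trans (lintegral_mono fun σ => ?_)
  exact lintegral_priorTheta_ge hτ hθ₀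
    (measurable_likelihood_comp measurable_const measurable_id measurable_const)

/-- Exchanging the integrals reduces the claim to `∫ L₀²/L`, uniformly over the local set. The
subtracted exponent pays for the shift to `θ₀`, for the local mass of order `1/n`, and for the
Gaussian integral, which is random through the design size. -/
theorem exists_lintegral_inv_evidence_le {a b l u : ℝ} (ha : 0 < a) (hb : 0 < b) (hl : 0 < l) :
    ∃ C : ℝ, 0 < C ∧ ∀ (n d : ℕ) (ν : Measure (Vec d)) (Cx C₁ σ₀ : ℝ) (θ₀ : Vec d),
      IsProbabilityMeasure ν → 0 < n → n < d → 0 < Cx → 0 < σ₀ → l ≤ σ₀ ^ 2 → σ₀ ^ 2 ≤ u →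
      l1norm θ₀ ≤ C₁ - 2 * d * tau n d Cx →
      ∫⁻ z, likelihood z θ₀ σ₀ * (evidence (prior d (tau n d Cx) C₁ a b) z)⁻¹ *
          ENNReal.ofReal (Real.exp (-(shiftCost (tau n d Cx) θ₀ +
            C * (Real.log (32 * d) + designSize Cx z))))
          ∂(Measure.pi fun _ : Fin n => model ν θ₀ σ₀) ≤ 1 := by
  have : Fact (0 < a) := ⟨ha⟩
  have : Fact (0 < b) := ⟨hb⟩
  obtain ⟨c, hc, hw⟩ := exists_priorSigma_noiseWindow_ge (u := u) ha hb hl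
  -- `4/c` pays for the local mass, through `4n/c ≤ e^(4/c) n`; `4/l` pays for the squared
  -- perturbation of the mean over `σ₀²`; `1` covers `log n` and the additive `1/2`.
  refine ⟨1 + 4 / c + 4 / l, by positivity,
    fun n d ν Cx C₁ σ₀ θ₀ hν hn hnd hCx hσ₀ hlσ hσu hθ₀ => ?_⟩
  set C := 1 + 4 / c + 4 / l with hC
  have hd : 0 < d := hn.trans hnd
  have hn' : (1 : ℝ) ≤ n := by exact_mod_cast hn
  have hd' : (1 : ℝ) ≤ d := by exact_mod_cast hd
  have hnd' : (n : ℝ) ≤ d := by exact_mod_cast hnd.le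
  have hτ : 0 < tau n d Cx := by unfold tau; positivity
  set τ := tau n d Cx with hτdef
  have hp := isProbabilityMeasure_priorTheta (C := C₁) hd hτ (by linarith [l1norm_nonneg θ₀])
  have hps := isProbabilityMeasure_studentPi d hτ
  set ρ := localPrior n d τ a b σ₀ with hρ
  have hρfin : IsFiniteMeasure ρ := by rw [hρ, localPrior]; infer_instance
  have hsf : SFinite (prior d τ C₁ a b) := by rw [prior]; infer_instance
  have hmass : ENNReal.ofReal (c / (4 * n)) ≤ ρ Set.univ := by
    rw [hρ, localPrior, ← Set.univ_prod_univ, Measure.prod_prod, Measure.restrict_apply_univ,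
      Measure.restrict_apply_univ]
    have : c / (4 * n) = 1 / 4 * (c / n) := by field_simp
    rw [this, ENNReal.ofReal_mul (by norm_num)]
    exact mul_le_mul' (studentPi_smallVec_ge hd hτ) (hw n σ₀ hn hσ₀ hlσ hσu)
  have hmem : ∀ᵐ q ∂ρ, q.1 ∈ smallVec d τ ∧ q.2 ∈ noiseWindow n σ₀ := by
    have hms := (measurableSet_smallVec d τ).prod (measurableSet_noiseWindow n σ₀)
    rw [hρ, localPrior, Measure.prod_restrict]
    exact ae_restrict_mem hms
  set E : ℝ≥0∞ := ENNReal.ofReal (Real.exp (-shiftCost τ θ₀)) with hE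
  have hE0 : E ≠ 0 := by simp [hE, Real.exp_pos]
  have hEt : E ≠ ∞ := ENNReal.ofReal_ne_top
  set ϖ := ρ Set.univ with hϖ
  have hϖ0 : ϖ ≠ 0 := by
    refine (lt_of_lt_of_le ?_ hmass).ne'
    rw [ENNReal.ofReal_pos]; positivity
  have hϖt : ϖ ≠ ∞ := measure_ne_top _ _
  have hinv : ∀ z : Fin n → Obs d, (evidence (prior d τ C₁ a b) z)⁻¹
      ≤ E⁻¹ * (ϖ ^ 2)⁻¹ * ∫⁻ q, (likelihood z (θ₀ + q.1) q.2)⁻¹ ∂ρ := by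
    intro z
    have hm : Measurable fun q : Vec d × ℝ => likelihood z (θ₀ + q.1) q.2 :=
      measurable_likelihood_comp measurable_const (measurable_const.add measurable_fst) measurable_snd
    have h1 := sq_measure_le_lintegral_mul_lintegral_inv ρ hm
      (by filter_upwards [hmem] with q hq using likelihood_ne_zero _ _ (hσ₀.trans_le hq.2.1))
      (Filter.Eventually.of_forall fun q => likelihood_ne_top _ _ _)
    have h2 := evidence_ge (a := a) (b := b) hd hτ hθ₀ σ₀ z
    set I := ∫⁻ q, likelihood z (θ₀ + q.1) q.2 ∂ρ with hI
    set J := ∫⁻ q, (likelihood z (θ₀ + q.1) q.2)⁻¹ ∂ρ with hJ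
    refine (ENNReal.inv_le_inv.2 h2).trans ?_
    rw [ENNReal.mul_inv (Or.inl hE0) (Or.inl hEt), mul_assoc]
    refine mul_le_mul_right ?_ _
    rw [ENNReal.inv_le_iff_inv_le, ENNReal.mul_inv (Or.inl (by simp [hϖt])) (Or.inl (by simp [hϖ0])),
      inv_inv, ← div_eq_mul_inv]
    exact ENNReal.div_le_of_le_mul h1
  have hLm : ∀ (θ : Vec d) (σ : ℝ), Measurable fun z : Fin n → Obs d => likelihood z θ σ :=
    fun θ σ => measurable_likelihood_comp measurable_id measurable_const measurable_const
  have hzm := measurable_evidence (n := n) (prior d τ C₁ a b)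
  have hWm := measurable_designSize (n := n) (d := d) Cx
  set B : (Fin n → Obs d) → ℝ≥0∞ := fun z => ENNReal.ofReal (Real.exp (-(shiftCost τ θ₀ +
            C * (Real.log (32 * d) + designSize Cx z)))) with hB
  have hBm : Measurable B :=
    (((hWm.const_add _).const_mul C).const_add _).neg.exp.ennreal_ofReal
  have hF1 : Measurable fun z : Fin n → Obs d =>
      likelihood z θ₀ σ₀ * (evidence (prior d τ C₁ a b) z)⁻¹ * B z := ((hLm _ _).mul hzm.inv).mul hBm
  have hF2 : Measurable fun z : Fin n → Obs d => likelihood z θ₀ σ₀ *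
      (likelihood z θ₀ σ₀ * (evidence (prior d τ C₁ a b) z)⁻¹ * B z) := (hLm _ _).mul hF1
  rw [lintegral_pi_model ν θ₀ hσ₀ hF1, lintegral_pi_base ν hF2]
  have hone : (1 : ℝ≥0∞) = ∫⁻ _, 1 ∂(Measure.pi fun _ : Fin n => ν) := by simp
  rw [hone]
  refine lintegral_mono fun x => ?_
  set W := designSize Cx (mkData x 0) with hW
  -- The compensating factor depends on the design only, hence is constant in the responses.
  have hBx : ∀ y, B (mkData x y) = ENNReal.ofReal (Real.exp (-(shiftCost τ θ₀ +
            C * (Real.log (32 * d) + W)))) := fun _ => rfl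
  set b₀ := ENNReal.ofReal (Real.exp (-(shiftCost τ θ₀ + C * (Real.log (32 * d) + W)))) with hb₀
  have hmk : Measurable fun y : Fin n → ℝ => mkData x y :=
    measurable_mkData.comp (measurable_const.prodMk measurable_id)
  have hjoint : Measurable fun r : (Fin n → ℝ) × (Vec d × ℝ) =>
      likelihood (mkData x r.1) θ₀ σ₀ ^ 2 * (likelihood (mkData x r.1) (θ₀ + r.2.1) r.2.2)⁻¹ :=
    ((measurable_likelihood_comp (hmk.comp measurable_fst) measurable_const measurable_const).pow_const 2).mul
      (measurable_likelihood_comp (hmk.comp measurable_fst)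
        (measurable_const.add measurable_snd.fst) measurable_snd.snd).inv
  calc ∫⁻ y, likelihood (mkData x y) θ₀ σ₀ * (likelihood (mkData x y) θ₀ σ₀ *
        (evidence (prior d τ C₁ a b) (mkData x y))⁻¹ * B (mkData x y))
        ∂(Measure.pi fun _ : Fin n => (volume : Measure ℝ))
      ≤ ∫⁻ y, (b₀ * (E⁻¹ * (ϖ ^ 2)⁻¹)) * ∫⁻ q, likelihood (mkData x y) θ₀ σ₀ ^ 2 *
          (likelihood (mkData x y) (θ₀ + q.1) q.2)⁻¹ ∂ρ
          ∂(Measure.pi fun _ : Fin n => (volume : Measure ℝ)) := by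
        refine lintegral_mono fun y => ?_
        rw [hBx, lintegral_const_mul' _ _ (ENNReal.pow_ne_top (likelihood_ne_top _ _ _))]
        calc _ = b₀ * likelihood (mkData x y) θ₀ σ₀ ^ 2 * (evidence (prior d τ C₁ a b) (mkData x y))⁻¹ := by
              ring
          _ ≤ b₀ * likelihood (mkData x y) θ₀ σ₀ ^ 2 * _ := mul_le_mul_right (hinv _) _
          _ = _ := by ring
    _ = (b₀ * (E⁻¹ * (ϖ ^ 2)⁻¹)) * ∫⁻ q, ∫⁻ y, likelihood (mkData x y) θ₀ σ₀ ^ 2 *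
          (likelihood (mkData x y) (θ₀ + q.1) q.2)⁻¹
          ∂(Measure.pi fun _ : Fin n => (volume : Measure ℝ)) ∂ρ := by
        rw [lintegral_const_mul _ hjoint.lintegral_prod_right', lintegral_lintegral_swap]
        exact hjoint.aemeasurable
    _ ≤ (b₀ * (E⁻¹ * (ϖ ^ 2)⁻¹)) * ∫⁻ q, ENNReal.ofReal (Real.exp (1 / 2 + 4 / l * W)) ∂ρ := by
        refine mul_le_mul_right (lintegral_mono_ae ?_) _
        filter_upwards [hmem] with q hq
        refine (lintegral_likelihood_sq_div_le hn x θ₀ q.1 hσ₀ hq.2).trans ?_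
        refine ENNReal.ofReal_le_ofReal (Real.exp_le_exp.2 ?_)
        have h1 := sum_inner_smallVec_le hn hd hCx (mkData x 0) hq.1
        have h0 : 0 < W := lt_of_lt_of_le one_pos (one_le_designSize _ _)
        have : (∑ i, inner ℝ (x i) q.1 ^ 2) / σ₀ ^ 2 ≤ (4 * W) / l := by gcongr; exact h1
        have e : 4 * W / l = 4 / l * W := by ring
        linarith
    _ = b₀ * ENNReal.ofReal (Real.exp (1 / 2 + 4 / l * W)) * E⁻¹ * ϖ⁻¹ := by
        rw [lintegral_const, ← hϖ]
        have : (ϖ ^ 2)⁻¹ * ϖ = ϖ⁻¹ := by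
          rw [sq, ENNReal.mul_inv (Or.inl hϖ0) (Or.inl hϖt), mul_assoc,
            ENNReal.inv_mul_cancel hϖ0 hϖt, mul_one]
        calc _ = b₀ * ENNReal.ofReal (Real.exp (1 / 2 + 4 / l * W)) * E⁻¹ * ((ϖ ^ 2)⁻¹ * ϖ) := by ring
          _ = _ := by rw [this]
    _ ≤ b₀ * ENNReal.ofReal (Real.exp (1 / 2 + 4 / l * W)) * E⁻¹ * (ENNReal.ofReal (c / (4 * n)))⁻¹ :=
        mul_le_mul_right (ENNReal.inv_le_inv.2 hmass) _
    _ ≤ 1 := by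
        rw [hb₀, hE, ← ENNReal.ofReal_inv_of_pos (Real.exp_pos _),
          ← ENNReal.ofReal_inv_of_pos (by positivity), ← ENNReal.ofReal_mul (by positivity),
          ← ENNReal.ofReal_mul (by positivity), ← ENNReal.ofReal_mul (by positivity),
          ← Real.exp_neg, ← Real.exp_add, ← Real.exp_add, ENNReal.ofReal_le_one]
        have e1 : (c / (4 * n))⁻¹ ≤ Real.exp (4 / c + Real.log n) := by
          rw [Real.exp_add, Real.exp_log (by linarith)]
          have := Real.add_one_le_exp (4 / c)
          calc (c / (4 * n))⁻¹ = 4 / c * n := by field_simp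
            _ ≤ _ := by gcongr; linarith
        refine (mul_le_mul_of_nonneg_left e1 (Real.exp_pos _).le).trans ?_
        rw [← Real.exp_add, Real.exp_le_one_iff]
        have h0 : 1 ≤ W := one_le_designSize _ _
        have h2 : Real.log n ≤ Real.log (32 * d) := Real.log_le_log (by linarith) (by linarith)
        have h3 : 0 ≤ Real.log (32 * d) := Real.log_nonneg (by linarith)
        have h4 : 0 < 4 / c := by positivity
        have h5 : 0 < 4 / l := by positivity
        simp only [hC]
        nlinarith [mul_nonneg h4.le h3, mul_nonneg h5.le h3, mul_nonneg h4.le (sub_nonneg.2 h0)]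

end SparseRegression

namespace SparseRegression

/-! ### The complexity of the sparse model -/

theorem l0norm_eq_card {d : ℕ} (θ : Vec d) : l0norm θ = (Finset.univ.filter fun i => θ i ≠ 0).card := by
  rw [l0norm, ← Set.ncard_coe_finset]
  congr 1
  ext i; simp

theorem l0norm_le {d : ℕ} (θ : Vec d) : l0norm θ ≤ d := by
  rw [l0norm_eq_card]
  exact (Finset.card_le_univ _).trans (by simp)

/-- Coordinates off the support cost nothing. On the support, concavity of `log` is used through its
tangent at `m = C/(sτ)`; the linear terms cancel because `sτ + ‖θ‖₁ ≤ C`. -/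
theorem shiftCost_le {d : ℕ} {τ C : ℝ} (hτ : 0 < τ) {θ : Vec d} (hs : 1 ≤ l0norm θ)
    (hC : l1norm θ ≤ C - 2 * d * τ) :
    shiftCost τ θ ≤ 4 * (l0norm θ * Real.log (C / (l0norm θ * τ))) := by
  set s := l0norm θ with hsdef
  have hs' : (1 : ℝ) ≤ s := by exact_mod_cast hs
  have hsd : (s : ℝ) ≤ d := by exact_mod_cast l0norm_le θ
  have hC0 : 0 < C := by
    have := l1norm_nonneg θ
    have : 0 < 2 * d * τ := by have : (0 : ℝ) < d := by linarith
                               positivity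
    linarith
  set m := C / (s * τ) with hm
  have hm0 : 0 < m := by positivity
  set S := Finset.univ.filter fun i => θ i ≠ 0 with hS
  have hcard : (S.card : ℝ) = s := by rw [hsdef, l0norm_eq_card]
  have h1 : shiftCost τ θ = 4 * ∑ i ∈ S, Real.log (1 + |θ i| / τ) := by
    rw [shiftCost, ← Finset.mul_sum, hS, Finset.sum_filter_of_ne]
    intro i _ hi h
    simp [h] at hi
  have h2 : ∀ i ∈ S, Real.log (1 + |θ i| / τ) ≤ (1 + |θ i| / τ) / m - 1 + Real.log m := by
    intro i _
    have hp : 0 < 1 + |θ i| / τ := by positivity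
    have := Real.log_le_sub_one_of_pos (div_pos hp hm0)
    rw [Real.log_div hp.ne' hm0.ne'] at this
    linarith
  have h3 : ∑ i ∈ S, |θ i| ≤ l1norm θ :=
    Finset.sum_le_sum_of_subset_of_nonneg (Finset.subset_univ _) fun _ _ _ => abs_nonneg _
  have h4 : ∑ i ∈ S, ((1 + |θ i| / τ) / m - 1 + Real.log m)
      = (s + (∑ i ∈ S, |θ i|) / τ) / m - s + s * Real.log m := by
    rw [Finset.sum_add_distrib, Finset.sum_sub_distrib, ← Finset.sum_div, Finset.sum_add_distrib,
      ← Finset.sum_div]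
    simp [hcard]
  have h5 : (s + (∑ i ∈ S, |θ i|) / τ) / m ≤ s := by
    rw [div_le_iff₀ hm0, hm]
    have : s * (C / (s * τ)) = C / τ := by field_simp
    rw [this, ← sub_nonneg]
    have : C / τ - (s + (∑ i ∈ S, |θ i|) / τ) = (C - s * τ - ∑ i ∈ S, |θ i|) / τ := by
      field_simp
      ring
    rw [this]
    refine div_nonneg ?_ hτ.le
    nlinarith
  rw [h1]
  have := Finset.sum_le_sum h2
  linarith

/-- The difference of the two sides increases with `D`, and at `D = s` the claim is `s ≤ 2^(s-1)`.
-/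
theorem log_two_mul_le {s : ℕ} {D : ℝ} (hs : 1 ≤ s) (hsD : s ≤ D) :
    Real.log (2 * D) ≤ s * Real.log (2 * D / s) := by
  have hs' : (1 : ℝ) ≤ s := by exact_mod_cast hs
  rw [Real.log_div (by linarith) (by linarith)]
  have h1 : Real.log (2 * s) ≤ Real.log (2 * D) := Real.log_le_log (by linarith) (by linarith)
  have h2 : Real.log s ≤ (s - 1) * Real.log 2 := by
    have h : (s : ℝ) ≤ 2 ^ (s - 1) := by
      have : s ≤ 2 ^ (s - 1) := by have := Nat.lt_two_pow_self (n := s - 1); omega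
      exact_mod_cast this
    have := Real.log_le_log (by linarith) h
    rwa [Real.log_pow, Nat.cast_sub hs, Nat.cast_one] at this
  rw [Real.log_mul (by norm_num) (by linarith)] at h1
  nlinarith

/-- `n` times the rate dominates all the logarithmic costs. -/
theorem rate_bounds {n d : ℕ} {Cx C₁ : ℝ} {θ₀ : Vec d} (hCx : 0 < Cx) (hnd : n < d)
    (hs : 1 ≤ l0norm θ₀) (hsn : l0norm θ₀ < n) (hC : l1norm θ₀ ≤ C₁ - 2 * d * tau n d Cx) :
    1 ≤ n * rate n d (l0norm θ₀) Cx C₁ ∧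
    Real.log (32 * d) ≤ 3 * (n * rate n d (l0norm θ₀) Cx C₁) ∧
    shiftCost (tau n d Cx) θ₀ ≤ 4 * (n * rate n d (l0norm θ₀) Cx C₁) := by
  have hn' : (0 : ℝ) < n := by exact_mod_cast (by omega : 0 < n)
  have hd' : (2 : ℝ) ≤ d := by exact_mod_cast (by omega : 2 ≤ d)
  have hτ : 0 < tau n d Cx := by unfold tau; positivity
  have hs' : (1 : ℝ) ≤ l0norm θ₀ := by exact_mod_cast hs
  have hsd : (l0norm θ₀ : ℝ) ≤ d := by exact_mod_cast l0norm_le θ₀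
  have e : n * rate n d (l0norm θ₀) Cx C₁
      = l0norm θ₀ * Real.log (C₁ / (l0norm θ₀ * tau n d Cx)) := by
    have : Cx * C₁ * Real.sqrt (n * d) / l0norm θ₀ = C₁ / (l0norm θ₀ * tau n d Cx) := by
      unfold tau; field_simp
    rw [rate, this]; field_simp
  rw [e]
  -- The radius condition forces `C₁ ≥ 2dτ`, so the logarithm in the rate is at least `log(2d/s)`.
  have h1 : Real.log (2 * d) ≤ l0norm θ₀ * Real.log (C₁ / (l0norm θ₀ * tau n d Cx)) := by
    refine (log_two_mul_le hs hsd).trans ?_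
    refine mul_le_mul_of_nonneg_left (Real.log_le_log (by positivity) ?_) (by positivity)
    rw [div_le_div_iff₀ (by positivity) (by positivity)]
    have := l1norm_nonneg θ₀
    nlinarith
  have h4 : Real.log 4 ≤ Real.log (2 * d) := Real.log_le_log (by norm_num) (by linarith)
  have h5 : 1 ≤ Real.log 4 := by
    rw [Real.le_log_iff_exp_le (by norm_num)]
    linarith [Real.exp_one_lt_d9]
  refine ⟨by linarith, ?_, shiftCost_le hτ hs hC⟩
  have : (32 * d : ℝ) = 4 ^ 2 * (2 * d) := by ring
  rw [this, Real.log_mul (by norm_num) (by linarith), Real.log_pow]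
  push_cast
  linarith

theorem lintegral_designSize_le {n d : ℕ} (hn : 0 < n) {ν : Measure (Vec d)} [IsProbabilityMeasure ν]
    {Cx : ℝ} (hCx : 0 < Cx) (hν : ∫⁻ x, ‖x‖ₑ ^ 2 ∂ν < ENNReal.ofReal (Cx ^ 2)) (θ₀ : Vec d) (σ₀ : ℝ) :
    ∫⁻ z, ENNReal.ofReal (designSize Cx z) ∂(Measure.pi fun _ : Fin n => model ν θ₀ σ₀) ≤ 2 := by
  have hn' : (0 : ℝ) < n := by exact_mod_cast hn
  have hCn : 0 < n * Cx ^ 2 := by positivity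
  have h1 : ∀ z : Fin n → Obs d, ENNReal.ofReal (designSize Cx z)
      = 1 + (ENNReal.ofReal (n * Cx ^ 2))⁻¹ * ∑ j, ‖(z j).2‖ₑ ^ 2 := by
    intro z
    have e : ∑ i, colSq z i = ∑ j, ‖(z j).2‖ ^ 2 := by
      simp only [colSq]
      rw [Finset.sum_comm]
      refine Finset.sum_congr rfl fun j _ => ?_
      rw [EuclideanSpace.norm_sq_eq]; simp
    have e2 : ∀ v : Vec d, ‖v‖ₑ ^ 2 = ENNReal.ofReal (‖v‖ ^ 2) := fun v => by
      rw [ENNReal.ofReal_pow (norm_nonneg _), ofReal_norm]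
    simp_rw [e2]
    rw [← ENNReal.ofReal_sum_of_nonneg fun _ _ => sq_nonneg _,
      ← ENNReal.ofReal_inv_of_pos hCn, ← ENNReal.ofReal_mul (by positivity), designSize, e,
      ENNReal.ofReal_add one_pos.le (by positivity), ENNReal.ofReal_one, div_eq_inv_mul]
  have hm : ∀ j : Fin n, Measurable fun z : Fin n → Obs d => ‖(z j).2‖ₑ ^ 2 := fun j =>
    ((measurable_pi_apply j).snd.enorm).pow_const 2
  have h2 : ∀ j : Fin n, ∫⁻ z, ‖(z j).2‖ₑ ^ 2 ∂(Measure.pi fun _ : Fin n => model ν θ₀ σ₀)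
      = ∫⁻ x, ‖x‖ₑ ^ 2 ∂ν := by
    intro j
    have hm2 : Measurable fun o : Obs d => ‖o.2‖ₑ ^ 2 := (measurable_snd.enorm).pow_const 2
    have hm3 : Measurable fun x : Vec d => ‖x‖ₑ ^ 2 := (measurable_id.enorm).pow_const 2
    have e := (measurePreserving_eval (fun _ : Fin n => model ν θ₀ σ₀) j).lintegral_comp hm2
    simp only [Function.eval] at e
    have hm4 : Measurable fun p : Vec d × ℝ => ((inner ℝ p.1 θ₀ + p.2, p.1) : Obs d) :=
      ((measurable_fst.inner measurable_const).add measurable_snd).prodMk measurable_fst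
    have hm5 : Measurable fun p : Vec d × ℝ => ‖p.1‖ₑ ^ 2 := hm3.comp measurable_fst
    rw [e, model, lintegral_map hm2 hm4, lintegral_prod _ hm5.aemeasurable]
    simp
  simp_rw [h1]
  rw [lintegral_add_left measurable_const, lintegral_const_mul _ (Finset.measurable_sum _ fun j _ => hm j),
    lintegral_finsetSum _ fun j _ => hm j]
  simp only [h2, Finset.sum_const, Finset.card_univ, Fintype.card_fin, nsmul_eq_mul, lintegral_const,
    measure_univ, mul_one]
  have h3 : (ENNReal.ofReal (n * Cx ^ 2))⁻¹ * (n * ∫⁻ x, ‖x‖ₑ ^ 2 ∂ν) ≤ 1 := by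
    calc _ ≤ (ENNReal.ofReal (n * Cx ^ 2))⁻¹ * (n * ENNReal.ofReal (Cx ^ 2)) := by gcongr
      _ = (ENNReal.ofReal (n * Cx ^ 2))⁻¹ * ENNReal.ofReal (n * Cx ^ 2) := by
          rw [ENNReal.ofReal_mul hn'.le, ENNReal.ofReal_natCast]
      _ ≤ 1 := ENNReal.inv_mul_le_one _
  calc _ ≤ (1 : ℝ≥0∞) + 1 := by gcongr
    _ = 2 := by norm_num

/-! ### The posterior risk -/

/-- Every logarithm is bounded by its argument, except that `m₁` and `m₂` are recovered exactly. The
`20` and `21` clear the denominator of `21/20`; the 21st copy of `log(L₀/Z)` comes from the affinity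
identity. -/
theorem neg_log_affinity_le {n : ℕ} {α A L L₀ Z U g m₁ m₂ : ℝ} (hα0 : 0 < α) (hα1 : α < 1)
    (hA : 0 < A) (hL : 0 < L) (hL₀ : 0 < L₀) (hZ : 0 < Z) (hU : 0 < U) (hm₁ : 0 ≤ m₁) (hm₂ : 0 ≤ m₂)
    (hLU : L ≤ Real.exp g * U) :
    n * -Real.log A ≤ Z / L * ((A ^ n)⁻¹ * (L / L₀) ^ α) + 20 * (Z / L * Real.exp (21 / 20 * g - m₁))
      + (20 * m₁ + 21 * m₂ + 21 * (U / L₀) + 21 * (L₀ / Z * Real.exp (-m₂))) := by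
  have hlog : ∀ {x : ℝ}, 0 < x → Real.log x ≤ x - 1 := fun h => Real.log_le_sub_one_of_pos h
  have hLL : 0 < L / L₀ := by positivity
  have p1 : 0 < Z / L * ((A ^ n)⁻¹ * (L / L₀) ^ α) := by positivity
  have p2 : 0 < Z / L * Real.exp (21 / 20 * g - m₁) := by positivity
  have p3 : 0 < L₀ / Z * Real.exp (-m₂) := by positivity
  have p4 : 0 < U / L₀ := by positivity
  have h1 := hlog p1
  have h2 := hlog p2
  have h3 := hlog p3
  have h4 := hlog p4
  rw [Real.log_mul (by positivity) (by positivity), Real.log_mul (by positivity) (by positivity),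
    Real.log_inv, Real.log_pow, Real.log_rpow hLL, Real.log_div hZ.ne' hL.ne',
    Real.log_div hL.ne' hL₀.ne'] at h1
  rw [Real.log_mul (by positivity) (by positivity), Real.log_exp, Real.log_div hZ.ne' hL.ne'] at h2
  rw [Real.log_mul (by positivity) (by positivity), Real.log_exp, Real.log_div hL₀.ne' hZ.ne'] at h3
  rw [Real.log_div hU.ne' hL₀.ne'] at h4
  have h5 := Real.log_le_log hL hLU
  rw [Real.log_mul (Real.exp_pos _).ne' hU.ne', Real.log_exp] at h5
  set T₁ := Z / L * ((A ^ n)⁻¹ * (L / L₀) ^ α)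
  set T₂ := Z / L * Real.exp (21 / 20 * g - m₁)
  set T₃ := L₀ / Z * Real.exp (-m₂)
  set T₄ := U / L₀
  have h6 : Real.log L - Real.log L₀ ≤ 20 * T₂ + 20 * m₁ + 20 * (T₃ + m₂) + 21 * T₄ := by linarith
  have h7 : (1 - α) * (Real.log L - Real.log L₀) ≤ 20 * T₂ + 20 * m₁ + 20 * (T₃ + m₂) + 21 * T₄ := by
    have hX : 0 ≤ 20 * T₂ + 20 * m₁ + 20 * (T₃ + m₂) + 21 * T₄ := by positivity
    calc _ ≤ (1 - α) * (20 * T₂ + 20 * m₁ + 20 * (T₃ + m₂) + 21 * T₄) :=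
          mul_le_mul_of_nonneg_left h6 (by linarith)
      _ ≤ _ := mul_le_of_le_one_left hX (by linarith)
  linarith

/-- An infinite affinity makes the truncated divergence `0`, so that case is harmless and the bound
`A ≤ 1` need not be established. -/
theorem ofReal_mul_renyiDiv_model {d : ℕ} (ν : Measure (Vec d)) [IsProbabilityMeasure ν] {α : ℝ}
    (hα0 : 0 < α) (hα1 : α < 1) (θ₀ : Vec d) {σ₀ : ℝ} (hσ₀ : 0 < σ₀) (p : Vec d × ℝ) (hp : 0 < p.2) :
    (affinity ν α θ₀ σ₀ p = ∞ ∧ renyiDiv α (model ν p.1 p.2) (model ν θ₀ σ₀) = 0) ∨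
    ∃ A : ℝ, 0 < A ∧ affinity ν α θ₀ σ₀ p = ENNReal.ofReal A ∧
      ENNReal.ofReal (1 - α) * renyiDiv α (model ν p.1 p.2) (model ν θ₀ σ₀)
        = ENNReal.ofReal (-Real.log A) := by
  have hα : 1 / (α - 1) < 0 := one_div_neg.2 (by linarith)
  rw [renyiDiv_model ν hα0 hα1 θ₀ hσ₀ p hp]
  by_cases h : affinity ν α θ₀ σ₀ p = ∞
  · refine Or.inl ⟨h, ?_⟩
    rw [h, ENNReal.log_top, EReal.coe_mul_top_of_neg hα]
    simp
  · refine Or.inr ⟨(affinity ν α θ₀ σ₀ p).toReal,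
      ENNReal.toReal_pos (affinity_ne_zero ν θ₀ hσ₀ p hp) h, (ENNReal.ofReal_toReal h).symm, ?_⟩
    have hpos := ENNReal.toReal_pos (affinity_ne_zero (α := α) ν θ₀ hσ₀ p hp) h
    conv_lhs => rw [← ENNReal.ofReal_toReal h]
    rw [ENNReal.log_ofReal_of_pos hpos, ← EReal.coe_mul, EReal.toENNReal_of_ne_top (EReal.coe_ne_top _),
      EReal.toReal_coe, ← ENNReal.ofReal_mul (by linarith)]
    congr 1
    have : α - 1 ≠ 0 := by linarith
    field_simp
    ring

/-- The real inequality multiplied by `L`: terms with `Z/L` become prior integrands times `Z`, while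
the terms depending only on the data keep the factor `L` and integrate to `Z`. -/
theorem renyiDiv_mul_likelihood_le {n d : ℕ} (hn : 0 < n) (hd : 0 < d) {Cx K β : ℝ} (hCx : 0 < Cx)
    (hK : 0 < K) (hβ : 0 < β) (ν : Measure (Vec d)) [IsProbabilityMeasure ν] {α : ℝ}
    (hα0 : 0 < α) (hα1 : α < 1) (θ₀ : Vec d) {σ₀ : ℝ} (hσ₀ : 0 < σ₀) (z : Fin n → Obs d) {Z : ℝ≥0∞}
    (hZ0 : Z ≠ 0) (hZt : Z ≠ ∞) {m₁ m₂ : ℝ} (hm₁ : 0 ≤ m₁) (hm₂ : 0 ≤ m₂) (p : Vec d × ℝ)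
    (hp : 0 < p.2) :
    likelihood z p.1 p.2 * (ENNReal.ofReal (n * (1 - α)) *
        renyiDiv α (model ν p.1 p.2) (model ν θ₀ σ₀))
      ≤ Z * ((affinity ν α θ₀ σ₀ p ^ n)⁻¹ * (likelihood z p.1 p.2 / likelihood z θ₀ σ₀) ^ α
          + 20 * (ENNReal.ofReal (Real.exp (-m₁)) *
            ENNReal.ofReal (Real.exp (21 / 20 * excess Cx K β z p.1 p.2))))
        + likelihood z p.1 p.2 * (ENNReal.ofReal (20 * m₁ + 21 * m₂)
          + 21 * (mixLik Cx K β z / likelihood z θ₀ σ₀)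
          + 21 * (likelihood z θ₀ σ₀ * Z⁻¹ * ENNReal.ofReal (Real.exp (-m₂)))) := by
  have hL0 := likelihood_ne_zero z p.1 hp
  have hLt := likelihood_ne_top z p.1 p.2
  have hL₀0 := likelihood_ne_zero z θ₀ hσ₀
  have hL₀t := likelihood_ne_top z θ₀ σ₀
  have hdom := likelihood_le_mixLik hn hd hCx hK hβ z p.1 hp
  rcases ofReal_mul_renyiDiv_model ν hα0 hα1 θ₀ hσ₀ p hp with ⟨-, h⟩ | ⟨A, hA, hAe, hR⟩
  · simp [h]
  rw [ENNReal.ofReal_mul (Nat.cast_nonneg n), mul_assoc (ENNReal.ofReal (n : ℝ)), hR, hAe,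
    ← ENNReal.ofReal_mul (Nat.cast_nonneg n)]
  set L := likelihood z p.1 p.2
  set L₀ := likelihood z θ₀ σ₀
  set U := mixLik Cx K β z
  set g := excess Cx K β z p.1 p.2
  have hU0 : U ≠ 0 := fun h => hL0 (by rw [h, mul_zero] at hdom; exact le_antisymm hdom zero_le)
  -- If the mixture is infinite, so is the right side, as `L ≠ 0` and `L₀` is finite.
  by_cases hUt : U = ∞
  · rw [hUt, ENNReal.top_div_of_ne_top hL₀t]
    simp [hL0]
  clear_value L L₀ U g
  lift L to ℝ≥0 using hLt
  lift L₀ to ℝ≥0 using hL₀t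
  lift U to ℝ≥0 using hUt
  lift Z to ℝ≥0 using hZt
  have toR : ∀ x : ℝ≥0, (x : ℝ≥0∞) ≠ 0 → 0 < (x : ℝ) := fun x hx => by
    have : x ≠ 0 := by simpa using hx
    exact_mod_cast pos_iff_ne_zero.2 this
  have cR : ∀ x : ℝ≥0, (x : ℝ≥0∞) = ENNReal.ofReal x := fun x => (ENNReal.ofReal_coe_nnreal).symm
  have pL := toR L hL0
  have pL₀ := toR L₀ hL₀0
  have pU := toR U hU0
  have pZ := toR Z hZ0
  simp only [cR] at hdom ⊢
  rw [← ENNReal.ofReal_mul (Real.exp_pos _).le,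
    ENNReal.ofReal_le_ofReal_iff (by positivity)] at hdom
  have key := neg_log_affinity_le (n := n) hα0 hα1 hA pL pL₀ pZ pU hm₁ hm₂ hdom
  have hLL : 0 < (L : ℝ) / L₀ := by positivity
  have h20 : (20 : ℝ≥0∞) = ENNReal.ofReal 20 := by simp
  have h21 : (21 : ℝ≥0∞) = ENNReal.ofReal 21 := by simp
  rw [h20, h21, ← ENNReal.ofReal_div_of_pos pL₀, ← ENNReal.ofReal_div_of_pos pL₀,
    ENNReal.ofReal_rpow_of_pos hLL, ← ENNReal.ofReal_pow hA.le,
    ← ENNReal.ofReal_inv_of_pos (by positivity), ← ENNReal.ofReal_inv_of_pos pZ]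
  have e1 : (0 : ℝ) ≤ (L / L₀ : ℝ) ^ α := (Real.rpow_pos_of_pos hLL _).le
  have e2 : (0 : ℝ) ≤ 20 * m₁ + 21 * m₂ := by positivity
  rw [← ENNReal.ofReal_mul (by positivity), ← ENNReal.ofReal_mul (by positivity),
    ← ENNReal.ofReal_mul (by positivity), ← ENNReal.ofReal_mul (by positivity),
    ← ENNReal.ofReal_mul (by positivity), ← ENNReal.ofReal_mul (by positivity),
    ← ENNReal.ofReal_mul (by positivity), ← ENNReal.ofReal_mul (by positivity),
    ← ENNReal.ofReal_add (by positivity) (by positivity),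
    ← ENNReal.ofReal_mul (by positivity),
    ← ENNReal.ofReal_add (by positivity) (by positivity),
    ← ENNReal.ofReal_add (by positivity) (by positivity),
    ← ENNReal.ofReal_mul (by positivity),
    ← ENNReal.ofReal_add (by positivity) (by positivity)]
  refine ENNReal.ofReal_le_ofReal ?_
  have hexp : Real.exp (21 / 20 * g - m₁) = Real.exp (-m₁) * Real.exp (21 / 20 * g) := by
    rw [← Real.exp_add]; congr 1; ring
  rw [hexp] at key
  refine (mul_le_mul_of_nonneg_left key pL.le).trans (le_of_eq ?_)
  field_simp

/-- `R` is not assumed measurable, so only this direction of the density formula is available; it is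
the one needed. -/
theorem lintegral_posterior_le {n d : ℕ} (π : Measure (Vec d × ℝ)) (z : Fin n → Obs d)
    (R : Vec d × ℝ → ℝ≥0∞) :
    ∫⁻ p, R p ∂(posterior π z) ≤ (evidence π z)⁻¹ * ∫⁻ p, likelihood z p.1 p.2 * R p ∂π := by
  have hm : Measurable fun p : Vec d × ℝ => likelihood z p.1 p.2 :=
    measurable_likelihood_comp measurable_const measurable_fst measurable_snd
  rw [posterior, normalizeMeasure, lintegral_smul_measure, withDensity_apply _ MeasurableSet.univ,
    Measure.restrict_univ, smul_eq_mul]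
  exact mul_le_mul_right (lintegral_withDensity_le_lintegral_mul _ hm _) _

theorem lintegral_posterior_renyiDiv_le {n d : ℕ} (hn : 0 < n) (hd : 0 < d) {Cx K β : ℝ} (hCx : 0 < Cx)
    (hK : 0 < K) (hβ : 0 < β) (ν : Measure (Vec d)) [IsProbabilityMeasure ν] {α : ℝ}
    (hα0 : 0 < α) (hα1 : α < 1) (θ₀ : Vec d) {σ₀ : ℝ} (hσ₀ : 0 < σ₀) (z : Fin n → Obs d)
    (π : Measure (Vec d × ℝ)) (hπ : ∀ᵐ p ∂π, 0 < p.2) {m₁ m₂ : ℝ} (hm₁ : 0 ≤ m₁) (hm₂ : 0 ≤ m₂)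
    (hE : ∫⁻ p, ENNReal.ofReal (Real.exp (21 / 20 * excess Cx K β z p.1 p.2)) ∂π
      ≤ ENNReal.ofReal (Real.exp m₁)) :
    ENNReal.ofReal (n * (1 - α)) *
        ∫⁻ p, renyiDiv α (model ν p.1 p.2) (model ν θ₀ σ₀) ∂(posterior π z)
      ≤ (∫⁻ p, (affinity ν α θ₀ σ₀ p ^ n)⁻¹ * (likelihood z p.1 p.2 / likelihood z θ₀ σ₀) ^ α ∂π)
        + 20 + (ENNReal.ofReal (20 * m₁ + 21 * m₂)
          + 21 * (mixLik Cx K β z / likelihood z θ₀ σ₀)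
          + 21 * (likelihood z θ₀ σ₀ * (evidence π z)⁻¹ * ENNReal.ofReal (Real.exp (-m₂)))) := by
  have hLm : Measurable fun p : Vec d × ℝ => likelihood z p.1 p.2 :=
    measurable_likelihood_comp measurable_const measurable_fst measurable_snd
  set Z := evidence π z with hZ
  have hev : π.withDensity (fun p => likelihood z p.1 p.2) Set.univ = Z := by
    rw [withDensity_apply _ MeasurableSet.univ, Measure.restrict_univ, hZ, evidence]
  -- For evidence `0` or `∞` the normalized measure is zero and the bound is trivial.
  by_cases hZ0 : Z = 0
  · have : posterior π z = 0 := by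
      rw [posterior, normalizeMeasure, Measure.measure_univ_eq_zero.1 (hev.trans hZ0), smul_zero]
    simp [this]
  by_cases hZt : Z = ∞
  · have : posterior π z = 0 := by
      rw [posterior, normalizeMeasure, hev, hZt, ENNReal.inv_top, zero_smul]
    simp [this]
  set k := ENNReal.ofReal (20 * m₁ + 21 * m₂) + 21 * (mixLik Cx K β z / likelihood z θ₀ σ₀)
    + 21 * (likelihood z θ₀ σ₀ * Z⁻¹ * ENNReal.ofReal (Real.exp (-m₂))) with hk
  set q : Vec d × ℝ → ℝ≥0∞ := fun p =>
    (affinity ν α θ₀ σ₀ p ^ n)⁻¹ * (likelihood z p.1 p.2 / likelihood z θ₀ σ₀) ^ α with hq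
  set t : Vec d × ℝ → ℝ≥0∞ := fun p =>
    ENNReal.ofReal (Real.exp (21 / 20 * excess Cx K β z p.1 p.2)) with ht
  have hqm : Measurable q := ((measurable_affinity ν α θ₀ σ₀).pow_const n).inv.mul
    ((hLm.div_const _).pow_const α)
  rw [← lintegral_const_mul' _ _ ENNReal.ofReal_ne_top]
  refine (lintegral_posterior_le π z _).trans ?_
  calc _ ≤ Z⁻¹ * ∫⁻ p, (Z * (q p + 20 * (ENNReal.ofReal (Real.exp (-m₁)) * t p))
          + likelihood z p.1 p.2 * k) ∂π := by
        refine mul_le_mul_right (lintegral_mono_ae ?_) _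
        filter_upwards [hπ] with p hp
        exact renyiDiv_mul_likelihood_le hn hd hCx hK hβ ν hα0 hα1 θ₀ hσ₀ z hZ0 hZt hm₁ hm₂ p hp
    _ = Z⁻¹ * (Z * ((∫⁻ p, q p ∂π) + 20 * (ENNReal.ofReal (Real.exp (-m₁)) * ∫⁻ p, t p ∂π))
          + Z * k) := by
        rw [lintegral_add_right _ (hLm.mul_const k), lintegral_mul_const _ hLm,
          lintegral_const_mul' _ _ hZt, lintegral_add_left hqm, lintegral_const_mul' _ _ (by norm_num),
          lintegral_const_mul' _ _ ENNReal.ofReal_ne_top]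
        rfl
    _ = (∫⁻ p, q p ∂π) + 20 * (ENNReal.ofReal (Real.exp (-m₁)) * ∫⁻ p, t p ∂π) + k := by
        rw [← mul_add, ← mul_assoc, ENNReal.inv_mul_cancel hZ0 hZt, one_mul]
    _ ≤ _ := by
        gcongr
        calc 20 * (ENNReal.ofReal (Real.exp (-m₁)) * ∫⁻ p, t p ∂π)
            ≤ 20 * (ENNReal.ofReal (Real.exp (-m₁)) * ENNReal.ofReal (Real.exp m₁)) := by gcongr
          _ = 20 := by
            rw [← ENNReal.ofReal_mul (Real.exp_pos _).le, ← Real.exp_add]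
            simp

/-- The average over the data of the normalized fractional likelihood ratios. -/
theorem lintegral_fractional_le {n d : ℕ} (ν : Measure (Vec d)) [IsProbabilityMeasure ν] {α : ℝ}
    (hα0 : 0 < α) (hα1 : α < 1) (θ₀ : Vec d) {σ₀ : ℝ} (hσ₀ : 0 < σ₀)
    (π : Measure (Vec d × ℝ)) [SFinite π] :
    ∫⁻ z, ∫⁻ p, (affinity ν α θ₀ σ₀ p ^ n)⁻¹ * (likelihood z p.1 p.2 / likelihood z θ₀ σ₀) ^ α ∂π
        ∂(Measure.pi fun _ : Fin n => model ν θ₀ σ₀) ≤ π Set.univ := by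
  have hL : Measurable fun q : (Fin n → Obs d) × (Vec d × ℝ) => likelihood q.1 q.2.1 q.2.2 :=
    measurable_likelihood_comp measurable_fst measurable_snd.fst measurable_snd.snd
  have hL₀ : Measurable fun z : Fin n → Obs d => likelihood z θ₀ σ₀ :=
    measurable_likelihood_comp measurable_id measurable_const measurable_const
  have hA := measurable_affinity ν α θ₀ σ₀
  have hj : Measurable fun q : (Fin n → Obs d) × (Vec d × ℝ) =>
      (affinity ν α θ₀ σ₀ q.2 ^ n)⁻¹ * (likelihood q.1 q.2.1 q.2.2 / likelihood q.1 θ₀ σ₀) ^ α :=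
    ((hA.comp measurable_snd).pow_const n).inv.mul ((hL.div (hL₀.comp measurable_fst)).pow_const α)
  have hF : Measurable fun z : Fin n → Obs d => ∫⁻ p,
      (affinity ν α θ₀ σ₀ p ^ n)⁻¹ * (likelihood z p.1 p.2 / likelihood z θ₀ σ₀) ^ α ∂π :=
    hj.lintegral_prod_right'
  have hj2 : Measurable fun q : (Fin n → Obs d) × (Vec d × ℝ) => (affinity ν α θ₀ σ₀ q.2 ^ n)⁻¹ *
      (likelihood q.1 q.2.1 q.2.2 ^ α * likelihood q.1 θ₀ σ₀ ^ (1 - α)) :=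
    ((hA.comp measurable_snd).pow_const n).inv.mul
      ((hL.pow_const α).mul ((hL₀.comp measurable_fst).pow_const (1 - α)))
  rw [lintegral_pi_model ν θ₀ hσ₀ hF]
  have h1 : ∀ z : Fin n → Obs d, likelihood z θ₀ σ₀ * ∫⁻ p,
      (affinity ν α θ₀ σ₀ p ^ n)⁻¹ * (likelihood z p.1 p.2 / likelihood z θ₀ σ₀) ^ α ∂π
      = ∫⁻ p, (affinity ν α θ₀ σ₀ p ^ n)⁻¹ *
        (likelihood z p.1 p.2 ^ α * likelihood z θ₀ σ₀ ^ (1 - α)) ∂π := by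
    intro z
    have h0 := likelihood_ne_zero z θ₀ hσ₀
    have ht := likelihood_ne_top z θ₀ σ₀
    rw [← lintegral_const_mul' _ _ ht]
    refine lintegral_congr fun p => ?_
    rw [ENNReal.div_rpow_of_nonneg _ _ hα0.le, ENNReal.rpow_sub _ _ h0 ht, ENNReal.rpow_one,
      div_eq_mul_inv, div_eq_mul_inv]
    ring
  simp_rw [h1]
  have hpow := lintegral_likelihood_rpow (n := n) ν hα0 hα1 θ₀ σ₀
  have hs : SigmaFinite ((volume : Measure ℝ).prod ν) := inferInstance
  generalize (volume : Measure ℝ).prod ν = ρ at hs hpow ⊢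
  rw [lintegral_lintegral_swap hj2.aemeasurable, ← lintegral_one]
  refine lintegral_mono fun p => ?_
  have hmp : Measurable fun z : Fin n → Obs d =>
      likelihood z p.1 p.2 ^ α * likelihood z θ₀ σ₀ ^ (1 - α) :=
    ((measurable_likelihood_comp measurable_id measurable_const measurable_const).pow_const α).mul
      (hL₀.pow_const (1 - α))
  rw [lintegral_const_mul _ hmp, hpow p]
  exact ENNReal.inv_mul_le_one _

/-- The compensators `m₁` and `m₂` are affine in the design size, so their expectation reduces to
its mean. The other random terms have bounded expectation, and `n · rate ≥ 1` absorbs the constants.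
-/
theorem exists_posterior_risk_le {a b l u : ℝ} (ha : 0 < a) (hb : 0 < b) (hl : 0 < l) :
    ∃ C : ℝ, 0 < C ∧ ∀ (n d : ℕ) (ν : Measure (Vec d)) (Cx C₁ σ₀ α : ℝ) (θ₀ : Vec d),
      IsProbabilityMeasure ν → 0 < Cx → ∫⁻ x, ‖x‖ₑ ^ 2 ∂ν < ENNReal.ofReal (Cx ^ 2) →
      0 < σ₀ → l ≤ σ₀ ^ 2 → σ₀ ^ 2 ≤ u → 0 < α → α < 1 → n < d →
      1 ≤ l0norm θ₀ → l0norm θ₀ < n → l1norm θ₀ ≤ C₁ - 2 * d * tau n d Cx →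
      ENNReal.ofReal (n * (1 - α)) * ∫⁻ z, ∫⁻ p, renyiDiv α (model ν p.1 p.2) (model ν θ₀ σ₀)
          ∂(posterior (prior d (tau n d Cx) C₁ a b) z)
          ∂(Measure.pi fun _ : Fin n => model ν θ₀ σ₀)
        ≤ ENNReal.ofReal (C * (n * rate n d (l0norm θ₀) Cx C₁)) := by
  have : Fact (0 < a) := ⟨ha⟩
  have : Fact (0 < b) := ⟨hb⟩
  obtain ⟨C₂, hC₂, hP⟩ := exists_priorSigma_univ_le ha hb
  obtain ⟨C₃, hC₃, hX⟩ := exists_lintegral_exp_excess_prior ha hb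
  obtain ⟨C₄, hC₄, hEv⟩ := exists_lintegral_inv_evidence_le (u := u) ha hb hl
  refine ⟨C₂ + 62 + 84 + 63 * C₄ + 2 * (60 * C₃ + 21 * C₄), by positivity,
    fun n d ν Cx C₁ σ₀ α θ₀ hν hCx hνx hσ₀ hlσ hσu hα0 hα1 hnd hs hsn hC => ?_⟩
  have hn : 0 < n := by omega
  have hd : 0 < d := by omega
  have hn' : (0 : ℝ) < n := by exact_mod_cast hn
  have hd' : (1 : ℝ) ≤ d := by exact_mod_cast hd
  have hτ : 0 < tau n d Cx := by unfold tau; positivity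
  obtain ⟨hr1, hr2, hr3⟩ := rate_bounds hCx hnd hs hsn hC
  set Λ := n * rate n d (l0norm θ₀) Cx C₁ with hΛ
  have hC₁ : 2 * d * tau n d Cx ≤ C₁ := by linarith [l1norm_nonneg θ₀]
  have hp := isProbabilityMeasure_priorTheta hd hτ hC₁
  set π := prior d (tau n d Cx) C₁ a b with hπ
  have hπf : IsFiniteMeasure π := by rw [hπ, prior]; infer_instance
  have hπu : π Set.univ ≤ ENNReal.ofReal C₂ := by
    rw [hπ, prior, ← Set.univ_prod_univ, Measure.prod_prod, measure_univ, one_mul]; exact hP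
  have hπpos : ∀ᵐ p ∂π, 0 < p.2 := by
    rw [hπ, prior]
    exact Measure.quasiMeasurePreserving_snd.ae (ae_priorSigma_pos a b)
  set G := Measure.pi fun _ : Fin n => model ν θ₀ σ₀ with hG
  set K := 4 / b with hK
  set β := min a 1 / 4 with hβ
  have hK0 : 0 < K := by positivity
  have hβ0 : 0 < β := by have : 0 < min a 1 := lt_min ha one_pos
                         positivity
  have hlog : 0 ≤ Real.log (32 * d) := Real.log_nonneg (by linarith)
  have hD : 0 ≤ shiftCost (tau n d Cx) θ₀ := Finset.sum_nonneg fun i _ =>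
    mul_nonneg (by norm_num) (Real.log_nonneg (by have : 0 ≤ |θ₀ i| / tau n d Cx := by positivity
                                                  linarith))
  set m₁ : (Fin n → Obs d) → ℝ := fun z => C₃ * (Real.log (32 * d) * designSize Cx z) with hm₁
  set m₂ : (Fin n → Obs d) → ℝ := fun z => shiftCost (tau n d Cx) θ₀ +
    C₄ * (Real.log (32 * d) + designSize Cx z) with hm₂
  have hW0 : ∀ z : Fin n → Obs d, 0 ≤ designSize Cx z := fun z =>
    zero_le_one.trans (one_le_designSize Cx z)
  have hm₁0 : ∀ z, 0 ≤ m₁ z := fun z => by have := hW0 z; simp only [hm₁]; positivity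
  have hm₂0 : ∀ z, 0 ≤ m₂ z := fun z => by have := hW0 z; simp only [hm₂]; positivity
  have hL₀ : Measurable fun z : Fin n → Obs d => likelihood z θ₀ σ₀ :=
    measurable_likelihood_comp measurable_id measurable_const measurable_const
  have hWm := measurable_designSize (n := n) (d := d) Cx
  have hUm : Measurable fun z : Fin n → Obs d => mixLik Cx K β z / likelihood z θ₀ σ₀ :=
    (measurable_mixLik Cx K β).div hL₀
  have hm₂m : Measurable m₂ := ((hWm.const_add _).const_mul C₄).const_add _
  have hZm : Measurable fun z : Fin n → Obs d => likelihood z θ₀ σ₀ * (evidence π z)⁻¹ *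
      ENNReal.ofReal (Real.exp (-m₂ z)) :=
    (hL₀.mul (measurable_evidence π).inv).mul hm₂m.neg.exp.ennreal_ofReal
  -- From `20 m₁ + 21 m₂`: `84 = 21·4` from the shift cost, `63 = 21·3` and `60 = 20·3` from
  -- `log(32d) ≤ 3Λ`. The `62` in the constant is `20 + 21 + 21`.
  set c₁ := 84 * Λ + 63 * C₄ * Λ with hc₁
  set c₂ := (60 * C₃ + 21 * C₄) * Λ with hc₂
  have hc₁0 : 0 ≤ c₁ := by positivity
  have hc₂0 : 0 ≤ c₂ := by positivity
  have hmm : ∀ z, ENNReal.ofReal (20 * m₁ z + 21 * m₂ z)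
      ≤ ENNReal.ofReal c₁ + ENNReal.ofReal c₂ * ENNReal.ofReal (designSize Cx z) := by
    intro z
    rw [← ENNReal.ofReal_mul hc₂0, ← ENNReal.ofReal_add hc₁0 (mul_nonneg hc₂0 (hW0 z))]
    refine ENNReal.ofReal_le_ofReal ?_
    have f1 : Real.log (32 * d) * designSize Cx z ≤ 3 * Λ * designSize Cx z :=
      mul_le_mul_of_nonneg_right hr2 (hW0 z)
    have f2 : designSize Cx z ≤ Λ * designSize Cx z := le_mul_of_one_le_left (hW0 z) hr1
    have g1 := mul_le_mul_of_nonneg_left f1 hC₃.le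
    have g2 := mul_le_mul_of_nonneg_left f2 hC₄.le
    have g3 := mul_le_mul_of_nonneg_left hr2 hC₄.le
    simp only [hm₁, hm₂, hc₁, hc₂]
    linarith
  rw [← lintegral_const_mul' _ _ ENNReal.ofReal_ne_top]
  calc _ ≤ ∫⁻ z, (((∫⁻ p, (affinity ν α θ₀ σ₀ p ^ n)⁻¹ *
            (likelihood z p.1 p.2 / likelihood z θ₀ σ₀) ^ α ∂π) + 20) +
          ((ENNReal.ofReal c₁ + ENNReal.ofReal c₂ * ENNReal.ofReal (designSize Cx z)) +
          21 * (mixLik Cx K β z / likelihood z θ₀ σ₀) +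
          21 * (likelihood z θ₀ σ₀ * (evidence π z)⁻¹ * ENNReal.ofReal (Real.exp (-m₂ z))))) ∂G := by
        refine lintegral_mono fun z => ?_
        refine (lintegral_posterior_renyiDiv_le hn hd hCx hK0 hβ0 ν hα0 hα1 θ₀ hσ₀ z π hπpos
          (hm₁0 z) (hm₂0 z) (hX n d Cx C₁ z hn hnd hCx hC₁)).trans ?_
        gcongr
        exact hmm z
    _ = (∫⁻ z, ∫⁻ p, (affinity ν α θ₀ σ₀ p ^ n)⁻¹ *
            (likelihood z p.1 p.2 / likelihood z θ₀ σ₀) ^ α ∂π ∂G) + 20 +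
          (ENNReal.ofReal c₁ + ENNReal.ofReal c₂ * (∫⁻ z, ENNReal.ofReal (designSize Cx z) ∂G) +
          21 * (∫⁻ z, mixLik Cx K β z / likelihood z θ₀ σ₀ ∂G) +
          21 * ∫⁻ z, (likelihood z θ₀ σ₀ * (evidence π z)⁻¹ *
            ENNReal.ofReal (Real.exp (-m₂ z))) ∂G) := by
        have hKm : Measurable fun z : Fin n → Obs d =>
            (ENNReal.ofReal c₁ + ENNReal.ofReal c₂ * ENNReal.ofReal (designSize Cx z)) +
            21 * (mixLik Cx K β z / likelihood z θ₀ σ₀) +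
            21 * (likelihood z θ₀ σ₀ * (evidence π z)⁻¹ * ENNReal.ofReal (Real.exp (-m₂ z))) :=
          ((measurable_const.add (hWm.ennreal_ofReal.const_mul _)).add (hUm.const_mul _)).add
            (hZm.const_mul _)
        rw [lintegral_add_right _ hKm,
          lintegral_add_right _ measurable_const, lintegral_add_right _ (hZm.const_mul _),
          lintegral_add_right _ (hUm.const_mul _),
          lintegral_add_right _ (hWm.ennreal_ofReal.const_mul _), lintegral_const_mul _ hZm,
          lintegral_const_mul _ hUm, lintegral_const_mul _ hWm.ennreal_ofReal]
        simp
    _ ≤ ENNReal.ofReal C₂ + 20 + (ENNReal.ofReal c₁ + ENNReal.ofReal c₂ * 2 + 21 * 1 + 21 * 1) := by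
        gcongr
        · exact (lintegral_fractional_le ν hα0 hα1 θ₀ hσ₀ π).trans hπu
        · exact lintegral_designSize_le hn hCx hνx θ₀ σ₀
        · exact lintegral_mixLik_div_le hn hd Cx hK0 hβ0 ν θ₀ hσ₀
        · exact hEv n d ν Cx C₁ σ₀ θ₀ hν hn hnd hCx hσ₀ hlσ hσu hC
    _ = ENNReal.ofReal (C₂ + 62 + (c₁ + 2 * c₂)) := by
        have h2c : 0 ≤ 2 * c₂ := by linarith
        have h62 : (0 : ℝ) ≤ 62 := by norm_num
        rw [ENNReal.ofReal_add (add_nonneg hC₂.le h62) (add_nonneg hc₁0 h2c),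
          ENNReal.ofReal_add hC₂.le h62, ENNReal.ofReal_add hc₁0 h2c, ENNReal.ofReal_mul two_pos.le]
        simp only [ENNReal.ofReal_ofNat]
        ring
    _ ≤ _ := by
        refine ENNReal.ofReal_le_ofReal ?_
        have : C₂ + 62 ≤ (C₂ + 62) * Λ := le_mul_of_one_le_right (by positivity) hr1
        simp only [hc₁, hc₂]
        linarith

end SparseRegression

/-! ### The main theorem -/

theorem mainTheorem5 (σmin σmax a b : ℝ) (hσmin : 0 < σmin) (hσmax : 0 < σmax)
    (ha : 0 < a) (hb : 0 < b) :
    ∃ c : ℝ, 0 < c ∧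
      ∀ (n d : ℕ) (ν : Measure (SparseRegression.Vec d)) (Cx C₁ σ₀ α : ℝ)
        (θ₀ : SparseRegression.Vec d) (Θ : Set (SparseRegression.Vec d)),
        IsProbabilityMeasure ν →
        0 < Cx →
        ∫⁻ x, ‖x‖ₑ ^ 2 ∂ν < ENNReal.ofReal (Cx ^ 2) →
        0 < σ₀ →
        (2 * σmin)⁻¹ < σ₀ ^ 2 →
        σ₀ ^ 2 < (2 * σmax)⁻¹ →
        0 < α →
        α < 1 →
        n < d →
        1 ≤ SparseRegression.l0norm θ₀ →
        SparseRegression.l0norm θ₀ < n →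
        SparseRegression.l1norm θ₀ ≤ C₁ - 2 * d * SparseRegression.tau n d Cx →
        θ₀ ∉ Θ →
        ∫⁻ z : Fin n → SparseRegression.Obs d,
            (∫⁻ p : SparseRegression.Vec d × ℝ,
              SparseRegression.renyiDiv α (SparseRegression.model ν p.1 p.2)
                (SparseRegression.model ν θ₀ σ₀)
              ∂(SparseRegression.posterior
                (SparseRegression.prior d (SparseRegression.tau n d Cx) C₁ a b) z))
            ∂(Measure.pi fun _ : Fin n => SparseRegression.model ν θ₀ σ₀)
          ≤ ENNReal.ofReal (α / (1 - α)) *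
              (⨅ θ ∈ Θ, InformationTheory.klDiv (SparseRegression.model ν θ₀ σ₀)
                (SparseRegression.model ν θ σ₀))
            + ENNReal.ofReal ((1 + α) / (1 - α) *
                (c * SparseRegression.rate n d (SparseRegression.l0norm θ₀) Cx C₁)) := by
  obtain ⟨C, hC, h⟩ := SparseRegression.exists_posterior_risk_le (u := (2 * σmax)⁻¹) ha hb
    (inv_pos.2 (mul_pos two_pos hσmin))
  refine ⟨C, hC, fun n d ν Cx C₁ σ₀ α θ₀ Θ hν hCx hνx hσ₀ hl hu hα0 hα1 hnd hs hsn hθ₀ _ => ?_⟩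
  -- The rate term alone dominates, with factor `1/(1-α) ≤ (1+α)/(1-α)`.
  refine le_trans ?_ le_add_self
  have hn : (0 : ℝ) < n := by exact_mod_cast (by omega : 0 < n)
  have hr := (SparseRegression.rate_bounds hCx hnd hs hsn hθ₀).1
  have hα : 0 < 1 - α := by linarith
  have key := h n d ν Cx C₁ σ₀ α θ₀ hν hCx hνx hσ₀ hl.le hu.le hα0 hα1 hnd hs hsn hθ₀
  set r := SparseRegression.rate n d (SparseRegression.l0norm θ₀) Cx C₁
  have hr0 : 0 < r := pos_of_mul_pos_right (one_pos.trans_le hr) hn.le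
  have hk : 0 < n * (1 - α) := by positivity
  rw [mul_comm, ← ENNReal.le_div_iff_mul_le (Or.inl (ENNReal.ofReal_pos.2 hk).ne')
    (Or.inl ENNReal.ofReal_ne_top), ← ENNReal.ofReal_div_of_pos hk] at key
  refine key.trans (ENNReal.ofReal_le_ofReal ?_)
  have e : C * (n * r) / (n * (1 - α)) = 1 / (1 - α) * (C * r) := by field_simp
  rw [e]
  gcongr
  linarith
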